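/- Let $H=\frac12(x^2-\partial_x^2)$ on $L^2(\mathbb R)$. For $a,k,\varphi\in\mathbb R$ and $z=a-ik$ put $T_zu(x)=e^{ikx-iak/2}u(x-a)$ and $R_\varphi=e^{i(1/2-H)\varphi}$. On $\mathscr H=L^2(\mathbb R,\mathbb C^2)$, graded by $\gamma=\mathrm{diag}(1,-1)$, let $T_z(u,v)=(T_zu,T_zv)$, $\mathbf R_\varphi(u,v)=(R_\varphi u,e^{-i\varphi}R_\varphi v)$ (this depends only on $e^{i\varphi}$), let $\mathscr A$ be the algebra generated by all $T_z$ and $\mathbf R_\varphi$, and let $$D=\frac1{\sqrt2}\begin{pmatrix}0&x-\partial_x\\x+\partial_x&0\end{pmatrix}$$ on the Schwartz space $\mathcal S(\mathbb R,\mathbb C^2)$. Write $\operatorname{tr}_s(B)=\operatorname{tr}(\gamma B)$, write $B^{[j]}$ for the $j$-th iterated commutator of $B$ with $D^2$, and let $|D|^{-2s}$ mean $(D^2+P)^{-s}$, where $P$ is the orthogonal projection onto $\ker D$. The components $\Psi_0,\Psi_2$ of the Connes–Moscovici cocycle of $(\mathscr A,\mathscr H,D)$ are $$\Psi_0(a_0)=\operatorname{Res}_{z=0}z^{-1}\operatorname{tr}_s(a_0|D|^{-2z}),$$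 $$\Psi_2(a_0,a_1,a_2)=\sum_{\alpha\in\mathbb N^2}\frac{(-1)^{|\alpha|}\,\Gamma(|\alpha|+1)}{\alpha!\,(\alpha_1+1)(\alpha_1+\alpha_2+2)}\operatorname{Res}_{z=0}\operatorname{tr}_s\bigl(a_0[D,a_1]^{[\alpha_1]}[D,a_2]^{[\alpha_2]}|D|^{-2(|\alpha|+1+z)}\bigr),$$ where each supertrace is defined and holomorphic for $\operatorname{Re}z$ large, and the residue is that of its meromorphic continuation to $\mathbb C$. **Theorem.** For the arguments below these continuations exist, and the components are as follows. (1) For $z=a-ik$ with $a,k\in\mathbb R$, and $\varphi\in\mathbb R$, $$\Psi_0(T_z\mathbf R_\varphi)=\begin{cases}0&\text{if }\varphi\in2\pi\mathbb Z,\ z\ne0,\\1&\text{if }\varphi\in2\pi\mathbb Z,\ z=0,\\\exp\bigl(\frac i4(a^2+k^2)\cot(\varphi/2)\bigr)&\text{if }\varphi\notin2\pi\mathbb Z.\end{cases}$$ (2) For $z_0,z_1,z_2\in\mathbb C$ and $\varphi_0,\varphi_1,\varphi_2\in\mathbb R$, the number $\Psi_2(T_{z_0}\mathbf R_{\varphi_0},T_{z_1}\mathbf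 R_{\varphi_1},T_{z_2}\mathbf R_{\varphi_2})$ is $0$ if $\varphi_0+\varphi_1+\varphi_2\notin2\pi\mathbb Z$ or $z_0+e^{i\varphi_0}z_1+e^{i(\varphi_0+\varphi_1)}z_2\ne0$, and otherwise it is $$\frac{e^{i\varepsilon}}4\bigl(z_1\bar z_2e^{-i\varphi_1}-\bar z_1z_2e^{i\varphi_1}\bigr),\qquad \varepsilon=\tfrac12\operatorname{Im}\bigl(e^{i\varphi_0}z_1\bar z_0+e^{i\varphi_1}z_2\bar z_1+e^{i(\varphi_0+\varphi_1)}z_2\bar z_0\bigr).$$ -/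

import Mathlib

open MeasureTheory Filter Topology
open scoped SchwartzMap ENNReal

/-! ### Unbounded operators on a Hilbert space -/

namespace UnbOp

universe u

variable {V : Type u} [NormedAddCommGroup V] [InnerProductSpace ℂ V]

/-- The composition `A ∘ B` of two unbounded operators, on its natural domain
`{u ∈ dom B | B u ∈ dom A}`. -/
def comp (A B : V →ₗ.[ℂ] V) : V →ₗ.[ℂ] V where
  domain := (A.domain.comap B.toFun).map B.domain.subtype
  toFun :=
    { toFun := fun u => A ⟨B ⟨u, by obtain ⟨w, -, hw⟩ := u.2; rw [← hw]; exact w.2⟩, by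
        obtain ⟨u, w, hw, rfl⟩ := u; exact hw⟩
      map_add' := by
        intro u v
        rw [← LinearPMap.map_add]
        congr 1
        apply Subtype.ext
        exact LinearPMap.map_add B ⟨u, _⟩ ⟨v, _⟩
      map_smul' := by
        intro c u
        rw [RingHom.id_apply, ← LinearPMap.map_smul]
        congr 1
        apply Subtype.ext
        exact LinearPMap.map_smul B c ⟨u, _⟩ }

theorem mem_comp_domain {A B : V →ₗ.[ℂ] V} {u : V} :
    u ∈ (comp A B).domain ↔ ∃ h : u ∈ B.domain, B ⟨u, h⟩ ∈ A.domain := by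
  constructor
  · rintro ⟨w, hw, rfl⟩
    exact ⟨w.2, hw⟩
  · rintro ⟨h, h'⟩
    exact ⟨⟨u, h⟩, h', rfl⟩

theorem comp_apply {A B : V →ₗ.[ℂ] V} {u : V} (h : u ∈ B.domain) (h' : B ⟨u, h⟩ ∈ A.domain) :
    comp A B ⟨u, mem_comp_domain.2 ⟨h, h'⟩⟩ = A ⟨B ⟨u, h⟩, h'⟩ := rfl

/-- A bounded operator, seen as an unbounded operator with full domain. -/
def ofBounded (B : V →L[ℂ] V) : V →ₗ.[ℂ] V := B.toLinearMap.toPMap ⊤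

/-- The commutator `[A, B] = A B - B A` on its natural domain. -/
noncomputable def commutator (A B : V →ₗ.[ℂ] V) : V →ₗ.[ℂ] V := comp A B - comp B A

/-- The iterated commutator `[A, [A, … [A, B]]]`, with `j` brackets. -/
noncomputable def iterCommutator (A B : V →ₗ.[ℂ] V) : ℕ → (V →ₗ.[ℂ] V)
  | 0 => B
  | j + 1 => commutator A (iterCommutator A B j)

/-- The product `B₁ B₂ ⋯ B_m` of a finite list of operators (the identity if the list is empty). -/
noncomputable def prod (L : List (V →ₗ.[ℂ] V)) : V →ₗ.[ℂ] V :=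
  L.foldr comp (ofBounded (ContinuousLinearMap.id ℂ V))

/-! ### Functions of a symmetric operator with pure point spectrum -/

/-- The space of `u ∈ dom A` with `A u = μ u`. -/
def eigenspace (A : V →ₗ.[ℂ] V) (μ : ℝ) : Submodule ℂ V where
  carrier := {u | ∃ h : u ∈ A.domain, A ⟨u, h⟩ = (μ : ℂ) • u}
  zero_mem' := ⟨A.domain.zero_mem, by rw [smul_zero]; exact A.map_zero⟩
  add_mem' := by
    rintro u v ⟨hu, hu'⟩ ⟨hv, hv'⟩
    refine ⟨A.domain.add_mem hu hv, ?_⟩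
    rw [smul_add, ← hu', ← hv']
    exact A.map_add ⟨u, hu⟩ ⟨v, hv⟩
  smul_mem' := by
    rintro c u ⟨hu, hu'⟩
    refine ⟨A.domain.smul_mem c hu, ?_⟩
    rw [smul_comm, ← hu']
    exact A.map_smul c ⟨u, hu⟩

variable [CompleteSpace V]

/-- The orthogonal projection onto the closed eigenspace of `A` for the value `μ`
(zero if `μ` is not an eigenvalue). -/
noncomputable def eigenProj (A : V →ₗ.[ℂ] V) (μ : ℝ) : V →L[ℂ] V :=
  (eigenspace A μ).topologicalClosure.starProjection

/-- The operator `f(A)`, for a symmetric operator `A` whose eigenvectors span a dense subspace: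
`f(A) u = ∑_μ f(μ) P_μ u`, where `P_μ` projects onto the eigenspace for `μ`, on the natural domain
where this orthogonal series converges. -/
noncomputable def functionOf (A : V →ₗ.[ℂ] V) (f : ℝ → ℂ) : V →ₗ.[ℂ] V where
  domain :=
    { carrier := {u | Summable fun μ : ℝ => f μ • eigenProj A μ u}
      zero_mem' := by simp
      add_mem' := by
        intro u v hu hv
        simpa [smul_add] using Summable.add hu hv
      smul_mem' := by
        intro c u hu
        simpa [smul_comm _ c] using Summable.const_smul c hu }
  toFun :=
    { toFun := fun u => ∑' μ : ℝ, f μ • eigenProj A μ u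
      map_add' := by
        intro u v
        rw [← Summable.tsum_add u.2 v.2]
        simp [smul_add]
      map_smul' := by
        intro c u
        rw [RingHom.id_apply, ← Summable.tsum_const_smul c u.2]
        simp [smul_comm _ c] }


theorem eigenProj_inner_eq_zero {A : V →ₗ.[ℂ] V} (hA : A.IsFormalAdjoint A) {μ ν : ℝ}
    (h : μ ≠ ν) (u v : V) : inner ℂ (eigenProj A μ u) (eigenProj A ν v) = 0 := by
  have hortho : eigenspace A μ ⟂ eigenspace A ν := by
    rw [Submodule.isOrtho_iff_inner_eq]
    rintro x ⟨hx, hx'⟩ y ⟨hy, hy'⟩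
    have h1 := hA ⟨x, hx⟩ ⟨y, hy⟩
    rw [hx', hy', inner_smul_left, inner_smul_right, Complex.conj_ofReal] at h1
    have h2 : ((μ : ℂ) - ν) * inner ℂ x y = 0 := by
      rw [sub_mul]; exact sub_eq_zero.2 h1
    rcases mul_eq_zero.1 h2 with h3 | h3
    · exact absurd (Complex.ofReal_injective (sub_eq_zero.1 h3)) h
    · exact h3
  have hclosed : (eigenspace A μ).topologicalClosure ⟂ (eigenspace A ν).topologicalClosure := by
    rw [Submodule.isOrtho_iff_le, Submodule.orthogonal_closure]
    exact Submodule.topologicalClosure_minimal _ hortho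
      (Submodule.isClosed_orthogonal _)
  exact Submodule.isOrtho_iff_inner_eq.1 hclosed _ (Submodule.starProjection_apply_mem _ _) _
    (Submodule.starProjection_apply_mem _ _)

theorem norm_sum_sq {A : V →ₗ.[ℂ] V} (hA : A.IsFormalAdjoint A) (f : ℝ → ℂ) (u : V)
    (s : Finset ℝ) :
    ‖∑ μ ∈ s, f μ • eigenProj A μ u‖ ^ 2 = ∑ μ ∈ s, ‖f μ‖ ^ 2 * ‖eigenProj A μ u‖ ^ 2 := by
  have h : (inner ℂ (∑ μ ∈ s, f μ • eigenProj A μ u) (∑ μ ∈ s, f μ • eigenProj A μ u) : ℂ)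
      = ((∑ μ ∈ s, ‖f μ‖ ^ 2 * ‖eigenProj A μ u‖ ^ 2 : ℝ) : ℂ) := by
    rw [sum_inner, Complex.ofReal_sum]
    refine Finset.sum_congr rfl fun μ hμ => ?_
    rw [inner_sum, Finset.sum_eq_single μ]
    · rw [inner_self_eq_norm_sq_to_K, norm_smul]
      simp [mul_pow]
    · intro ν _ hν
      rw [inner_smul_left, inner_smul_right, eigenProj_inner_eq_zero hA hν.symm]
      simp
    · exact fun h => absurd hμ h
  rw [← inner_self_eq_norm_sq (𝕜 := ℂ), h]
  exact Complex.ofReal_re _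

theorem sum_norm_sq_le {A : V →ₗ.[ℂ] V} (hA : A.IsFormalAdjoint A) (u : V) (s : Finset ℝ) :
    ∑ μ ∈ s, ‖eigenProj A μ u‖ ^ 2 ≤ ‖u‖ ^ 2 := by
  have h1 := norm_sum_sq hA (fun _ => 1) u s
  simp only [one_smul, norm_one, one_pow, one_mul] at h1
  have h2 : RCLike.re (inner ℂ (∑ μ ∈ s, eigenProj A μ u) u : ℂ)
      = ∑ μ ∈ s, ‖eigenProj A μ u‖ ^ 2 := by
    rw [sum_inner, map_sum]
    exact Finset.sum_congr rfl fun μ _ =>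
      Submodule.re_inner_starProjection_eq_normSq (K := (eigenspace A μ).topologicalClosure) u
  have h3 : ‖∑ μ ∈ s, eigenProj A μ u‖ ^ 2 ≤ ‖∑ μ ∈ s, eigenProj A μ u‖ * ‖u‖ := by
    rw [h1, ← h2]
    exact re_inner_le_norm _ _
  have h4 : ‖∑ μ ∈ s, eigenProj A μ u‖ ≤ ‖u‖ := by
    rcases (norm_nonneg (∑ μ ∈ s, eigenProj A μ u)).eq_or_lt with h | h
    · rw [← h]; exact norm_nonneg u
    · rw [sq] at h3
      exact le_of_mul_le_mul_left h3 h
  rw [← h1]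
  exact pow_le_pow_left₀ (norm_nonneg _) h4 2

theorem summable_of_bounded {A : V →ₗ.[ℂ] V} (hA : A.IsFormalAdjoint A) {f : ℝ → ℂ}
    (hf : ∀ μ, ‖f μ‖ ≤ 1) (u : V) : Summable fun μ : ℝ => f μ • eigenProj A μ u := by
  have hs : Summable fun μ : ℝ => ‖eigenProj A μ u‖ ^ 2 :=
    summable_of_sum_le (fun _ => by positivity) (sum_norm_sq_le hA u)
  rw [summable_iff_vanishing_norm] at hs ⊢
  intro ε hε
  obtain ⟨s, hs⟩ := hs (ε ^ 2) (by positivity)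
  refine ⟨s, fun t ht => ?_⟩
  refine lt_of_pow_lt_pow_left₀ 2 hε.le ?_
  rw [norm_sum_sq hA]
  refine lt_of_le_of_lt ?_ (lt_of_le_of_lt (le_abs_self _) (hs t ht))
  refine Finset.sum_le_sum fun μ _ => ?_
  exact mul_le_of_le_one_left (by positivity) (pow_le_one₀ (norm_nonneg _) (hf μ))

/-- The operator `f(A)` of `functionOf` as a bounded operator, if `|f| ≤ 1`. -/
noncomputable def boundedFunctionOf (A : V →ₗ.[ℂ] V) (hA : A.IsFormalAdjoint A) (f : ℝ → ℂ)
    (hf : ∀ μ, ‖f μ‖ ≤ 1) : V →L[ℂ] V :=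
  LinearMap.mkContinuous
    { toFun := fun u => functionOf A f ⟨u, summable_of_bounded hA hf u⟩
      map_add' := fun u v => (functionOf A f).map_add ⟨u, _⟩ ⟨v, _⟩
      map_smul' := fun c u => (functionOf A f).map_smul c ⟨u, _⟩ } 1 fun u => by
    refine le_of_tendsto (summable_of_bounded hA hf u).hasSum.norm (Eventually.of_forall fun s => ?_)
    rw [one_mul]
    refine le_of_sq_le_sq ?_ (norm_nonneg _)
    rw [norm_sum_sq hA]
    refine le_trans (Finset.sum_le_sum fun μ _ => ?_) (sum_norm_sq_le hA u s)
    exact mul_le_of_le_one_left (by positivity) (pow_le_one₀ (norm_nonneg _) (hf μ))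

/-! ### The trace -/

/-- A bounded operator is of trace class (nuclear) if it is an absolutely convergent sum of
operators of rank one. -/
def IsTraceClass (B : V →L[ℂ] V) : Prop :=
  ∃ x y : ℕ → V, Summable (fun n => ‖x n‖ * ‖y n‖) ∧
    ∀ u, HasSum (fun n => (inner ℂ (x n) u : ℂ) • y n) (B u)

/-- The densely defined operator `B` extends to a bounded operator of trace class on `V`, whose
trace, computed in any orthonormal basis, is `τ`. -/
def HasTrace (B : V →ₗ.[ℂ] V) (τ : ℂ) : Prop :=
  Dense (B.domain : Set V) ∧
    ∃ C : V →L[ℂ] V, (∀ u : B.domain, C u = B u) ∧ IsTraceClass C ∧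
      ∀ (ι : Type u) (b : HilbertBasis ι ℂ V), HasSum (fun i => (inner ℂ (b i) (C (b i)) : ℂ)) τ


/-! ### Zeta functions and the Connes-Moscovici cocycle -/

/-- The Laurent coefficient of index `-1` at `c` of a function holomorphic in a punctured
neighbourhood of `c`: `r = (2πi)⁻¹ ∮ f` over all small circles about `c`. -/
def HasResidue (f : ℂ → ℂ) (c r : ℂ) : Prop :=
  ∀ᶠ ρ in 𝓝[>] (0 : ℝ), (∮ z in C(c, ρ), f z) = 2 * Real.pi * Complex.I * r

/-- The operator `|D|^{-2s}`, that is `(D²)^{-s}`. On the kernel of `D`, where this is not defined,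
it is the identity: this is `(D² + P)^{-s}` with `P` the orthogonal projection onto `ker D`, the
usual convention for an operator `D` that is not invertible. -/
noncomputable def absPow (D : V →ₗ.[ℂ] V) (s : ℂ) : V →ₗ.[ℂ] V :=
  functionOf (comp D D) fun μ => if μ = 0 then 1 else (μ : ℂ) ^ (-s)

/-- `ζ` is the meromorphic continuation to the complex plane of the zeta function
`s ↦ tr_s (B |D|^{-2s}) = tr (γ B |D|^{-2s})`, which is defined and holomorphic for `Re s` large;
here `γ` is the grading operator. -/
def IsSuperZeta (γ : V →L[ℂ] V) (D B : V →ₗ.[ℂ] V) (ζ : ℂ → ℂ) : Prop :=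
  MeromorphicOn ζ Set.univ ∧ ∃ σ : ℝ, ∀ s : ℂ, σ < s.re →
    AnalyticAt ℂ ζ s ∧ HasTrace (comp (ofBounded γ) (comp B (absPow D s))) (ζ s)

/-- The number `Ψ₀(a) = Res_{z=0} z⁻¹ tr_s (a |D|^{-2z})` exists and is equal to `v`. -/
def IsPsiZero (γ : V →L[ℂ] V) (D : V →ₗ.[ℂ] V) {𝒜 : Subalgebra ℂ (V →L[ℂ] V)} (a : 𝒜) (v : ℂ) :
    Prop :=
  ∃ ζ : ℂ → ℂ, IsSuperZeta γ D (ofBounded (a : V →L[ℂ] V)) ζ ∧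
    HasResidue (fun z => z⁻¹ * ζ z) 0 v

/-- The operator `a₀ [D, a₁]^{[α₁]} ⋯ [D, a_m]^{[α_m]}`, where `B^{[j]}` is the `j`-th iterated
commutator of `B` with `D²`. -/
noncomputable def cochainOp (D : V →ₗ.[ℂ] V) {m : ℕ} (a : Fin (m + 1) → V →L[ℂ] V)
    (α : Fin m → ℕ) : V →ₗ.[ℂ] V :=
  comp (ofBounded (a 0)) (prod (List.ofFn fun j : Fin m =>
    iterCommutator (comp D D) (commutator D (ofBounded (a j.succ))) (α j)))

/-- The constant `c_{k,α} = (-1)^{|α|} Γ(|α| + k) / (α! (α₁+1)(α₁+α₂+2) ⋯ (α₁+⋯+α_{2k}+2k))`. -/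
noncomputable def cocycleCoeff (k : ℕ) (α : Fin (2 * k) → ℕ) : ℂ :=
  (-1) ^ (∑ j, α j) * Complex.Gamma (((∑ j, α j) + k : ℕ) : ℂ) /
    ((∏ j, ((α j).factorial : ℂ)) *
      ∏ j : Fin (2 * k), (((∑ i ∈ Finset.Iic j, α i) + (j.val + 1) : ℕ) : ℂ))

/-- For `k ≥ 1`, the number
`Ψ_{2k}(a₀, …, a_{2k}) =
  ∑_α c_{k,α} Res_{z=0} tr_s (a₀ [D, a₁]^{[α₁]} ⋯ [D, a_{2k}]^{[α_{2k}]} |D|^{-2(|α| + k + z)})`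
exists and is equal to `v`. -/
def IsPsi (γ : V →L[ℂ] V) (D : V →ₗ.[ℂ] V) (k : ℕ) {𝒜 : Subalgebra ℂ (V →L[ℂ] V)}
    (a : Fin (2 * k + 1) → 𝒜) (v : ℂ) : Prop :=
  ∃ r : (Fin (2 * k) → ℕ) → ℂ,
    (∀ α, ∃ ζ : ℂ → ℂ, IsSuperZeta γ D (cochainOp D (fun j => (a j : V →L[ℂ] V)) α) ζ ∧
      HasResidue (fun z => ζ (((∑ j, α j) + k : ℕ) + z)) 0 (r α)) ∧
    HasSum (fun α => cocycleCoeff k α * r α) v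

end UnbOp

/-! ### The Euler operator, Heisenberg-Weyl operators and metaplectic operators on the line -/

namespace Oscillator

open UnbOp

/-- The Hilbert space `L²(ℝ, F)`. -/
abbrev L2 (F : Type) [NormedAddCommGroup F] : Type := Lp F 2 (volume : Measure ℝ)

/-- `ℂ²` with its standard inner product. -/
abbrev C2 : Type := EuclideanSpace ℂ (Fin 2)

section

variable {F : Type} [NormedAddCommGroup F] [InnerProductSpace ℂ F] [NormedSpace ℝ F]
  [SMulCommClass ℝ ℂ F]

/-- The inclusion of the Schwartz space in `L²(ℝ, F)`. -/
noncomputable def incl (F : Type) [NormedAddCommGroup F] [InnerProductSpace ℂ F] [NormedSpace ℝ F]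
    [SMulCommClass ℝ ℂ F] : 𝓢(ℝ, F) →ₗ[ℂ] L2 F :=
  (SchwartzMap.toLpCLM ℂ F 2 (volume : Measure ℝ)).toLinearMap

theorem incl_injective : Function.Injective (incl F) :=
  SchwartzMap.injective_toLp 2 volume

/-- An operator on the Schwartz space, as an unbounded operator in `L²(ℝ, F)` with the Schwartz
space as its domain. -/
noncomputable def ofSchwartz (A : 𝓢(ℝ, F) →ₗ[ℂ] 𝓢(ℝ, F)) : L2 F →ₗ.[ℂ] L2 F where
  domain := LinearMap.range (incl F)
  toFun := incl F ∘ₗ A ∘ₗ (LinearEquiv.ofInjective (incl F) incl_injective).symm.toLinearMap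

theorem ofSchwartz_apply (A : 𝓢(ℝ, F) →ₗ[ℂ] 𝓢(ℝ, F)) (f : 𝓢(ℝ, F)) :
    ofSchwartz A ⟨incl F f, LinearMap.mem_range_self _ f⟩ = incl F (A f) := by
  have h : (LinearEquiv.ofInjective (incl F) incl_injective).symm
      ⟨incl F f, LinearMap.mem_range_self _ f⟩ = f := by
    rw [LinearEquiv.symm_apply_eq]; rfl
  exact congrArg (fun g => incl F (A g)) h

end

/-- Multiplication by `x` on scalar Schwartz functions. -/
noncomputable def mulX : 𝓢(ℝ, ℂ) →ₗ[ℂ] 𝓢(ℝ, ℂ) :=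
  (SchwartzMap.smulLeftCLM ℂ (fun x : ℝ => (x : ℂ))).toLinearMap

theorem mulX_apply (f : 𝓢(ℝ, ℂ)) (x : ℝ) : mulX f x = x * f x :=
  SchwartzMap.smulLeftCLM_apply_apply (by fun_prop) f x

/-- Differentiation on scalar Schwartz functions. -/
noncomputable def ddx : 𝓢(ℝ, ℂ) →ₗ[ℂ] 𝓢(ℝ, ℂ) := (SchwartzMap.derivCLM ℂ ℂ).toLinearMap

/-- The quantum oscillator `H = (x² - ∂²)/2` in `L²(ℝ)`. -/
noncomputable def oscillator : L2 ℂ →ₗ.[ℂ] L2 ℂ :=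
  ofSchwartz ((1 / 2 : ℂ) • (mulX ∘ₗ mulX - ddx ∘ₗ ddx))

theorem inner_incl (f g : 𝓢(ℝ, ℂ)) :
    (inner ℂ (incl ℂ f) (incl ℂ g) : ℂ) = ∫ x, g x * (starRingEnd ℂ) (f x) := by
  rw [L2.inner_def]
  refine integral_congr_ae ?_
  filter_upwards [SchwartzMap.coeFn_toLp f 2 volume, SchwartzMap.coeFn_toLp g 2 volume]
    with x hf hg
  change inner ℂ (f.toLp 2 volume x) (g.toLp 2 volume x) = _
  rw [hf, hg]
  rfl

theorem inner_mulX (f g : 𝓢(ℝ, ℂ)) :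
    (inner ℂ (incl ℂ (mulX f)) (incl ℂ g) : ℂ) = inner ℂ (incl ℂ f) (incl ℂ (mulX g)) := by
  rw [inner_incl, inner_incl]
  congr 1
  funext x
  rw [mulX_apply, mulX_apply, map_mul, Complex.conj_ofReal]
  ring

theorem inner_ddx (f g : 𝓢(ℝ, ℂ)) :
    (inner ℂ (incl ℂ (ddx f)) (incl ℂ g) : ℂ) = -inner ℂ (incl ℂ f) (incl ℂ (ddx g)) := by
  rw [inner_incl, inner_incl]
  exact SchwartzMap.integral_bilinear_deriv_right_eq_neg_left g f
    ((ContinuousLinearMap.mul ℝ ℂ).bilinearComp (ContinuousLinearMap.id ℝ ℂ)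
      Complex.conjCLE.toContinuousLinearMap)

theorem oscillator_symmetric : oscillator.IsFormalAdjoint oscillator := by
  rintro ⟨_, f, rfl⟩ ⟨_, g, rfl⟩
  have h (f : 𝓢(ℝ, ℂ)) : oscillator ⟨incl ℂ f, LinearMap.mem_range_self _ f⟩ =
      incl ℂ (((1 / 2 : ℂ) • (mulX ∘ₗ mulX - ddx ∘ₗ ddx)) f) := ofSchwartz_apply _ f
  change (inner ℂ (oscillator ⟨incl ℂ f, LinearMap.mem_range_self _ f⟩) (incl ℂ g) : ℂ) =
    inner ℂ (incl ℂ f) (oscillator ⟨incl ℂ g, LinearMap.mem_range_self _ g⟩)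
  rw [h, h]
  simp only [LinearMap.smul_apply, LinearMap.sub_apply, LinearMap.comp_apply, map_smul, map_sub,
    inner_smul_left, inner_smul_right, inner_sub_left, inner_sub_right]
  rw [inner_mulX, inner_mulX, inner_ddx, inner_ddx]
  simp only [one_div, map_inv₀, map_ofNat, neg_neg]

/-- The operators `R_φ = exp(iφ(1/2 - H))` on `L²(ℝ)`. -/
noncomputable def fracFourier (φ : ℝ) : L2 ℂ →L[ℂ] L2 ℂ :=
  boundedFunctionOf oscillator oscillator_symmetric
    (fun μ => Complex.exp (Complex.I * φ * (1 / 2 - μ))) fun μ => by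
      have h : Complex.I * φ * (1 / 2 - μ) = ((φ * (1 / 2 - μ) : ℝ) : ℂ) * Complex.I := by
        push_cast; ring
      rw [h, Complex.norm_exp_ofReal_mul_I]

/-- The `i`-th coordinate of an element of `L²(ℝ, ℂ²)`. -/
noncomputable def coord (i : Fin 2) : L2 C2 →L[ℂ] L2 ℂ :=
  (EuclideanSpace.proj i : C2 →L[ℂ] ℂ).compLpL 2 volume

/-- The inclusion of `L²(ℝ)` in `L²(ℝ, ℂ²)` as the `i`-th summand. -/
noncomputable def single (i : Fin 2) : L2 ℂ →L[ℂ] L2 C2 :=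
  (ContinuousLinearMap.toSpanSingleton ℂ (EuclideanSpace.single i (1 : ℂ) : C2)).compLpL 2 volume

/-- The grading operator `(u, v) ↦ (u, -v)` on `L²(ℝ, ℂ²)`. -/
noncomputable def grading : L2 C2 →L[ℂ] L2 C2 :=
  single 0 ∘L coord 0 - single 1 ∘L coord 1

/-- The operator `𝐑_φ (u, v) = (R_φ u, e^{-iφ} R_φ v)` on `L²(ℝ, ℂ²)`. -/
noncomputable def metaplectic (φ : ℝ) : L2 C2 →L[ℂ] L2 C2 :=
  single 0 ∘L fracFourier φ ∘L coord 0 +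
    Complex.exp (-(Complex.I * φ)) • (single 1 ∘L fracFourier φ ∘L coord 1)

/-- The `i`-th coordinate of a `ℂ²`-valued Schwartz function. -/
noncomputable def scoord (i : Fin 2) : 𝓢(ℝ, C2) →ₗ[ℂ] 𝓢(ℝ, ℂ) :=
  (SchwartzMap.postcompCLM (𝕜 := ℂ) (EuclideanSpace.proj i : C2 →L[ℂ] ℂ)).toLinearMap

/-- The inclusion of the scalar Schwartz functions as the `i`-th summand. -/
noncomputable def ssingle (i : Fin 2) : 𝓢(ℝ, ℂ) →ₗ[ℂ] 𝓢(ℝ, C2) :=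
  (SchwartzMap.postcompCLM (𝕜 := ℂ)
    (ContinuousLinearMap.toSpanSingleton ℂ (EuclideanSpace.single i (1 : ℂ) : C2))).toLinearMap

/-- The Euler operator `D (u, v) = 2^{-1/2} ((x - ∂) v, (x + ∂) u)` in `L²(ℝ, ℂ²)`, with the
Schwartz space as its domain. -/
noncomputable def euler : L2 C2 →ₗ.[ℂ] L2 C2 :=
  ofSchwartz ((1 / Real.sqrt 2 : ℂ) •
    (ssingle 0 ∘ₗ (mulX - ddx) ∘ₗ scoord 1 + ssingle 1 ∘ₗ (mulX + ddx) ∘ₗ scoord 0))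

/-- The unimodular function `x ↦ e^{ikx - iak/2}`, where `z = a - ik`. -/
noncomputable def phase (z : ℂ) (x : ℝ) : ℂ :=
  Complex.exp (Complex.I * ((-z.im) * x - z.re * (-z.im) / 2 : ℝ))

theorem norm_phase (z : ℂ) (x : ℝ) : ‖phase z x‖ = 1 := by
  rw [phase, mul_comm, Complex.norm_exp_ofReal_mul_I]

theorem continuous_phase (z : ℂ) : Continuous (phase z) := by
  unfold phase
  fun_prop

section

variable {F : Type} [NormedAddCommGroup F] [InnerProductSpace ℂ F]

theorem memLp_weyl (z : ℂ) (u : L2 F) :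
    MemLp (fun x : ℝ => phase z x • u (x - z.re)) 2 volume := by
  have h1 : MemLp (fun x : ℝ => u (x - z.re)) 2 volume :=
    (Lp.memLp u).comp_measurePreserving (measurePreserving_sub_right volume z.re)
  refine h1.of_le ((continuous_phase z).aestronglyMeasurable.smul h1.1) ?_
  exact Eventually.of_forall fun x => by rw [norm_smul, norm_phase, one_mul]

/-- The Heisenberg-Weyl operator `T_z u(x) = e^{ikx - iak/2} u(x - a)` on `L²(ℝ, F)`, where
`z = a - ik`. -/
noncomputable def weyl (z : ℂ) : L2 F →L[ℂ] L2 F :=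
  LinearMap.mkContinuous
    { toFun := fun u => (memLp_weyl z u).toLp
      map_add' := by
        intro u v
        rw [← MemLp.toLp_add, MemLp.toLp_eq_toLp_iff]
        filter_upwards [(measurePreserving_sub_right volume z.re).quasiMeasurePreserving.ae
          (Lp.coeFn_add u v)] with x hx
        simp only [hx, Pi.add_apply, smul_add]
      map_smul' := by
        intro c u
        rw [RingHom.id_apply, ← MemLp.toLp_const_smul, MemLp.toLp_eq_toLp_iff]
        filter_upwards [(measurePreserving_sub_right volume z.re).quasiMeasurePreserving.ae
          (Lp.coeFn_smul c u)] with x hx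
        simp only [hx, Pi.smul_apply, smul_comm c] } 1 fun u => by
    rw [one_mul]
    change ‖(memLp_weyl z u).toLp‖ ≤ _
    rw [Lp.norm_toLp, Lp.norm_def]
    refine le_of_eq (congrArg ENNReal.toReal ?_)
    rw [← eLpNorm_comp_measurePreserving (Lp.aestronglyMeasurable u)
      (measurePreserving_sub_right volume z.re)]
    refine eLpNorm_congr_norm_ae (Eventually.of_forall fun x => ?_)
    rw [norm_smul, norm_phase, one_mul]
    rfl

end

/-- The algebra of operators on `L²(ℝ, ℂ²)` generated by all `T_z` and `𝐑_φ`. -/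
noncomputable def oscAlgebra : Subalgebra ℂ (L2 C2 →L[ℂ] L2 C2) :=
  Algebra.adjoin ℂ (Set.range (weyl (F := C2)) ∪ Set.range metaplectic)

/-- The element `T_z 𝐑_φ` of the algebra. -/
noncomputable def weylMetaplectic (z : ℂ) (φ : ℝ) : oscAlgebra :=
  ⟨weyl z * metaplectic φ, mul_mem (Algebra.subset_adjoin (Or.inl ⟨z, rfl⟩))
    (Algebra.subset_adjoin (Or.inr ⟨φ, rfl⟩))⟩

end Oscillator

/-! All operators involved are built from the ladder operators a = (x+∂)/√2 and a* = (x-∂)/√2, the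
T_z and the 𝐑_φ. The ladder operators commute with T_z up to scalar multiples of T_z, the 𝐑_φ
commute with D, and conjugation by 𝐑_φ rotates z. Hence each cochain operator has a normal form c
T_w P 𝐑_φ, where φ is the sum of the angles, w the twisted sum of the z_j, and P a 2×2 matrix of
polynomials in a, a* of degree at most |α| (`actsOn_cochainOp`, `isBlockWord_cochain`). In the
Hermite basis D² is diagonal, with eigenvalue n on (h_n, 0) and n+1 on (0, h_n). The supertrace is
therefore a Dirichlet series d_0 + ∑ d_n n^{-s}, with d_n the supertrace on the eigenspace for n
(`isSuperZeta_of_actsOn`).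

Suppose that e^{iφ} ≠ 1 or w ≠ 0, and put q = e^{-iφ}. Moving a ladder operator cyclically around
the diagonal coefficients expresses the generating function of a word by those of shorter words,
divided by 1-qt. The empty word has the Laguerre generating function e^{-|w|²/4} (1-qt)^{-1}
exp(-(|w|²/2) qt/(1-qt)). For q ≠ 1 the denominator stays away from 0 on [0,1]; for q = 1 and w ≠ 0
the exponential beats every power of it. So no generating function blows up as t → 1
(`wordCoeff_mem_tame`), a Mellin transform continues the Dirichlet series to an entire function, and
its value at 0 is the Abel limit of ∑ d_n t^n (`IsRegularSeq.exists_isContinuation`). The residues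
in Ψ_2 vanish. For Ψ_0 the supertrace cancels the factor (1-qt)^{-1}, and the limit t → 1 is
elementary.

Suppose now that e^{iφ} = 1 and w = 0. Then for n ≥ 1 the number d_n is a polynomial in n of degree
at most |α|/2 (`wordCoeff_mem_polySeq`), and the continuation is a combination of shifted zeta
functions ζ(s-j). A pole at |α|+1 would need degree |α|, so only α = 0 contributes to Ψ_2. There P
is a constant diagonal matrix, and the residue is c times the difference of its entries. For Ψ_0 the
levels n ≥ 1 cancel and only ker D counts. -/

namespace UnbOp

universe u

section General

variable {V : Type u} [NormedAddCommGroup V] [InnerProductSpace ℂ V]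

/-! ### Functions of a symmetric operator on its eigenvectors -/

section FunctionOf

variable [CompleteSpace V] {A : V →ₗ.[ℂ] V} {ν μ : ℝ} {v u : V} {f : ℝ → ℂ}

theorem eigenProj_eq_self (h : v ∈ eigenspace A ν) : eigenProj A ν v = v :=
  Submodule.starProjection_eq_self_iff.2 ((eigenspace A ν).le_topologicalClosure h)

theorem inner_eigenProj (u v : V) :
    (inner ℂ (eigenProj A μ u) v : ℂ) = inner ℂ u (eigenProj A μ v) :=
  Submodule.inner_starProjection_left_eq_right _ u v

theorem eigenProj_idem (v : V) : eigenProj A ν (eigenProj A ν v) = eigenProj A ν v :=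
  Submodule.starProjection_eq_self_iff.2 (Submodule.starProjection_apply_mem _ _)

theorem eigenProj_eq_zero (hA : A.IsFormalAdjoint A) (h : v ∈ eigenspace A ν) (hμ : μ ≠ ν) :
    eigenProj A μ v = 0 := by
  rw [← inner_self_eq_zero (𝕜 := ℂ), ← inner_eigenProj, eigenProj_idem]
  conv_lhs => rw [← eigenProj_eq_self h]
  rw [eigenProj_eq_self h]
  have := eigenProj_inner_eq_zero hA hμ v v
  rwa [eigenProj_eq_self h] at this

theorem hasSum_functionOf_eigenvector (hA : A.IsFormalAdjoint A) (h : v ∈ eigenspace A ν) :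
    HasSum (fun μ : ℝ => f μ • eigenProj A μ v) (f ν • v) := by
  have := hasSum_single (f := fun μ : ℝ => f μ • eigenProj A μ v) ν fun μ hμ => by
    rw [eigenProj_eq_zero hA h hμ, smul_zero]
  rwa [eigenProj_eq_self h] at this

theorem mem_functionOf_domain (hA : A.IsFormalAdjoint A) (h : v ∈ eigenspace A ν) :
    v ∈ (functionOf A f).domain :=
  (hasSum_functionOf_eigenvector hA h).summable

theorem functionOf_eigenvector (hA : A.IsFormalAdjoint A) (h : v ∈ eigenspace A ν)
    (h' : v ∈ (functionOf A f).domain) : functionOf A f ⟨v, h'⟩ = f ν • v :=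
  (hasSum_functionOf_eigenvector hA h).tsum_eq

/-- Pairing the defining series with an eigenvector leaves a single term, because the spectral
projections are self-adjoint and all but one annihilate that eigenvector. This holds for unbounded f
on the natural domain. -/
theorem inner_functionOf (hA : A.IsFormalAdjoint A) (h : v ∈ eigenspace A ν)
    (u : (functionOf A f).domain) :
    (inner ℂ v (functionOf A f u) : ℂ) = f ν * inner ℂ v u := by
  have h1 : HasSum (fun μ : ℝ => f μ • eigenProj A μ (u : V)) (functionOf A f u) :=
    Summable.hasSum u.2
  have h2 := h1.mapL (innerSL ℂ v)
  refine h2.unique ?_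
  have h3 := hasSum_single (f := fun μ : ℝ => innerSL ℂ v (f μ • eigenProj A μ (u : V))) ν
    fun μ hμ => by
      rw [map_smul, innerSL_apply_apply, ← inner_eigenProj, eigenProj_eq_zero hA h hμ,
        inner_zero_left, smul_zero]
  rwa [map_smul, innerSL_apply_apply, ← inner_eigenProj, eigenProj_eq_self h] at h3

theorem boundedFunctionOf_eigenvector (hA : A.IsFormalAdjoint A) (hf : ∀ μ, ‖f μ‖ ≤ 1)
    (h : v ∈ eigenspace A ν) : boundedFunctionOf A hA f hf v = f ν • v :=
  functionOf_eigenvector hA h (summable_of_bounded hA hf v)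

theorem inner_boundedFunctionOf (hA : A.IsFormalAdjoint A) (hf : ∀ μ, ‖f μ‖ ≤ 1)
    (h : v ∈ eigenspace A ν) (u : V) :
    (inner ℂ v (boundedFunctionOf A hA f hf u) : ℂ) = f ν * inner ℂ v u :=
  inner_functionOf hA h ⟨u, summable_of_bounded hA hf u⟩

end FunctionOf

/-! ### Absolutely convergent sums of operators of rank one -/

section Nuclear

variable {ι κ : Type*}

/-- Cauchy-Schwarz followed by Bessel's inequality for each factor. The bound is uniform in the
orthonormal family, which is what makes the trace independent of the basis. -/
theorem sum_norm_inner_mul_le {b : κ → V} (hb : Orthonormal ℂ b) (x y : V) (s : Finset κ) :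
    ∑ k ∈ s, ‖(inner ℂ (b k) y : ℂ)‖ * ‖(inner ℂ x (b k) : ℂ)‖ ≤ ‖x‖ * ‖y‖ := by
  have hx := hb.sum_inner_products_le x (s := s)
  have hy := hb.sum_inner_products_le y (s := s)
  have h := Real.sum_mul_le_sqrt_mul_sqrt s (fun k => ‖(inner ℂ (b k) y : ℂ)‖)
    (fun k => ‖(inner ℂ x (b k) : ℂ)‖)
  refine h.trans ?_
  rw [mul_comm ‖x‖]
  refine mul_le_mul ?_ ?_ (Real.sqrt_nonneg _) (norm_nonneg _)
  · exact Real.sqrt_le_iff.2 ⟨norm_nonneg _, hy⟩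
  · refine Real.sqrt_le_iff.2 ⟨norm_nonneg _, ?_⟩
    simpa only [norm_inner_symm x] using hx

variable [CompleteSpace V]

/-- The double family ⟨b_k, y_i⟩⟨x_i, b_k⟩ is absolutely summable. Summed over k first it gives ∑
⟨x_i, y_i⟩ by Parseval, summed over i first it gives the trace in the basis b. -/
theorem exists_nuclear (e : ι ≃ ℕ) (x y : ι → V) (hs : Summable fun i => ‖x i‖ * ‖y i‖) :
    ∃ C : V →L[ℂ] V, IsTraceClass C ∧
      (∀ u, HasSum (fun i => (inner ℂ (x i) u : ℂ) • y i) (C u)) ∧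
      ∀ (κ : Type u) (b : HilbertBasis κ ℂ V) (τ : ℂ),
        HasSum (fun i => (inner ℂ (x i) (y i) : ℂ)) τ →
        HasSum (fun k => (inner ℂ (b k) (C (b k)) : ℂ)) τ := by
  have hsum : Summable fun i => (innerSL ℂ (x i)).smulRight (y i) := by
    refine Summable.of_norm_bounded hs fun i => ?_
    rw [ContinuousLinearMap.norm_smulRight_apply, innerSL_apply_norm]
  have hC (u : V) : HasSum (fun i => (inner ℂ (x i) u : ℂ) • y i)
      ((∑' i, (innerSL ℂ (x i)).smulRight (y i)) u) :=
    hsum.hasSum.mapL (ContinuousLinearMap.apply ℂ V u)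
  refine ⟨_, ⟨x ∘ e.symm, y ∘ e.symm, (e.symm.summable_iff (f := fun i => ‖x i‖ * ‖y i‖)).2 hs,
    fun u => (e.symm.hasSum_iff (f := fun i => (inner ℂ (x i) u : ℂ) • y i)).2 (hC u)⟩, hC, ?_⟩
  intro κ b τ hτ
  let F : ι × κ → ℂ := fun p => inner ℂ (b p.2) (y p.1) * inner ℂ (x p.1) (b p.2)
  have hrow (i : ι) : HasSum (fun k => F (i, k)) (inner ℂ (x i) (y i)) := by
    have := b.hasSum_inner_mul_inner (x i) (y i)
    simpa only [F, mul_comm] using this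
  have hbd (i : ι) (s : Finset κ) : ∑ k ∈ s, ‖F (i, k)‖ ≤ ‖x i‖ * ‖y i‖ := by
    simp only [F, norm_mul]
    exact sum_norm_inner_mul_le b.orthonormal (x i) (y i) s
  have hrow' (i : ι) : Summable fun k => ‖F (i, k)‖ :=
    summable_of_sum_le (fun _ => norm_nonneg _) (hbd i)
  have hF : Summable F := by
    refine Summable.of_norm ?_
    rw [summable_prod_of_nonneg fun _ => norm_nonneg _]
    refine ⟨hrow', Summable.of_nonneg_of_le (fun i => tsum_nonneg fun _ => norm_nonneg _)
      (fun i => ?_) hs⟩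
    exact (hrow' i).tsum_le_of_sum_le (hbd i)
  have h1 : HasSum F τ := by
    have h2 := hF.hasSum.prod_fiberwise hrow
    rw [← h2.unique hτ]
    exact hF.hasSum
  have h3 : HasSum (F ∘ Prod.swap) τ := ((Equiv.prodComm κ ι).hasSum_iff).2 h1
  refine h3.prod_fiberwise fun k => ?_
  have := (hC (b k)).mapL (innerSL ℂ (b k))
  simpa only [innerSL_apply_apply, inner_smul_right, F, Function.comp, Prod.swap, mul_comm]
    using this

/-- On the eigenbasis the operator X f(A) sends b_i to f(ev i) y_i, so the only candidate for a
bounded extension is the nuclear sum of the corresponding rank one operators. Agreement must hold on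
the whole natural domain and not just on the span of the basis; the hypothesis `hadj` serves this
purpose, as X need not be closed. -/
theorem hasTrace_comp_functionOf {ι : Type u} (e : ι ≃ ℕ) (b : HilbertBasis ι ℂ V)
    {A : V →ₗ.[ℂ] V} (hA : A.IsFormalAdjoint A) {ev : ι → ℝ}
    (hb : ∀ i, b i ∈ eigenspace A (ev i)) (f : ℝ → ℂ) (γ : V →L[ℂ] V) (X : V →ₗ.[ℂ] V)
    (y : ι → V) (hX : ∀ i, ∃ h : b i ∈ X.domain, X ⟨b i, h⟩ = y i)
    (hadj : ∀ j, ∃ g : V, ∀ w : X.domain, (inner ℂ (b j) (X w) : ℂ) = inner ℂ g w)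
    (hsum : Summable fun i => ‖f (ev i)‖ * ‖y i‖) {τ : ℂ}
    (hτ : HasSum (fun i => f (ev i) * inner ℂ (b i) (γ (y i))) τ) :
    HasTrace (comp (ofBounded γ) (comp X (functionOf A f))) τ := by
  have hb1 (i : ι) : ‖b i‖ = 1 := b.orthonormal.1 i
  have hs0 : Summable fun i => ‖b i‖ * ‖f (ev i) • y i‖ := by
    simpa only [hb1, one_mul, norm_smul] using hsum
  obtain ⟨C, -, hC, -⟩ := exists_nuclear e b (fun i => f (ev i) • y i) hs0
  have hs1 : Summable fun i => ‖b i‖ * ‖f (ev i) • γ (y i)‖ := by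
    refine Summable.of_nonneg_of_le (fun _ => by positivity) (fun i => ?_) (hsum.mul_left ‖γ‖)
    rw [hb1, one_mul, norm_smul, mul_left_comm]
    exact mul_le_mul_of_nonneg_left (γ.le_opNorm _) (norm_nonneg _)
  obtain ⟨C', hC'1, hC'2, hC'3⟩ := exists_nuclear e b (fun i => f (ev i) • γ (y i)) hs1
  have hCC' (u : V) : C' u = γ (C u) := by
    refine (hC'2 u).unique ?_
    simpa only [map_smul] using (hC u).mapL γ
  refine ⟨?_, C', ?_, hC'1, fun κ c => hC'3 κ c τ ?_⟩
  · have hsub : ((Submodule.span ℂ (Set.range b) : Submodule ℂ V) : Set V) ⊆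
        (comp (ofBounded γ) (comp X (functionOf A f))).domain := by
      rw [SetLike.coe_subset_coe, Submodule.span_le]
      rintro _ ⟨i, rfl⟩
      have h1 : b i ∈ (functionOf A f).domain := mem_functionOf_domain hA (hb i)
      have h2 : functionOf A f ⟨b i, h1⟩ ∈ X.domain := by
        rw [functionOf_eigenvector hA (hb i)]
        exact X.domain.smul_mem _ (hX i).1
      exact mem_comp_domain.2 ⟨mem_comp_domain.2 ⟨h1, h2⟩, trivial⟩
    refine Dense.mono hsub ?_
    rw [Submodule.dense_iff_topologicalClosure_eq_top]
    exact b.dense_span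
  · rintro ⟨u, hu⟩
    obtain ⟨hu1, -⟩ := mem_comp_domain.1 hu
    obtain ⟨hu2, hu3⟩ := mem_comp_domain.1 hu1
    change C' u = γ (X ⟨functionOf A f ⟨u, hu2⟩, hu3⟩)
    rw [hCC']
    congr 1
    -- Coefficients against b_j are compared. The vector g takes over the action of X, and Parseval
    -- for ⟨g, f(A) u⟩ reproduces the series of C u term by term.
    refine b.repr.injective (lp.ext (funext fun j => ?_))
    rw [HilbertBasis.repr_apply_apply, HilbertBasis.repr_apply_apply]
    obtain ⟨g, hg⟩ := hadj j
    rw [hg]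
    have h1 := (hC u).mapL (innerSL ℂ (b j))
    have h2 := b.hasSum_inner_mul_inner g (functionOf A f ⟨u, hu2⟩)
    have h3 : (fun i => innerSL ℂ (b j) ((inner ℂ (b i) u : ℂ) • f (ev i) • y i)) =
        fun i => inner ℂ g (b i) * inner ℂ (b i) (functionOf A f ⟨u, hu2⟩) := by
      funext i
      obtain ⟨h4, h5⟩ := hX i
      rw [inner_functionOf hA (hb i), ← hg ⟨b i, h4⟩, h5, map_smul, map_smul,
        innerSL_apply_apply, smul_eq_mul, smul_eq_mul]
      ring
    rw [h3] at h1
    exact h1.unique h2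
  · simpa only [inner_smul_right] using hτ

end Nuclear

/-! ### Operators acting on an invariant space of test vectors -/

section ActsOn

variable {E : Type*} [AddCommGroup E] [Module ℂ E]

/-- The commutator with a fixed element of a ring. -/
def ringAd {R : Type*} [Ring R] (x p : R) : R := x * p - p * x

/-- The operator `X` maps the test vectors `J E` to themselves, acting as `x` on `E`, and it has
a formal adjoint that maps test vectors to test vectors. -/
structure ActsOn (J : E →ₗ[ℂ] V) (X : V →ₗ.[ℂ] V) (x : Module.End ℂ E) : Prop where
  apply : ∀ v, ∃ h : J v ∈ X.domain, X ⟨J v, h⟩ = J (x v)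
  adjoint : ∀ v, ∃ g, ∀ w : X.domain, (inner ℂ (J v) (X w) : ℂ) = inner ℂ (J g) w

variable {J : E →ₗ[ℂ] V} {X Y : V →ₗ.[ℂ] V} {x y : Module.End ℂ E}

/-- The adjoint clause ranges over the full natural domain of the operator, so it survives
compositions and differences even though their domains are not computed. -/
theorem ActsOn.comp (hX : ActsOn J X x) (hY : ActsOn J Y y) :
    ActsOn J (UnbOp.comp X Y) (x * y) where
  apply v := by
    obtain ⟨h1, h2⟩ := hY.apply v
    obtain ⟨h3, h4⟩ := hX.apply (y v)
    have h5 : Y ⟨J v, h1⟩ ∈ X.domain := h2 ▸ h3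
    refine ⟨mem_comp_domain.2 ⟨h1, h5⟩, ?_⟩
    rw [comp_apply h1 h5, Module.End.mul_apply, ← h4]
    congr 1
    exact Subtype.ext h2
  adjoint v := by
    obtain ⟨g, hg⟩ := hX.adjoint v
    obtain ⟨g', hg'⟩ := hY.adjoint g
    refine ⟨g', ?_⟩
    rintro ⟨w, hw⟩
    obtain ⟨h1, h2⟩ := mem_comp_domain.1 hw
    rw [comp_apply h1 h2, hg, hg']

theorem ActsOn.sub (hX : ActsOn J X x) (hY : ActsOn J Y y) : ActsOn J (X - Y) (x - y) where
  apply v := by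
    obtain ⟨h1, h2⟩ := hX.apply v
    obtain ⟨h3, h4⟩ := hY.apply v
    refine ⟨⟨h1, h3⟩, ?_⟩
    rw [LinearMap.sub_apply, map_sub, ← h2, ← h4]
    rfl
  adjoint v := by
    obtain ⟨g, hg⟩ := hX.adjoint v
    obtain ⟨g', hg'⟩ := hY.adjoint v
    refine ⟨g - g', ?_⟩
    rintro ⟨w, hw1, hw2⟩
    rw [map_sub, inner_sub_left, ← hg ⟨w, hw1⟩, ← hg' ⟨w, hw2⟩, ← inner_sub_right]
    rfl

theorem ActsOn.commutator (hX : ActsOn J X x) (hY : ActsOn J Y y) :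
    ActsOn J (UnbOp.commutator X Y) (ringAd x y) :=
  (hX.comp hY).sub (hY.comp hX)

theorem ActsOn.iterCommutator (hX : ActsOn J X x) (hY : ActsOn J Y y) (n : ℕ) :
    ActsOn J (UnbOp.iterCommutator X Y n) ((ringAd x)^[n] y) := by
  induction n with
  | zero => exact hY
  | succ n ih =>
    rw [Function.iterate_succ_apply']
    exact hX.commutator ih

theorem ActsOn.ofBounded {B B' : V →L[ℂ] V} (hx : ∀ v, B (J v) = J (x v))
    (hy : ∀ v, B' (J v) = J (y v)) (hB : ∀ u v, (inner ℂ u (B v) : ℂ) = inner ℂ (B' u) v) :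
    ActsOn J (UnbOp.ofBounded B) x where
  apply v := ⟨trivial, hx v⟩
  adjoint v := ⟨y v, fun w => by rw [← hy]; exact hB _ _⟩

theorem ActsOn.ofBounded_id : ActsOn J (UnbOp.ofBounded (ContinuousLinearMap.id ℂ V)) 1 :=
  ActsOn.ofBounded (y := 1) (B' := ContinuousLinearMap.id ℂ V) (fun _ => rfl) (fun _ => rfl)
    fun _ _ => rfl

end ActsOn

end General

end UnbOp

namespace Oscillator

open UnbOp

/-! ### Ladder operators on the Schwartz space -/

theorem ddx_apply (f : 𝓢(ℝ, ℂ)) (x : ℝ) : ddx f x = deriv f x := rfl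

theorem ddx_mulX (f : 𝓢(ℝ, ℂ)) : ddx (mulX f) = f + mulX (ddx f) := by
  ext x
  rw [ddx_apply]
  have h1 : HasDerivAt (fun y : ℝ => (y : ℂ) * f y) (1 * f x + x * deriv f x) x :=
    (Complex.ofRealCLM.hasDerivAt (x := x)).mul f.differentiableAt.hasDerivAt
  have h2 : (mulX f : ℝ → ℂ) = fun y : ℝ => (y : ℂ) * f y := funext fun y => mulX_apply f y
  rw [h2, h1.deriv, add_apply, mulX_apply, ddx_apply, one_mul]

/-- The lowering operator `(x + ∂) / √2`. -/
noncomputable def lower : 𝓢(ℝ, ℂ) →ₗ[ℂ] 𝓢(ℝ, ℂ) := (1 / Real.sqrt 2 : ℂ) • (mulX + ddx)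

/-- The raising operator `(x - ∂) / √2`. -/
noncomputable def raise : 𝓢(ℝ, ℂ) →ₗ[ℂ] 𝓢(ℝ, ℂ) := (1 / Real.sqrt 2 : ℂ) • (mulX - ddx)

theorem inv_sqrt_two_mul_self : (1 / Real.sqrt 2 : ℂ) * (1 / Real.sqrt 2 : ℂ) = 1 / 2 := by
  rw [div_mul_div_comm, one_mul, ← Complex.ofReal_mul, Real.mul_self_sqrt (by norm_num)]
  norm_num

theorem conj_inv_sqrt_two :
    (starRingEnd ℂ) (1 / Real.sqrt 2 : ℂ) = (1 / Real.sqrt 2 : ℂ) := by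
  rw [map_div₀, map_one, Complex.conj_ofReal]

theorem lower_raise (f : 𝓢(ℝ, ℂ)) : lower (raise f) = raise (lower f) + f := by
  simp only [lower, raise, LinearMap.smul_apply, LinearMap.add_apply, LinearMap.sub_apply,
    map_smul, map_add, map_sub, smul_add, smul_sub, smul_smul,
    inv_sqrt_two_mul_self, ddx_mulX]
  module

theorem half_mulX_sub_ddx (f : 𝓢(ℝ, ℂ)) :
    ((1 / 2 : ℂ) • (mulX ∘ₗ mulX - ddx ∘ₗ ddx)) f = raise (lower f) + (1 / 2 : ℂ) • f := by
  simp only [lower, raise, LinearMap.smul_apply, LinearMap.add_apply, LinearMap.sub_apply,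
    LinearMap.comp_apply, map_smul, map_add, smul_add, smul_sub, smul_smul,
    inv_sqrt_two_mul_self, ddx_mulX]
  module

theorem inner_lower (f g : 𝓢(ℝ, ℂ)) :
    (inner ℂ (incl ℂ (lower f)) (incl ℂ g) : ℂ) = inner ℂ (incl ℂ f) (incl ℂ (raise g)) := by
  simp only [lower, raise, LinearMap.smul_apply, LinearMap.add_apply, LinearMap.sub_apply,
    map_smul, map_add, map_sub, inner_smul_left, inner_smul_right, inner_add_left, inner_sub_right,
    inner_mulX, inner_ddx, conj_inv_sqrt_two]
  ring

theorem inner_raise (f g : 𝓢(ℝ, ℂ)) :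
    (inner ℂ (incl ℂ (raise f)) (incl ℂ g) : ℂ) = inner ℂ (incl ℂ f) (incl ℂ (lower g)) := by
  rw [← inner_conj_symm, ← inner_lower, inner_conj_symm]

/-! ### Heisenberg-Weyl operators on the Schwartz space -/

theorem hasDerivAt_phase (z : ℂ) (x : ℝ) :
    HasDerivAt (phase z) (Complex.I * (-z.im : ℝ) * phase z x) x := by
  have h1 : HasDerivAt (fun x : ℝ => Complex.I * ((-z.im) * x - z.re * (-z.im) / 2 : ℝ))
      (Complex.I * (-z.im : ℝ)) x := by
    have h2 : HasDerivAt (fun x : ℝ => (-z.im) * x - z.re * (-z.im) / 2) (-z.im) x := by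
      simpa using ((hasDerivAt_id x).const_mul (-z.im)).sub_const (z.re * (-z.im) / 2)
    exact h2.ofReal_comp.const_mul Complex.I
  exact h1.cexp.congr_deriv (mul_comm _ _)

theorem iteratedDeriv_phase (z : ℂ) (n : ℕ) :
    iteratedDeriv n (phase z) = fun x => (Complex.I * (-z.im : ℝ)) ^ n * phase z x := by
  induction n with
  | zero => simp
  | succ n ih =>
    rw [iteratedDeriv_succ, ih]
    funext x
    rw [((hasDerivAt_phase z x).const_mul _).deriv]
    ring

theorem contDiff_phase (z : ℂ) {n : WithTop ℕ∞} : ContDiff ℝ n (phase z) := by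
  unfold phase
  have h : ContDiff ℝ n (fun x : ℝ => Complex.I * ((-z.im) * x - z.re * (-z.im) / 2 : ℝ)) := by
    exact contDiff_const.mul (Complex.ofRealCLM.contDiff.comp
      ((contDiff_const.mul contDiff_id).sub contDiff_const))
  exact h.cexp

theorem hasTemperateGrowth_phase (z : ℂ) : (phase z).HasTemperateGrowth := by
  refine ⟨contDiff_phase z, fun n => ⟨0, ‖Complex.I * (-z.im : ℝ)‖ ^ n, fun x => ?_⟩⟩
  rw [norm_iteratedFDeriv_eq_norm_iteratedDeriv, iteratedDeriv_phase, norm_mul, norm_phase,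
    norm_pow, pow_zero]

/-- The Heisenberg-Weyl operator on the Schwartz space. -/
noncomputable def sweyl (z : ℂ) : 𝓢(ℝ, ℂ) →ₗ[ℂ] 𝓢(ℝ, ℂ) :=
  (SchwartzMap.smulLeftCLM ℂ (phase z)).toLinearMap ∘ₗ
    (SchwartzMap.compSubConstCLM ℂ z.re).toLinearMap

theorem sweyl_apply (z : ℂ) (f : 𝓢(ℝ, ℂ)) (x : ℝ) : sweyl z f x = phase z x * f (x - z.re) :=
  SchwartzMap.smulLeftCLM_apply_apply (hasTemperateGrowth_phase z) _ x

theorem ddx_sweyl (z : ℂ) (f : 𝓢(ℝ, ℂ)) :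
    ddx (sweyl z f) = sweyl z (ddx f) + (Complex.I * (-z.im : ℝ)) • sweyl z f := by
  ext x
  have h1 : (sweyl z f : ℝ → ℂ) = fun x => phase z x * f (x - z.re) :=
    funext fun x => sweyl_apply z f x
  have h2 : HasDerivAt (fun x => f (x - z.re)) (deriv f (x - z.re)) x :=
    HasDerivAt.comp_sub_const x z.re f.differentiableAt.hasDerivAt
  rw [ddx_apply, h1, ((hasDerivAt_phase z x).fun_mul h2).deriv, add_apply,
    smul_apply, sweyl_apply, sweyl_apply, ddx_apply, smul_eq_mul]
  ring

theorem mulX_sweyl (z : ℂ) (f : 𝓢(ℝ, ℂ)) :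
    mulX (sweyl z f) = sweyl z (mulX f) + (z.re : ℂ) • sweyl z f := by
  ext x
  rw [mulX_apply, add_apply, smul_apply, sweyl_apply, sweyl_apply,
    mulX_apply, smul_eq_mul]
  push_cast
  ring

/-- Conjugation by T_z shifts x by a and ∂ by ik, hence x + ∂ by a + ik, the conjugate of z = a -
ik. -/
theorem lower_sweyl (z : ℂ) (f : 𝓢(ℝ, ℂ)) :
    lower (sweyl z f) =
      sweyl z (lower f) + ((1 / Real.sqrt 2 : ℂ) * (starRingEnd ℂ) z) • sweyl z f := by
  have h : (starRingEnd ℂ) z = z.re + Complex.I * (-z.im : ℝ) := by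
    apply Complex.ext <;> simp
  simp only [lower, LinearMap.smul_apply, LinearMap.add_apply, map_smul, map_add, ddx_sweyl,
    mulX_sweyl, h]
  module

theorem raise_sweyl (z : ℂ) (f : 𝓢(ℝ, ℂ)) :
    raise (sweyl z f) = sweyl z (raise f) + ((1 / Real.sqrt 2 : ℂ) * z) • sweyl z f := by
  have h : z = z.re - Complex.I * (-z.im : ℝ) := by
    apply Complex.ext <;> simp
  conv_rhs => enter [2, 1]; rw [h]
  simp only [raise, LinearMap.smul_apply, LinearMap.sub_apply, map_smul, map_sub, ddx_sweyl,
    mulX_sweyl]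
  module

/-! ### Heisenberg-Weyl operators on L²: composition law and unitarity. -/

section

variable {F : Type} [NormedAddCommGroup F] [InnerProductSpace ℂ F]

theorem coeFn_weyl (z : ℂ) (u : L2 F) :
    (weyl z u : ℝ → F) =ᵐ[volume] fun x => phase z x • u (x - z.re) :=
  (memLp_weyl z u).coeFn_toLp

theorem ae_comp_sub {p : ℝ → Prop} (h : ∀ᵐ x, p x) (a : ℝ) : ∀ᵐ x, p (x - a) :=
  (measurePreserving_sub_right volume a).quasiMeasurePreserving.ae h

/-- The summand -iak/2 in the exponent symmetrizes the phase, so that the composition law of the T_z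
has the antisymmetric cocycle Im(w z̄)/2. -/
theorem phase_mul_phase (z w : ℂ) (x : ℝ) :
    phase z x * phase w (x - z.re) =
      Complex.exp (Complex.I * (w * (starRingEnd ℂ) z).im / 2) * phase (z + w) x := by
  simp only [phase, ← Complex.exp_add]
  congr 1
  simp only [Complex.mul_im, Complex.conj_re, Complex.conj_im, Complex.add_im, Complex.add_re]
  push_cast
  ring

theorem weyl_weyl (z w : ℂ) (u : L2 F) :
    weyl z (weyl w u) =
      Complex.exp (Complex.I * (w * (starRingEnd ℂ) z).im / 2) • weyl (z + w) u := by
  refine Lp.ext ?_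
  filter_upwards [coeFn_weyl z (weyl w u), ae_comp_sub (coeFn_weyl w u) z.re,
    coeFn_weyl (z + w) u, Lp.coeFn_smul
      (Complex.exp (Complex.I * (w * (starRingEnd ℂ) z).im / 2)) (weyl (z + w) u)]
    with x h1 h2 h3 h4
  rw [h1, h2, h4, Pi.smul_apply, h3, smul_smul, smul_smul, phase_mul_phase, sub_sub,
    Complex.add_re]

theorem weyl_zero (u : L2 F) : weyl 0 u = u := by
  refine Lp.ext ?_
  filter_upwards [coeFn_weyl 0 u] with x h
  rw [h]
  simp [phase]

theorem weyl_neg_weyl (z : ℂ) (u : L2 F) : weyl (-z) (weyl z u) = u := by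
  rw [weyl_weyl, neg_add_cancel, weyl_zero]
  have h : (z * (starRingEnd ℂ) (-z)).im = 0 := by
    simp [Complex.mul_im]; ring
  rw [h]
  simp

theorem weyl_weyl_neg (z : ℂ) (u : L2 F) : weyl z (weyl (-z) u) = u := by
  have := weyl_neg_weyl (-z) u
  rwa [neg_neg] at this

theorem norm_weyl (z : ℂ) (u : L2 F) : ‖weyl z u‖ = ‖u‖ := by
  have h (z : ℂ) (u : L2 F) : ‖weyl z u‖ ≤ ‖u‖ := by
    have h1 := (weyl (F := F) z).le_of_opNorm_le
      (LinearMap.mkContinuous_norm_le _ zero_le_one _) u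
    rwa [one_mul] at h1
  refine le_antisymm (h z u) ?_
  conv_lhs => rw [← weyl_neg_weyl z u]
  exact h _ _

theorem inner_weyl_weyl (z : ℂ) (u v : L2 F) :
    (inner ℂ (weyl z u) (weyl z v) : ℂ) = inner ℂ u v :=
  (⟨(weyl z).toLinearMap, norm_weyl z⟩ : L2 F →ₗᵢ[ℂ] L2 F).inner_map_map u v

theorem inner_weyl_right (z : ℂ) (u v : L2 F) :
    (inner ℂ u (weyl z v) : ℂ) = inner ℂ (weyl (-z) u) v := by
  rw [← inner_weyl_weyl z (weyl (-z) u), weyl_weyl_neg]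

end

theorem coeFn_incl {F : Type} [NormedAddCommGroup F] [InnerProductSpace ℂ F] [NormedSpace ℝ F]
    [SMulCommClass ℝ ℂ F] (f : 𝓢(ℝ, F)) : (incl F f : ℝ → F) =ᵐ[volume] f :=
  SchwartzMap.coeFn_toLp f 2 volume

theorem weyl_incl (z : ℂ) (f : 𝓢(ℝ, ℂ)) : weyl z (incl ℂ f) = incl ℂ (sweyl z f) := by
  refine Lp.ext ?_
  filter_upwards [coeFn_weyl z (incl ℂ f), ae_comp_sub (coeFn_incl f) z.re,
    coeFn_incl (sweyl z f)] with x h1 h2 h3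
  rw [h1, h2, h3, sweyl_apply, smul_eq_mul]

/-! ### Hermite functions -/

theorem exists_pow_mul_gaussian_le (m : ℕ) :
    ∃ C : ℝ, ∀ x : ℝ, |x| ^ m * Real.exp (-(x ^ 2 / 2)) ≤ C := by
  -- Here |x|^m ≤ 1 + x^{2m}, while 1 ≤ e^{x²/2} and (x²/2)^m / m! ≤ e^{x²/2}.
  refine ⟨1 + 2 ^ m * m.factorial, fun x => ?_⟩
  have hy : 0 ≤ x ^ 2 / 2 := by positivity
  have h1 := Real.pow_div_factorial_le_exp _ hy m
  rw [div_le_iff₀ (by positivity), div_pow, ← pow_mul, mul_comm 2 m, pow_mul,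
    div_le_iff₀ (by positivity)] at h1
  have h2 : |x| ^ m ≤ 1 + (x ^ m) ^ 2 := by
    rw [← abs_pow, ← sq_abs]
    nlinarith [sq_nonneg (|x ^ m| - 1)]
  have h3 := Real.one_le_exp hy
  rw [Real.exp_neg, ← div_eq_mul_inv, div_le_iff₀ (Real.exp_pos _)]
  nlinarith

theorem exists_polynomial_mul_gaussian_le (p : Polynomial ℝ) (m : ℕ) :
    ∃ C : ℝ, ∀ x : ℝ, |x| ^ m * (|p.eval x| * Real.exp (-(x ^ 2 / 2))) ≤ C := by
  induction p using Polynomial.induction_on' with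
  | add p q hp hq =>
    obtain ⟨C, hC⟩ := hp
    obtain ⟨C', hC'⟩ := hq
    refine ⟨C + C', fun x => le_trans ?_ (add_le_add (hC x) (hC' x))⟩
    rw [← mul_add, ← add_mul, Polynomial.eval_add]
    gcongr
    exact abs_add_le _ _
  | monomial n a =>
    obtain ⟨C, hC⟩ := exists_pow_mul_gaussian_le (m + n)
    refine ⟨|a| * C, fun x => ?_⟩
    have := mul_le_mul_of_nonneg_left (hC x) (abs_nonneg a)
    rw [Polynomial.eval_monomial, abs_mul, abs_pow]
    refine le_of_eq_of_le ?_ this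
    ring

/-- The Gaussian `x ↦ e^{-x²/2}`. -/
noncomputable def gaussian : 𝓢(ℝ, ℝ) where
  toFun x := Real.exp (-(x ^ 2 / 2))
  smooth' := by fun_prop
  decay' k n := by
    -- Up to sign, the n-th derivative of the Gaussian is the n-th Hermite polynomial times the
    -- Gaussian.
    obtain ⟨C, hC⟩ := exists_polynomial_mul_gaussian_le
      ((Polynomial.hermite n).map (Int.castRingHom ℝ)) k
    refine ⟨C, fun x => le_of_eq_of_le ?_ (hC x)⟩
    rw [norm_iteratedFDeriv_eq_norm_iteratedDeriv, iteratedDeriv_eq_iterate,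
      Polynomial.deriv_gaussian_eq_hermite_mul_gaussian, norm_mul, norm_mul, norm_pow, norm_neg,
      norm_one, one_pow, one_mul, Real.norm_eq_abs, Real.norm_eq_abs, Real.norm_eq_abs,
      Real.abs_exp, Polynomial.eval_map, Polynomial.aeval_def]
    rfl

/-- The normalized ground state `π^{-1/4} e^{-x²/2}` of the oscillator. -/
noncomputable def groundState : 𝓢(ℝ, ℂ) :=
  ((Real.pi ^ (-(1 / 4 : ℝ)) : ℝ) : ℂ) • SchwartzMap.postcompCLM (𝕜 := ℝ) Complex.ofRealCLM gaussian

theorem groundState_apply (x : ℝ) :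
    groundState x = ((Real.pi ^ (-(1 / 4 : ℝ)) : ℝ) : ℂ) * Complex.exp (-(x ^ 2 / 2)) := by
  have h : (SchwartzMap.postcompCLM (𝕜 := ℝ) Complex.ofRealCLM gaussian) x =
      ((Real.exp (-(x ^ 2 / 2)) : ℝ) : ℂ) := rfl
  rw [groundState, smul_apply, h, smul_eq_mul]
  push_cast
  rfl

theorem lower_groundState : lower groundState = 0 := by
  ext x
  have h0 : (groundState : ℝ → ℂ) = fun x : ℝ =>
      ((Real.pi ^ (-(1 / 4 : ℝ)) : ℝ) : ℂ) * Complex.exp (-(x ^ 2 / 2)) :=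
    funext groundState_apply
  have h1 : HasDerivAt (fun x : ℝ => -((x : ℂ) ^ 2 / 2)) (-(x : ℂ)) x := by
    have h2 : HasDerivAt (fun x : ℝ => (-(x ^ 2 / 2))) (-x) x := by
      have := ((hasDerivAt_pow 2 x).div_const 2).neg
      refine this.congr_deriv ?_
      simp
    have := h2.ofReal_comp
    simpa using this
  have h3 : HasDerivAt (groundState : ℝ → ℂ)
      (((Real.pi ^ (-(1 / 4 : ℝ)) : ℝ) : ℂ) * (Complex.exp (-((x : ℂ) ^ 2 / 2)) * (-(x : ℂ)))) x := by
    rw [h0]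
    exact h1.cexp.const_mul _
  rw [lower, LinearMap.smul_apply, LinearMap.add_apply, smul_apply,
    add_apply, mulX_apply, ddx_apply, h3.deriv, groundState_apply,
    zero_apply, smul_eq_mul]
  ring

/-- The `n`-th normalized Hermite function. -/
noncomputable def hermite : ℕ → 𝓢(ℝ, ℂ)
  | 0 => groundState
  | n + 1 => (1 / Real.sqrt (n + 1) : ℂ) • raise (hermite n)

theorem sqrt_succ_ne_zero (n : ℕ) : (Real.sqrt (n + 1) : ℂ) ≠ 0 := by
  rw [Complex.ofReal_ne_zero]
  positivity

theorem raise_hermite (n : ℕ) :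
    raise (hermite n) = (Real.sqrt (n + 1) : ℂ) • hermite (n + 1) := by
  rw [hermite, smul_smul, mul_one_div_cancel (sqrt_succ_ne_zero n), one_smul]

theorem sqrt_succ_mul_self (n : ℕ) :
    (Real.sqrt (n + 1) : ℂ) * Real.sqrt (n + 1) = n + 1 := by
  rw [← Complex.ofReal_mul, Real.mul_self_sqrt (by positivity)]
  push_cast
  rfl

theorem lower_hermite_zero : lower (hermite 0) = 0 := lower_groundState

theorem raise_lower_hermite (n : ℕ) : raise (lower (hermite n)) = (n : ℂ) • hermite n := by
  induction n with
  | zero => rw [lower_hermite_zero, map_zero, Nat.cast_zero, zero_smul]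
  | succ n ih =>
    rw [hermite, map_smul, map_smul, lower_raise, ih, map_add, map_smul, smul_comm]
    push_cast
    module

theorem lower_hermite_succ (n : ℕ) :
    lower (hermite (n + 1)) = (Real.sqrt (n + 1) : ℂ) • hermite n := by
  have h : (n : ℂ) • hermite n + hermite n = ((n : ℂ) + 1) • hermite n := by module
  rw [hermite, map_smul, lower_raise, raise_lower_hermite, h, smul_smul,
    ← sqrt_succ_mul_self, ← mul_assoc, one_div_mul_cancel (sqrt_succ_ne_zero n), one_mul]

/-! ### Orthonormality of the Hermite functions -/

/-- The Hermite functions as elements of `L²(ℝ)`. -/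
noncomputable def hermiteL2 (n : ℕ) : L2 ℂ := incl ℂ (hermite n)

/-- A Gaussian integral. Its value depends on |z| only, which starts the induction in
`weylCoeff_rotate`. -/
theorem inner_weyl_groundState (z : ℂ) :
    (inner ℂ (hermiteL2 0) (weyl z (hermiteL2 0)) : ℂ) =
      Complex.exp (-(Complex.normSq z : ℂ) / 4) := by
  rw [hermiteL2, weyl_incl, inner_incl]
  have hpi : ((Real.pi ^ (-(1 / 4 : ℝ)) : ℝ) : ℂ) * ((Real.pi ^ (-(1 / 4 : ℝ)) : ℝ) : ℂ) *
      (Real.pi / -(-1) : ℂ) ^ (1 / 2 : ℂ) = 1 := by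
    have h1 : (Real.pi / -(-1) : ℂ) ^ (1 / 2 : ℂ) = ((Real.pi ^ (1 / 2 : ℝ) : ℝ) : ℂ) := by
      rw [Complex.ofReal_cpow Real.pi_pos.le]
      norm_num
    rw [h1, ← Complex.ofReal_mul, ← Complex.ofReal_mul, ← Real.rpow_add Real.pi_pos,
      ← Real.rpow_add Real.pi_pos]
    norm_num
  have h : ∀ x : ℝ, sweyl z (hermite 0) x * (starRingEnd ℂ) (hermite 0 x) =
      ((Real.pi ^ (-(1 / 4 : ℝ)) : ℝ) : ℂ) * ((Real.pi ^ (-(1 / 4 : ℝ)) : ℝ) : ℂ) *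
      Complex.exp ((-1) * (x : ℂ) ^ 2 + (z.re - Complex.I * z.im) * x +
        (Complex.I * (z.re * z.im) / 2 - (z.re : ℂ) ^ 2 / 2)) := by
    intro x
    rw [sweyl_apply, hermite, groundState_apply, groundState_apply, map_mul, Complex.conj_ofReal,
      ← Complex.exp_conj, phase]
    simp only [map_neg, map_div₀, map_pow, Complex.conj_ofReal, map_ofNat]
    rw [show ∀ a b c d e : ℂ, a * (b * c) * (d * e) = b * d * (a * c * e) by intros; ring,
      ← Complex.exp_add, ← Complex.exp_add]
    congr 2
    push_cast
    ring
  simp_rw [h]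
  rw [integral_const_mul, integral_cexp_quadratic (by norm_num), ← mul_assoc, hpi, one_mul]
  congr 1
  rw [Complex.normSq_apply]
  push_cast
  linear_combination ((z.im : ℂ) ^ 2 / 4) * Complex.I_sq

theorem inner_hermiteL2_self (n : ℕ) : (inner ℂ (hermiteL2 n) (hermiteL2 n) : ℂ) = 1 := by
  induction n with
  | zero => simpa [weyl_zero] using inner_weyl_groundState 0
  | succ n ih =>
    have h1 := inner_lower (hermite (n + 1)) (hermite n)
    rw [lower_hermite_succ, raise_hermite, map_smul, map_smul, inner_smul_left, inner_smul_right,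
      Complex.conj_ofReal] at h1
    exact (mul_left_cancel₀ (sqrt_succ_ne_zero n) h1).symm.trans ih

/-- Eigenvectors of the symmetric operator a*a for different eigenvalues. -/
theorem inner_hermiteL2_of_ne {m n : ℕ} (h : m ≠ n) :
    (inner ℂ (hermiteL2 m) (hermiteL2 n) : ℂ) = 0 := by
  have h1 : (inner ℂ (incl ℂ (raise (lower (hermite m)))) (hermiteL2 n) : ℂ) =
      inner ℂ (hermiteL2 m) (incl ℂ (raise (lower (hermite n)))) := by
    rw [hermiteL2, hermiteL2, inner_raise, inner_lower]
  rw [raise_lower_hermite, raise_lower_hermite, map_smul, map_smul, inner_smul_left,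
    inner_smul_right, Complex.conj_natCast] at h1
  have h2 : ((m : ℂ) - n) * inner ℂ (hermiteL2 m) (hermiteL2 n) = 0 := by
    rw [sub_mul]; exact sub_eq_zero.2 h1
  refine (mul_eq_zero.1 h2).resolve_left fun h3 => h ?_
  exact_mod_cast sub_eq_zero.1 h3

theorem orthonormal_hermiteL2 : Orthonormal ℂ hermiteL2 := by
  refine ⟨fun n => ?_, fun m n h => inner_hermiteL2_of_ne h⟩
  rw [← pow_left_inj₀ (norm_nonneg _) zero_le_one two_ne_zero, ← inner_self_eq_norm_sq (𝕜 := ℂ),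
    inner_hermiteL2_self]
  simp

/-! ### Matrix coefficients of the Heisenberg-Weyl operators -/

/-- The matrix coefficients of `T_z` in the basis of Hermite functions. -/
noncomputable def weylCoeff (z : ℂ) (n m : ℕ) : ℂ :=
  inner ℂ (hermiteL2 n) (weyl z (hermiteL2 m))

/-- A raising operator on the left is moved to the right as a lowering operator, and passing T_z
costs a scalar. Together with `inner_raise_weyl` this gives recursions which determine all matrix
coefficients from the one at (0, 0). -/
theorem inner_lower_weyl (z : ℂ) (f g : 𝓢(ℝ, ℂ)) :
    (inner ℂ (incl ℂ (raise f)) (weyl z (incl ℂ g)) : ℂ) =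
      inner ℂ (incl ℂ f) (weyl z (incl ℂ (lower g))) +
        (1 / Real.sqrt 2 : ℂ) * (starRingEnd ℂ) z * inner ℂ (incl ℂ f) (weyl z (incl ℂ g)) := by
  rw [weyl_incl, weyl_incl, inner_raise, lower_sweyl, map_add, map_smul, inner_add_right,
    inner_smul_right]

theorem inner_raise_weyl (z : ℂ) (f g : 𝓢(ℝ, ℂ)) :
    (inner ℂ (incl ℂ (lower f)) (weyl z (incl ℂ g)) : ℂ) =
      inner ℂ (incl ℂ f) (weyl z (incl ℂ (raise g))) +
        (1 / Real.sqrt 2 : ℂ) * z * inner ℂ (incl ℂ f) (weyl z (incl ℂ g)) := by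
  rw [weyl_incl, weyl_incl, inner_lower, raise_sweyl, map_add, map_smul, inner_add_right,
    inner_smul_right]

theorem weylCoeff_zero_succ (z : ℂ) (m : ℕ) :
    (Real.sqrt (m + 1) : ℂ) * weylCoeff z 0 (m + 1) =
      -((1 / Real.sqrt 2 : ℂ) * z * weylCoeff z 0 m) := by
  have h := inner_raise_weyl z (hermite 0) (hermite m)
  rw [lower_hermite_zero, map_zero, inner_zero_left, raise_hermite, map_smul, map_smul,
    inner_smul_right] at h
  exact eq_neg_of_add_eq_zero_left h.symm

theorem weylCoeff_succ_zero (z : ℂ) (n : ℕ) :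
    (Real.sqrt (n + 1) : ℂ) * weylCoeff z (n + 1) 0 =
      (1 / Real.sqrt 2 : ℂ) * (starRingEnd ℂ) z * weylCoeff z n 0 := by
  have h := inner_lower_weyl z (hermite n) (hermite 0)
  rw [lower_hermite_zero, raise_hermite, map_smul, map_zero, map_zero, inner_zero_right, zero_add,
    inner_smul_left, Complex.conj_ofReal] at h
  exact h

theorem weylCoeff_succ_succ (z : ℂ) (n m : ℕ) :
    (Real.sqrt (n + 1) : ℂ) * weylCoeff z (n + 1) (m + 1) =
      (Real.sqrt (m + 1) : ℂ) * weylCoeff z n m +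
        (1 / Real.sqrt 2 : ℂ) * (starRingEnd ℂ) z * weylCoeff z n (m + 1) := by
  have h := inner_lower_weyl z (hermite n) (hermite (m + 1))
  rw [lower_hermite_succ, raise_hermite, map_smul, map_smul, map_smul, inner_smul_right,
    inner_smul_left, Complex.conj_ofReal] at h
  exact h

theorem exp_succ_mul (φ : ℝ) (n : ℕ) :
    Complex.exp (-(Complex.I * φ * (n + 1 : ℕ))) =
      Complex.exp (-(Complex.I * φ)) * Complex.exp (-(Complex.I * φ * n)) := by
  rw [← Complex.exp_add]
  congr 1
  push_cast
  ring

theorem exp_neg_mul_exp (w : ℂ) : Complex.exp (-w) * Complex.exp w = 1 := by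
  rw [← Complex.exp_add, neg_add_cancel, Complex.exp_zero]

theorem conj_exp_I_mul (φ : ℝ) :
    (starRingEnd ℂ) (Complex.exp (Complex.I * φ)) = Complex.exp (-(Complex.I * φ)) := by
  rw [← Complex.exp_conj, map_mul, Complex.conj_I, Complex.conj_ofReal, neg_mul]

theorem normSq_exp_I_mul (φ : ℝ) : Complex.normSq (Complex.exp (Complex.I * φ)) = 1 := by
  rw [Complex.normSq_eq_norm_sq, mul_comm, Complex.norm_exp_ofReal_mul_I, one_pow]

/-- This is R_φ T_z = T_{e^{iφ}z} R_φ in coordinates. Both sides obey the same recursions in n and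
m, since each ladder step contributes the factor by which z or its conjugate is rotated, and both
have the same rotation invariant value at (0, 0). -/
theorem weylCoeff_rotate (z : ℂ) (φ : ℝ) (n m : ℕ) :
    Complex.exp (-(Complex.I * φ * n)) * weylCoeff z n m =
      Complex.exp (-(Complex.I * φ * m)) * weylCoeff (Complex.exp (Complex.I * φ) * z) n m := by
  have hE := exp_neg_mul_exp (Complex.I * φ)
  induction n generalizing m with
  | zero =>
    induction m with
    | zero =>
      rw [weylCoeff, weylCoeff, inner_weyl_groundState, inner_weyl_groundState,
        Complex.normSq_mul, normSq_exp_I_mul, one_mul]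
    | succ m ih =>
      refine mul_left_cancel₀ (sqrt_succ_ne_zero m) ?_
      have h1 := weylCoeff_zero_succ z m
      have h2 := weylCoeff_zero_succ (Complex.exp (Complex.I * φ) * z) m
      rw [mul_left_comm, h1, mul_left_comm, h2, exp_succ_mul]
      linear_combination (-(1 / Real.sqrt 2 : ℂ) * z) * ih + ((1 / Real.sqrt 2 : ℂ) * z *
        Complex.exp (-(Complex.I * φ * m)) *
        weylCoeff (Complex.exp (Complex.I * φ) * z) 0 m) * hE
  | succ n ih =>
    refine mul_left_cancel₀ (sqrt_succ_ne_zero n) ?_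
    rw [mul_left_comm, mul_left_comm _ _ (weylCoeff (_ * _) _ _)]
    cases m with
    | zero =>
      rw [weylCoeff_succ_zero, weylCoeff_succ_zero, map_mul, conj_exp_I_mul, exp_succ_mul]
      linear_combination (Complex.exp (-(Complex.I * φ)) * (1 / Real.sqrt 2 : ℂ) *
        (starRingEnd ℂ) z) * ih 0
    | succ m =>
      rw [weylCoeff_succ_succ, weylCoeff_succ_succ, map_mul, conj_exp_I_mul, exp_succ_mul]
      have h1 := ih (m + 1)
      rw [exp_succ_mul] at h1 ⊢
      linear_combination (Complex.exp (-(Complex.I * φ)) * (Real.sqrt (m + 1) : ℂ)) * ih m +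
        (Complex.exp (-(Complex.I * φ)) * (1 / Real.sqrt 2 : ℂ) * (starRingEnd ℂ) z) * h1

/-! ### Completeness of the Hermite functions -/

/-- The Hermite coefficients of the coherent state T_z h_0 have squares forming a Poisson
distribution of mean |z|²/2. -/
theorem norm_weylCoeff_zero_sq (z : ℂ) (n : ℕ) :
    ‖weylCoeff z n 0‖ ^ 2 =
      Real.exp (-(Complex.normSq z / 2)) * ((Complex.normSq z / 2) ^ n / n.factorial) := by
  induction n with
  | zero =>
    rw [weylCoeff, inner_weyl_groundState, Complex.norm_exp, ← Real.exp_nat_mul]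
    have : (-(Complex.normSq z : ℂ) / 4).re = -(Complex.normSq z) / 4 := by
      rw [show (-(Complex.normSq z : ℂ) / 4) = ((-(Complex.normSq z) / 4 : ℝ) : ℂ) by push_cast; rfl]
      exact Complex.ofReal_re _
    rw [this, pow_zero, Nat.factorial_zero, Nat.cast_one, div_one, mul_one]
    congr 1
    push_cast
    ring
  | succ n ih =>
    have h := congrArg (fun w : ℂ => ‖w‖ ^ 2) (weylCoeff_succ_zero z n)
    simp only [norm_mul, mul_pow, Complex.norm_real, RCLike.norm_conj, norm_div, norm_one,
      Real.norm_eq_abs, sq_abs, ih, div_pow, one_pow] at h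
    rw [Real.sq_sqrt (by positivity), Real.sq_sqrt (by norm_num), ← Complex.normSq_eq_norm_sq z] at h
    have hn : ((n : ℝ) + 1) ≠ 0 := by positivity
    refine mul_left_cancel₀ hn ?_
    rw [h, Nat.factorial_succ]
    push_cast
    rw [div_pow, pow_succ, pow_succ]
    field_simp

theorem norm_hermiteL2 (n : ℕ) : ‖hermiteL2 n‖ = 1 := orthonormal_hermiteL2.1 n

theorem norm_sub_sum_sq {v : L2 ℂ} (s : Finset ℕ) :
    ‖v - ∑ n ∈ s, (inner ℂ (hermiteL2 n) v : ℂ) • hermiteL2 n‖ ^ 2 =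
      ‖v‖ ^ 2 - ∑ n ∈ s, ‖(inner ℂ (hermiteL2 n) v : ℂ)‖ ^ 2 := by
  have h1 := norm_sub_sq (𝕜 := ℂ) v (∑ n ∈ s, (inner ℂ (hermiteL2 n) v : ℂ) • hermiteL2 n)
  have h2 : ‖∑ n ∈ s, (inner ℂ (hermiteL2 n) v : ℂ) • hermiteL2 n‖ ^ 2 =
      ∑ n ∈ s, ‖(inner ℂ (hermiteL2 n) v : ℂ)‖ ^ 2 := by
    rw [← inner_self_eq_norm_sq (𝕜 := ℂ), orthonormal_hermiteL2.inner_sum, map_sum]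
    refine Finset.sum_congr rfl fun n _ => ?_
    rw [mul_comm, RCLike.mul_conj]
    norm_cast
  have h3 : RCLike.re (inner ℂ v (∑ n ∈ s, (inner ℂ (hermiteL2 n) v : ℂ) • hermiteL2 n) : ℂ) =
      ∑ n ∈ s, ‖(inner ℂ (hermiteL2 n) v : ℂ)‖ ^ 2 := by
    rw [inner_sum, map_sum]
    refine Finset.sum_congr rfl fun n _ => ?_
    rw [inner_smul_right, ← inner_conj_symm v, RCLike.mul_conj]
    norm_cast
  rw [h1, h2, h3]
  ring

/-- The Poisson weights add up to 1 = ‖T_z h_0‖², so the coherent state is the limit of its Hermite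
partial sums, and orthogonality passes to the limit. Completeness of the Hermite functions is not
presupposed. -/
theorem inner_weyl_groundState_eq_zero {u : L2 ℂ}
    (hu : ∀ n, (inner ℂ (hermiteL2 n) u : ℂ) = 0) (z : ℂ) :
    (inner ℂ (weyl z (hermiteL2 0)) u : ℂ) = 0 := by
  set v := weyl z (hermiteL2 0) with hv
  have hsum : HasSum (fun n => ‖(inner ℂ (hermiteL2 n) v : ℂ)‖ ^ 2) 1 := by
    have h1 := (NormedSpace.expSeries_div_hasSum_exp (Complex.normSq z / 2)).mul_left
      (Real.exp (-(Complex.normSq z / 2)))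
    rw [← Real.exp_eq_exp_ℝ, ← Real.exp_add, neg_add_cancel, Real.exp_zero] at h1
    exact (funext (norm_weylCoeff_zero_sq z) :
      (fun n => ‖(inner ℂ (hermiteL2 n) v : ℂ)‖ ^ 2) = _) ▸ h1
  have hlim : Tendsto (fun s : Finset ℕ =>
      ‖v - ∑ n ∈ s, (inner ℂ (hermiteL2 n) v : ℂ) • hermiteL2 n‖ ^ 2 * ‖u‖ ^ 2) atTop (𝓝 0) := by
    have h1 : ‖v‖ = 1 := by rw [hv, norm_weyl, norm_hermiteL2]
    simp_rw [norm_sub_sum_sq, h1]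
    have := (tendsto_const_nhds (x := (1 : ℝ) ^ 2)).sub hsum |>.mul_const (‖u‖ ^ 2)
    simpa using this
  have hle (s : Finset ℕ) : ‖(inner ℂ v u : ℂ)‖ ^ 2 ≤
      ‖v - ∑ n ∈ s, (inner ℂ (hermiteL2 n) v : ℂ) • hermiteL2 n‖ ^ 2 * ‖u‖ ^ 2 := by
    have h1 : (inner ℂ v u : ℂ) =
        inner ℂ (v - ∑ n ∈ s, (inner ℂ (hermiteL2 n) v : ℂ) • hermiteL2 n) u := by
      rw [inner_sub_left, sum_inner, Finset.sum_eq_zero, sub_zero]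
      intro n _
      rw [inner_smul_left, hu, mul_zero]
    rw [h1, ← mul_pow]
    exact pow_le_pow_left₀ (norm_nonneg _) (norm_inner_le_norm _ _) 2
  have h0 := ge_of_tendsto' hlim hle
  exact norm_eq_zero.1 (pow_eq_zero_iff two_ne_zero |>.1 (le_antisymm h0 (by positivity)))

open scoped FourierTransform ContDiff in
-- A smooth test function with compact support is the Fourier transform of a Schwartz function Φ,
-- and the transform can be moved from Φ to g under the integral.
theorem ae_eq_zero_of_fourier_eq_zero {g : ℝ → ℂ} (hg : Integrable g) (h : ∀ w, 𝓕 g w = 0) :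
    ∀ᵐ x, g x = 0 := by
  refine ae_eq_zero_of_integral_contDiff_smul_eq_zero hg.locallyIntegrable fun ψ hψ hc => ?_
  have hψ' : ContDiff ℝ ∞ (fun x => (ψ x : ℂ)) := Complex.ofRealCLM.contDiff.comp hψ
  have hc' : HasCompactSupport (fun x => (ψ x : ℂ)) := hc.comp_left Complex.ofReal_zero
  let Ψ : 𝓢(ℝ, ℂ) := hc'.toSchwartzMap hψ'
  obtain ⟨Φ, hΦ⟩ : ∃ Φ : 𝓢(ℝ, ℂ), 𝓕 Φ = Ψ := ⟨𝓕⁻ Ψ, FourierTransform.fourier_fourierInv_eq Ψ⟩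
  have hint : Integrable Φ (volume : Measure ℝ) := SchwartzMap.integrable _
  have h1 : ∫ x, (𝓕 Φ : 𝓢(ℝ, ℂ)) x • g x = ∫ x, Φ x • 𝓕 g x := by
    simpa using! VectorFourier.integral_fourierIntegral_smul_eq_flip (L := innerₗ ℝ)
      Real.continuous_fourierChar continuous_inner hint hg
  rw [hΦ] at h1
  simp only [h, smul_zero, integral_zero] at h1
  exact h1

theorem conj_groundState (x : ℝ) : (starRingEnd ℂ) (groundState x) = groundState x := by
  rw [groundState_apply, map_mul, Complex.conj_ofReal, ← Complex.exp_conj, map_neg, map_div₀,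
    map_pow, Complex.conj_ofReal, map_ofNat]

theorem groundState_ne_zero (x : ℝ) : groundState x ≠ 0 := by
  rw [groundState_apply]
  refine mul_ne_zero ?_ (Complex.exp_ne_zero _)
  rw [Complex.ofReal_ne_zero]
  exact (Real.rpow_pos_of_pos Real.pi_pos _).ne'

open scoped FourierTransform in
-- A vector orthogonal to all coherent states e^{ikx} h_0 makes the Fourier transform of h_0 u
-- vanish, and h_0 has no zeros.
theorem eq_zero_of_inner_hermiteL2 {u : L2 ℂ} (hu : ∀ n, (inner ℂ (hermiteL2 n) u : ℂ) = 0) :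
    u = 0 := by
  have hint : Integrable (fun x => groundState x * u x) := by
    have h1 : MemLp groundState 2 (volume : Measure ℝ) := groundState.memLp 2 (volume : Measure ℝ)
    exact h1.integrable_mul (Lp.memLp u)
  have hF (w : ℝ) : 𝓕 (fun x => groundState x * u x) w = 0 := by
    -- With real part 0 and imaginary part -2πw the operator T_z is multiplication by e^{2πiwx}; its
    -- conjugate is the Fourier kernel.
    have h := inner_weyl_groundState_eq_zero hu ⟨0, -(2 * Real.pi * w)⟩
    rw [hermiteL2, weyl_incl, L2.inner_def] at h
    rw [Real.fourier_real_eq_integral_exp_smul]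
    refine Eq.trans (integral_congr_ae ?_) h
    filter_upwards [coeFn_incl (sweyl ⟨0, -(2 * Real.pi * w)⟩ (hermite 0))] with x hx
    rw [hx, sweyl_apply, RCLike.inner_apply, map_mul, hermite, sub_zero, conj_groundState, phase,
      ← Complex.exp_conj, smul_eq_mul, map_mul, Complex.conj_I, Complex.conj_ofReal]
    rw [mul_comm (u x), ← mul_assoc]
    congr 3
    push_cast
    ring
  have h := ae_eq_zero_of_fourier_eq_zero hint hF
  refine Lp.ext ?_
  filter_upwards [h, Lp.coeFn_zero ℂ 2 (volume : Measure ℝ)] with x hx h0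
  rw [h0]
  exact (mul_eq_zero.1 hx).resolve_left (groundState_ne_zero x)

/-- The basis of Hermite functions. -/
noncomputable def hermiteBasis : HilbertBasis ℕ ℂ (L2 ℂ) :=
  HilbertBasis.mkOfOrthogonalEqBot orthonormal_hermiteL2 <| by
    rw [Submodule.eq_bot_iff]
    intro u hu
    refine eq_zero_of_inner_hermiteL2 fun n => ?_
    exact Submodule.mem_orthogonal _ _ |>.1 hu _ (Submodule.subset_span ⟨n, rfl⟩)

theorem ext_inner_hermiteL2 {u v : L2 ℂ}
    (h : ∀ n, (inner ℂ (hermiteL2 n) u : ℂ) = inner ℂ (hermiteL2 n) v) : u = v := by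
  refine sub_eq_zero.1 (eq_zero_of_inner_hermiteL2 fun n => ?_)
  rw [inner_sub_right, h, sub_self]

theorem ext_hermiteL2 {B C : L2 ℂ →L[ℂ] L2 ℂ} (h : ∀ n, B (hermiteL2 n) = C (hermiteL2 n)) :
    B = C := by
  refine ContinuousLinearMap.ext_on (s := Set.range hermiteBasis) ?_ ?_
  · rw [Submodule.dense_iff_topologicalClosure_eq_top]
    exact hermiteBasis.dense_span
  · rintro _ ⟨n, rfl⟩
    rw [hermiteBasis, HilbertBasis.coe_mkOfOrthogonalEqBot]
    exact h n

/-! ### The operators `R_φ` -/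

theorem hermiteL2_mem_eigenspace (n : ℕ) : hermiteL2 n ∈ eigenspace oscillator (n + 1 / 2) := by
  refine ⟨LinearMap.mem_range_self _ _, ?_⟩
  refine (ofSchwartz_apply _ _).trans ?_
  rw [half_mulX_sub_ddx, raise_lower_hermite, ← add_smul, map_smul]
  push_cast
  rfl

theorem fracFourier_exponent (φ : ℝ) (n : ℕ) :
    Complex.exp (Complex.I * φ * (1 / 2 - ((n + 1 / 2 : ℝ) : ℂ))) =
      Complex.exp (-(Complex.I * φ * n)) := by
  congr 1
  push_cast
  ring

theorem fracFourier_hermiteL2 (φ : ℝ) (n : ℕ) :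
    fracFourier φ (hermiteL2 n) = Complex.exp (-(Complex.I * φ * n)) • hermiteL2 n := by
  rw [← fracFourier_exponent]
  exact boundedFunctionOf_eigenvector _ _ (hermiteL2_mem_eigenspace n)

theorem inner_fracFourier (φ : ℝ) (n : ℕ) (u : L2 ℂ) :
    (inner ℂ (hermiteL2 n) (fracFourier φ u) : ℂ) =
      Complex.exp (-(Complex.I * φ * n)) * inner ℂ (hermiteL2 n) u := by
  rw [← fracFourier_exponent]
  exact inner_boundedFunctionOf _ _ (hermiteL2_mem_eigenspace n) u

theorem fracFourier_weyl (φ : ℝ) (z : ℂ) (u : L2 ℂ) :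
    fracFourier φ (weyl z u) = weyl (Complex.exp (Complex.I * φ) * z) (fracFourier φ u) := by
  have h : fracFourier φ ∘L weyl z = weyl (Complex.exp (Complex.I * φ) * z) ∘L fracFourier φ := by
    refine ext_hermiteL2 fun m => ext_inner_hermiteL2 fun n => ?_
    rw [ContinuousLinearMap.comp_apply, ContinuousLinearMap.comp_apply, inner_fracFourier,
      fracFourier_hermiteL2, map_smul, inner_smul_right]
    exact weylCoeff_rotate z φ n m
  exact DFunLike.congr_fun h u

theorem fracFourier_fracFourier (φ ψ : ℝ) (u : L2 ℂ) :
    fracFourier φ (fracFourier ψ u) = fracFourier (φ + ψ) u := by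
  refine ext_inner_hermiteL2 fun n => ?_
  rw [inner_fracFourier, inner_fracFourier, inner_fracFourier, ← mul_assoc, ← Complex.exp_add]
  congr 2
  push_cast
  ring

theorem inner_fracFourier_right (φ : ℝ) (u v : L2 ℂ) :
    (inner ℂ u (fracFourier φ v) : ℂ) = inner ℂ (fracFourier (-φ) u) v := by
  have h : (fracFourier φ).adjoint = fracFourier (-φ) := by
    refine ext_hermiteL2 fun m => ext_inner_hermiteL2 fun n => ?_
    rw [ContinuousLinearMap.adjoint_inner_right, inner_fracFourier, fracFourier_hermiteL2,
      inner_smul_left, ← Complex.exp_conj]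
    by_cases hmn : m = n
    · subst hmn
      simp
    · rw [inner_hermiteL2_of_ne (Ne.symm hmn), mul_zero, mul_zero]
  rw [← ContinuousLinearMap.adjoint_inner_left, h]

/-! ### A space of test vectors invariant under all the operators -/

theorem fracFourier_zero (u : L2 ℂ) : fracFourier 0 u = u := by
  refine ext_inner_hermiteL2 fun n => ?_
  rw [inner_fracFourier]
  simp

theorem inner_hermiteL2_lower (n : ℕ) (f : 𝓢(ℝ, ℂ)) :
    (inner ℂ (hermiteL2 n) (incl ℂ (lower f)) : ℂ) =
      (Real.sqrt (n + 1) : ℂ) * inner ℂ (hermiteL2 (n + 1)) (incl ℂ f) := by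
  rw [hermiteL2, ← inner_raise, raise_hermite, map_smul, inner_smul_left, Complex.conj_ofReal]
  rfl

theorem inner_hermiteL2_succ_raise (n : ℕ) (f : 𝓢(ℝ, ℂ)) :
    (inner ℂ (hermiteL2 (n + 1)) (incl ℂ (raise f)) : ℂ) =
      (Real.sqrt (n + 1) : ℂ) * inner ℂ (hermiteL2 n) (incl ℂ f) := by
  rw [hermiteL2, ← inner_lower, lower_hermite_succ, map_smul, inner_smul_left,
    Complex.conj_ofReal]
  rfl

theorem inner_hermiteL2_zero_raise (f : 𝓢(ℝ, ℂ)) :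
    (inner ℂ (hermiteL2 0) (incl ℂ (raise f)) : ℂ) = 0 := by
  rw [hermiteL2, ← inner_lower, lower_hermite_zero, map_zero, inner_zero_left]

/-- R_φ is diagonal with eigenvalues e^{-inφ} and the lowering operator shifts n by one. Comparing
Hermite coefficients shows at once that the image is again a Schwartz function. -/
theorem fracFourier_lower {φ : ℝ} {f g : 𝓢(ℝ, ℂ)} (h : fracFourier φ (incl ℂ f) = incl ℂ g) :
    fracFourier φ (incl ℂ (lower f)) =
      incl ℂ (Complex.exp (Complex.I * φ) • lower g) := by
  refine ext_inner_hermiteL2 fun n => ?_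
  rw [inner_fracFourier, map_smul, inner_smul_right, inner_hermiteL2_lower,
    inner_hermiteL2_lower, ← h, inner_fracFourier, exp_succ_mul]
  linear_combination (-(Complex.exp (-(Complex.I * φ * n)) * (Real.sqrt (n + 1) : ℂ) *
    inner ℂ (hermiteL2 (n + 1)) (incl ℂ f))) * exp_neg_mul_exp (Complex.I * φ)

theorem fracFourier_raise {φ : ℝ} {f g : 𝓢(ℝ, ℂ)} (h : fracFourier φ (incl ℂ f) = incl ℂ g) :
    fracFourier φ (incl ℂ (raise f)) =
      incl ℂ (Complex.exp (-(Complex.I * φ)) • raise g) := by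
  refine ext_inner_hermiteL2 fun n => ?_
  rw [inner_fracFourier, map_smul, inner_smul_right]
  cases n with
  | zero => rw [inner_hermiteL2_zero_raise, inner_hermiteL2_zero_raise, mul_zero, mul_zero]
  | succ n =>
    rw [inner_hermiteL2_succ_raise, inner_hermiteL2_succ_raise, ← h, inner_fracFourier,
      exp_succ_mul]
    ring

/-- The vectors `u` for which all `R_φ u` are Schwartz functions. -/
noncomputable def testSpace : Submodule ℂ (L2 ℂ) :=
  ⨅ φ : ℝ, (LinearMap.range (incl ℂ)).comap (fracFourier φ).toLinearMap

theorem mem_testSpace {u : L2 ℂ} :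
    u ∈ testSpace ↔ ∀ φ : ℝ, ∃ f, incl ℂ f = fracFourier φ u := by
  simp only [testSpace, Submodule.mem_iInf]
  rfl

theorem exists_of_mem_testSpace {u : L2 ℂ} (hu : u ∈ testSpace) : ∃ f, incl ℂ f = u := by
  obtain ⟨f, hf⟩ := mem_testSpace.1 hu 0
  exact ⟨f, by rw [hf, fracFourier_zero]⟩

theorem testSpace_le : testSpace ≤ LinearMap.range (incl ℂ) :=
  fun _ hu => exists_of_mem_testSpace hu

/-- Demanding that the whole orbit under the R_φ consist of Schwartz functions builds in invariance
under rotation, so it is never necessary to know that R_φ preserves the Schwartz space. Invariance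
under T_z follows from the covariance R_φ T_z = T_{e^{iφ}z} R_φ. -/
theorem weyl_mem_testSpace (z : ℂ) {u : L2 ℂ} (hu : u ∈ testSpace) : weyl z u ∈ testSpace := by
  refine mem_testSpace.2 fun φ => ?_
  obtain ⟨f, hf⟩ := mem_testSpace.1 hu φ
  exact ⟨sweyl (Complex.exp (Complex.I * φ) * z) f, by rw [fracFourier_weyl, ← hf, weyl_incl]⟩

theorem fracFourier_mem_testSpace (φ : ℝ) {u : L2 ℂ} (hu : u ∈ testSpace) :
    fracFourier φ u ∈ testSpace := by
  refine mem_testSpace.2 fun ψ => ?_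
  rw [fracFourier_fracFourier]
  exact mem_testSpace.1 hu _

theorem hermiteL2_mem_testSpace (n : ℕ) : hermiteL2 n ∈ testSpace :=
  mem_testSpace.2 fun φ => ⟨_, by rw [fracFourier_hermiteL2, hermiteL2, ← map_smul]⟩

theorem lower_mem_testSpace {f : 𝓢(ℝ, ℂ)} (hf : incl ℂ f ∈ testSpace) :
    incl ℂ (lower f) ∈ testSpace := by
  refine mem_testSpace.2 fun φ => ?_
  obtain ⟨g, hg⟩ := mem_testSpace.1 hf φ
  exact ⟨_, (fracFourier_lower hg.symm).symm⟩

theorem raise_mem_testSpace {f : 𝓢(ℝ, ℂ)} (hf : incl ℂ f ∈ testSpace) :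
    incl ℂ (raise f) ∈ testSpace := by
  refine mem_testSpace.2 fun φ => ?_
  obtain ⟨g, hg⟩ := mem_testSpace.1 hf φ
  exact ⟨_, (fracFourier_raise hg.symm).symm⟩

/-- The algebra of operators on the test vectors. -/
abbrev TestEnd : Type := Module.End ℂ testSpace

/-- The restriction to the test vectors of an operator on the Schwartz space. -/
noncomputable def restrictSchwartz (A : 𝓢(ℝ, ℂ) →ₗ[ℂ] 𝓢(ℝ, ℂ))
    (hA : ∀ f, incl ℂ f ∈ testSpace → incl ℂ (A f) ∈ testSpace) : TestEnd :=
  ((ofSchwartz A).toFun ∘ₗ Submodule.inclusion testSpace_le).codRestrict testSpace (by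
    rintro ⟨u, hu⟩
    obtain ⟨f, rfl⟩ := exists_of_mem_testSpace hu
    have h : ((ofSchwartz A).toFun ∘ₗ Submodule.inclusion testSpace_le) ⟨incl ℂ f, hu⟩ =
        incl ℂ (A f) := ofSchwartz_apply A f
    rw [h]
    exact hA f hu)

theorem restrictSchwartz_apply {A : 𝓢(ℝ, ℂ) →ₗ[ℂ] 𝓢(ℝ, ℂ)}
    (hA : ∀ f, incl ℂ f ∈ testSpace → incl ℂ (A f) ∈ testSpace) (f : 𝓢(ℝ, ℂ))
    (hf : incl ℂ f ∈ testSpace) :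
    restrictSchwartz A hA ⟨incl ℂ f, hf⟩ = ⟨incl ℂ (A f), hA f hf⟩ :=
  Subtype.ext (ofSchwartz_apply A f)

/-- The lowering operator on test vectors. -/
noncomputable def tLower : TestEnd := restrictSchwartz lower fun _ => lower_mem_testSpace

/-- The raising operator on test vectors. -/
noncomputable def tRaise : TestEnd := restrictSchwartz raise fun _ => raise_mem_testSpace

/-- The operator `T_z` on test vectors. -/
noncomputable def tWeyl (z : ℂ) : TestEnd :=
  (weyl z).toLinearMap.restrict fun _ => weyl_mem_testSpace z

/-- The operator `R_φ` on test vectors. -/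
noncomputable def tFrac (φ : ℝ) : TestEnd :=
  (fracFourier φ).toLinearMap.restrict fun _ => fracFourier_mem_testSpace φ

/-- The Hermite functions as test vectors. -/
noncomputable def tHermite (n : ℕ) : testSpace := ⟨hermiteL2 n, hermiteL2_mem_testSpace n⟩

theorem coe_tWeyl (z : ℂ) (u : testSpace) : (tWeyl z u : L2 ℂ) = weyl z u := rfl

theorem coe_tFrac (φ : ℝ) (u : testSpace) : (tFrac φ u : L2 ℂ) = fracFourier φ u := rfl

theorem testEnd_ext {x y : TestEnd}
    (h : ∀ f (hf : incl ℂ f ∈ testSpace), x ⟨incl ℂ f, hf⟩ = y ⟨incl ℂ f, hf⟩) : x = y := by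
  ext1 ⟨u, hu⟩
  obtain ⟨f, rfl⟩ := exists_of_mem_testSpace hu
  exact h f hu

theorem tLower_apply (f : 𝓢(ℝ, ℂ)) (hf : incl ℂ f ∈ testSpace) :
    tLower ⟨incl ℂ f, hf⟩ = ⟨incl ℂ (lower f), lower_mem_testSpace hf⟩ :=
  restrictSchwartz_apply _ f hf

theorem tRaise_apply (f : 𝓢(ℝ, ℂ)) (hf : incl ℂ f ∈ testSpace) :
    tRaise ⟨incl ℂ f, hf⟩ = ⟨incl ℂ (raise f), raise_mem_testSpace hf⟩ :=
  restrictSchwartz_apply _ f hf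

theorem sweyl_mem_testSpace (z : ℂ) {f : 𝓢(ℝ, ℂ)} (hf : incl ℂ f ∈ testSpace) :
    incl ℂ (sweyl z f) ∈ testSpace := by
  rw [← weyl_incl]
  exact weyl_mem_testSpace z hf

theorem tWeyl_apply (z : ℂ) (f : 𝓢(ℝ, ℂ)) (hf : incl ℂ f ∈ testSpace) :
    tWeyl z ⟨incl ℂ f, hf⟩ = ⟨incl ℂ (sweyl z f), sweyl_mem_testSpace z hf⟩ :=
  Subtype.ext (weyl_incl z f)

theorem tLower_mul_tRaise : tLower * tRaise = tRaise * tLower + 1 := by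
  refine testEnd_ext fun f hf => Subtype.ext ?_
  rw [LinearMap.add_apply, Module.End.mul_apply, Module.End.mul_apply, tRaise_apply, tLower_apply,
    tLower_apply, tRaise_apply]
  exact (congrArg (incl ℂ) (lower_raise f)).trans (map_add _ _ _)

theorem tLower_mul_tWeyl (z : ℂ) :
    tLower * tWeyl z = tWeyl z * tLower + ((1 / Real.sqrt 2 : ℂ) * (starRingEnd ℂ) z) • tWeyl z := by
  refine testEnd_ext fun f hf => Subtype.ext ?_
  rw [LinearMap.add_apply, LinearMap.smul_apply, Module.End.mul_apply, Module.End.mul_apply,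
    tWeyl_apply, tLower_apply, tLower_apply, tWeyl_apply]
  refine (congrArg (incl ℂ) (lower_sweyl z f)).trans ((map_add _ _ _).trans ?_)
  exact congrArg _ (map_smul _ _ _)

theorem tRaise_mul_tWeyl (z : ℂ) :
    tRaise * tWeyl z = tWeyl z * tRaise + ((1 / Real.sqrt 2 : ℂ) * z) • tWeyl z := by
  refine testEnd_ext fun f hf => Subtype.ext ?_
  rw [LinearMap.add_apply, LinearMap.smul_apply, Module.End.mul_apply, Module.End.mul_apply,
    tWeyl_apply, tRaise_apply, tRaise_apply, tWeyl_apply]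
  refine (congrArg (incl ℂ) (raise_sweyl z f)).trans ((map_add _ _ _).trans ?_)
  exact congrArg _ (map_smul _ _ _)

theorem tWeyl_mul_tWeyl (z w : ℂ) :
    tWeyl z * tWeyl w =
      Complex.exp (Complex.I * (w * (starRingEnd ℂ) z).im / 2) • tWeyl (z + w) := by
  ext1 u
  refine Subtype.ext ?_
  rw [LinearMap.smul_apply, Module.End.mul_apply, Submodule.coe_smul, coe_tWeyl, coe_tWeyl,
    coe_tWeyl]
  rw [weyl_weyl]

theorem tWeyl_zero : tWeyl 0 = 1 := by
  ext1 u
  exact Subtype.ext (weyl_zero _)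

theorem tWeyl_mul_tWeyl_neg (z : ℂ) : tWeyl z * tWeyl (-z) = 1 := by
  ext1 u
  exact Subtype.ext (weyl_weyl_neg z _)

theorem tWeyl_neg_mul_tWeyl (z : ℂ) : tWeyl (-z) * tWeyl z = 1 := by
  ext1 u
  exact Subtype.ext (weyl_neg_weyl z _)

theorem tFrac_mul_tWeyl (φ : ℝ) (z : ℂ) :
    tFrac φ * tWeyl z = tWeyl (Complex.exp (Complex.I * φ) * z) * tFrac φ := by
  ext1 u
  exact Subtype.ext (fracFourier_weyl φ z u)

theorem tFrac_mul_tFrac (φ ψ : ℝ) : tFrac φ * tFrac ψ = tFrac (φ + ψ) := by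
  ext1 u
  exact Subtype.ext (fracFourier_fracFourier φ ψ u)

theorem tFrac_mul_tLower (φ : ℝ) :
    tFrac φ * tLower = Complex.exp (Complex.I * φ) • (tLower * tFrac φ) := by
  refine testEnd_ext fun f hf => Subtype.ext ?_
  obtain ⟨g, hg⟩ := mem_testSpace.1 hf φ
  have h1 : tFrac φ ⟨incl ℂ f, hf⟩ = ⟨incl ℂ g, hg ▸ fracFourier_mem_testSpace φ hf⟩ :=
    Subtype.ext hg.symm
  rw [LinearMap.smul_apply, Module.End.mul_apply, Module.End.mul_apply, tLower_apply, h1,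
    tLower_apply]
  exact (fracFourier_lower hg.symm).trans (map_smul _ _ _)

theorem tFrac_mul_tRaise (φ : ℝ) :
    tFrac φ * tRaise = Complex.exp (-(Complex.I * φ)) • (tRaise * tFrac φ) := by
  refine testEnd_ext fun f hf => Subtype.ext ?_
  obtain ⟨g, hg⟩ := mem_testSpace.1 hf φ
  have h1 : tFrac φ ⟨incl ℂ f, hf⟩ = ⟨incl ℂ g, hg ▸ fracFourier_mem_testSpace φ hf⟩ :=
    Subtype.ext hg.symm
  rw [LinearMap.smul_apply, Module.End.mul_apply, Module.End.mul_apply, tRaise_apply, h1,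
    tRaise_apply]
  exact (fracFourier_raise hg.symm).trans (map_smul _ _ _)

theorem tLower_tHermite_zero : tLower (tHermite 0) = 0 := by
  refine Subtype.ext ((congrArg Subtype.val (tLower_apply _ _)).trans ?_)
  change incl ℂ (lower (hermite 0)) = 0
  rw [lower_hermite_zero, map_zero]

theorem tLower_tHermite_succ (n : ℕ) :
    tLower (tHermite (n + 1)) = (Real.sqrt (n + 1) : ℂ) • tHermite n := by
  refine Subtype.ext ((congrArg Subtype.val (tLower_apply _ _)).trans ?_)
  change incl ℂ (lower (hermite (n + 1))) = _
  rw [lower_hermite_succ, map_smul]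
  rfl

theorem tRaise_tHermite (n : ℕ) :
    tRaise (tHermite n) = (Real.sqrt (n + 1) : ℂ) • tHermite (n + 1) := by
  refine Subtype.ext ((congrArg Subtype.val (tRaise_apply _ _)).trans ?_)
  change incl ℂ (raise (hermite n)) = _
  rw [raise_hermite, map_smul]
  rfl

theorem tFrac_tHermite (φ : ℝ) (n : ℕ) :
    tFrac φ (tHermite n) = Complex.exp (-(Complex.I * φ)) ^ n • tHermite n := by
  refine Subtype.ext ((fracFourier_hermiteL2 φ n).trans ?_)
  rw [← Complex.exp_nat_mul]
  congr 2
  ring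

theorem inner_tRaise (u v : testSpace) :
    (inner ℂ (tRaise u : L2 ℂ) (v : L2 ℂ) : ℂ) = inner ℂ (u : L2 ℂ) (tLower v : L2 ℂ) := by
  obtain ⟨_, hu⟩ := u
  obtain ⟨f, rfl⟩ := exists_of_mem_testSpace hu
  obtain ⟨_, hv⟩ := v
  obtain ⟨g, rfl⟩ := exists_of_mem_testSpace hv
  rw [tRaise_apply, tLower_apply]
  exact inner_raise f g

theorem inner_tLower (u v : testSpace) :
    (inner ℂ (tLower u : L2 ℂ) (v : L2 ℂ) : ℂ) = inner ℂ (u : L2 ℂ) (tRaise v : L2 ℂ) := by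
  rw [← inner_conj_symm, ← inner_tRaise, inner_conj_symm]

/-! ### Coordinates in `L²(ℝ, ℂ²)` -/

theorem coeFn_coord (i : Fin 2) (u : L2 C2) : (coord i u : ℝ → ℂ) =ᵐ[volume] fun x => u x i :=
  ContinuousLinearMap.coeFn_compLpL _ u

theorem coeFn_single (i : Fin 2) (u : L2 ℂ) :
    (single i u : ℝ → C2) =ᵐ[volume] fun x => u x • EuclideanSpace.single i (1 : ℂ) :=
  ContinuousLinearMap.coeFn_compLpL _ u

theorem coord_single_same (i : Fin 2) (u : L2 ℂ) : coord i (single i u) = u := by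
  refine Lp.ext ?_
  filter_upwards [coeFn_coord i (single i u), coeFn_single i u] with x h1 h2
  rw [h1, h2]
  simp

theorem coord_single_of_ne {i j : Fin 2} (h : i ≠ j) (u : L2 ℂ) : coord i (single j u) = 0 := by
  refine Lp.ext ?_
  filter_upwards [coeFn_coord i (single j u), coeFn_single j u,
    Lp.coeFn_zero ℂ 2 (volume : Measure ℝ)] with x h1 h2 h3
  rw [h1, h2, h3]
  simp [h]

theorem single_coord_add (u : L2 C2) : single 0 (coord 0 u) + single 1 (coord 1 u) = u := by
  refine Lp.ext ?_
  filter_upwards [coeFn_coord 0 u, coeFn_coord 1 u, coeFn_single 0 (coord 0 u),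
    coeFn_single 1 (coord 1 u), Lp.coeFn_add (single 0 (coord 0 u)) (single 1 (coord 1 u))]
    with x h1 h2 h3 h4 h5
  rw [h5, Pi.add_apply, h3, h4, h1, h2]
  ext i
  fin_cases i <;> simp

theorem inner_single_left (i : Fin 2) (u : L2 ℂ) (v : L2 C2) :
    (inner ℂ (single i u) v : ℂ) = inner ℂ u (coord i v) := by
  rw [L2.inner_def, L2.inner_def]
  refine integral_congr_ae ?_
  filter_upwards [coeFn_coord i v, coeFn_single i u] with x h1 h2
  simp only [h1, h2, inner_smul_left, EuclideanSpace.inner_single_left, map_one, one_mul,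
    RCLike.inner_apply]
  exact mul_comm _ _

theorem weyl_single (z : ℂ) (i : Fin 2) (u : L2 ℂ) :
    weyl z (single i u) = single i (weyl z u) := by
  refine Lp.ext ?_
  filter_upwards [coeFn_weyl z (single i u), ae_comp_sub (coeFn_single i u) z.re,
    coeFn_single i (weyl z u), coeFn_weyl z u] with x h1 h2 h3 h4
  rw [h1, h2, h3, h4, smul_eq_mul, mul_smul]

theorem coord_incl (i : Fin 2) (f : 𝓢(ℝ, C2)) : coord i (incl C2 f) = incl ℂ (scoord i f) := by
  refine Lp.ext ?_
  filter_upwards [coeFn_coord i (incl C2 f), coeFn_incl f, coeFn_incl (scoord i f)] with x h1 h2 h3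
  rw [h1, h2, h3]
  rfl

theorem single_incl (i : Fin 2) (f : 𝓢(ℝ, ℂ)) : single i (incl ℂ f) = incl C2 (ssingle i f) := by
  refine Lp.ext ?_
  filter_upwards [coeFn_single i (incl ℂ f), coeFn_incl f, coeFn_incl (ssingle i f)] with x h1 h2 h3
  rw [h1, h2, h3]
  rfl

/-! ### The Euler operator -/

theorem euler_incl (f : 𝓢(ℝ, C2)) :
    euler ⟨incl C2 f, LinearMap.mem_range_self _ f⟩ =
      single 0 (incl ℂ (raise (scoord 1 f))) + single 1 (incl ℂ (lower (scoord 0 f))) := by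
  refine (ofSchwartz_apply _ f).trans ?_
  rw [single_incl, single_incl, ← map_add]
  congr 1
  change (1 / Real.sqrt 2 : ℂ) • (ssingle 0 ((mulX - ddx) (scoord 1 f)) +
    ssingle 1 ((mulX + ddx) (scoord 0 f))) =
    ssingle 0 ((1 / Real.sqrt 2 : ℂ) • (mulX - ddx) (scoord 1 f)) +
      ssingle 1 ((1 / Real.sqrt 2 : ℂ) • (mulX + ddx) (scoord 0 f))
  rw [map_smul, map_smul, smul_add]

theorem exists_of_mem_euler_domain (w : euler.domain) :
    ∃ f : 𝓢(ℝ, C2), w = ⟨incl C2 f, LinearMap.mem_range_self _ f⟩ := by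
  obtain ⟨_, f, rfl⟩ := w
  exact ⟨f, rfl⟩

theorem euler_symmetric : euler.IsFormalAdjoint euler := by
  intro v w
  obtain ⟨f, rfl⟩ := exists_of_mem_euler_domain v
  obtain ⟨g, rfl⟩ := exists_of_mem_euler_domain w
  rw [euler_incl, euler_incl, inner_add_left, inner_single_left, inner_single_left, inner_add_right]
  change (inner ℂ _ (coord 0 (incl C2 g)) + inner ℂ _ (coord 1 (incl C2 g)) : ℂ) =
    inner ℂ (incl C2 f) _ + inner ℂ (incl C2 f) _
  rw [← inner_conj_symm (incl C2 f), ← inner_conj_symm (incl C2 f), inner_single_left,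
    inner_single_left, coord_incl, coord_incl, coord_incl, coord_incl, inner_conj_symm,
    inner_conj_symm, inner_raise, inner_lower, add_comm]

theorem euler_sq_symmetric : (comp euler euler).IsFormalAdjoint (comp euler euler) := by
  rintro ⟨v, hv⟩ ⟨w, hw⟩
  obtain ⟨h1, h2⟩ := mem_comp_domain.1 hv
  obtain ⟨h3, h4⟩ := mem_comp_domain.1 hw
  rw [comp_apply h1 h2, comp_apply h3 h4]
  exact (euler_symmetric ⟨_, h2⟩ ⟨w, h3⟩).trans (euler_symmetric ⟨v, h1⟩ ⟨_, h4⟩)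

/-! ### Test vectors in `L²(ℝ, ℂ²)` -/

/-- The inclusion of pairs of test vectors in `L²(ℝ, ℂ²)`. -/
noncomputable def testIncl : testSpace × testSpace →ₗ[ℂ] L2 C2 :=
  ((single 0).toLinearMap ∘ₗ testSpace.subtype).coprod
    ((single 1).toLinearMap ∘ₗ testSpace.subtype)

theorem testIncl_apply (v : testSpace × testSpace) :
    testIncl v = single 0 (v.1 : L2 ℂ) + single 1 (v.2 : L2 ℂ) := rfl

/-- The operators on pairs of test vectors given by `2 × 2` matrices. -/
noncomputable def block (p : Fin 2 → Fin 2 → TestEnd) : Module.End ℂ (testSpace × testSpace) :=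
  ((p 0 0).coprod (p 0 1)).prod ((p 1 0).coprod (p 1 1))

theorem block_apply (p : Fin 2 → Fin 2 → TestEnd) (v : testSpace × testSpace) :
    block p v = (p 0 0 v.1 + p 0 1 v.2, p 1 0 v.1 + p 1 1 v.2) := rfl

theorem block_mul (p p' : Fin 2 → Fin 2 → TestEnd) :
    block p * block p' = block fun i j => p i 0 * p' 0 j + p i 1 * p' 1 j := by
  refine LinearMap.ext fun v => ?_
  simp only [Module.End.mul_apply, block_apply, map_add, LinearMap.add_apply]
  exact Prod.ext (by simp only; abel) (by simp only; abel)

theorem block_add (p p' : Fin 2 → Fin 2 → TestEnd) :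
    block p + block p' = block (p + p') := by
  refine LinearMap.ext fun v => ?_
  simp only [block_apply, Pi.add_apply, LinearMap.add_apply, Prod.mk_add_mk]
  exact Prod.ext (by simp only; abel) (by simp only; abel)

theorem block_smul (c : ℂ) (p : Fin 2 → Fin 2 → TestEnd) : c • block p = block (c • p) := by
  refine LinearMap.ext fun v => ?_
  simp only [block_apply, Pi.smul_apply, LinearMap.smul_apply, Prod.smul_mk, smul_add]

theorem block_sub (p p' : Fin 2 → Fin 2 → TestEnd) :
    block p - block p' = block (p - p') := by
  refine LinearMap.ext fun v => ?_
  simp only [block_apply, Pi.sub_apply, LinearMap.sub_apply, Prod.mk_sub_mk]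
  exact Prod.ext (by simp only; abel) (by simp only; abel)

/-- The Euler operator on pairs of test vectors. -/
noncomputable def blockEuler : Module.End ℂ (testSpace × testSpace) :=
  block ![![0, tRaise], ![tLower, 0]]

/-- The operator `T_z` on pairs of test vectors. -/
noncomputable def blockWeyl (z : ℂ) : Module.End ℂ (testSpace × testSpace) :=
  block ![![tWeyl z, 0], ![0, tWeyl z]]

/-- The operator `𝐑_φ` on pairs of test vectors. -/
noncomputable def blockFrac (φ : ℝ) : Module.End ℂ (testSpace × testSpace) :=
  block ![![tFrac φ, 0], ![0, Complex.exp (-(Complex.I * φ)) • tFrac φ]]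

/-- The matrix `T_z⁻¹ [D, T_z]`. -/
noncomputable def blockShift (z : ℂ) : Module.End ℂ (testSpace × testSpace) :=
  block ![![0, ((1 / Real.sqrt 2 : ℂ) * z) • 1], ![((1 / Real.sqrt 2 : ℂ) * (starRingEnd ℂ) z) • 1, 0]]

theorem euler_testIncl (v : testSpace × testSpace) :
    ∃ h : testIncl v ∈ euler.domain, euler ⟨testIncl v, h⟩ = testIncl (blockEuler v) := by
  obtain ⟨⟨_, hu⟩, ⟨_, hv⟩⟩ := v
  obtain ⟨f, rfl⟩ := exists_of_mem_testSpace hu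
  obtain ⟨g, rfl⟩ := exists_of_mem_testSpace hv
  have h1 : testIncl (⟨incl ℂ f, hu⟩, ⟨incl ℂ g, hv⟩) = incl C2 (ssingle 0 f + ssingle 1 g) := by
    rw [testIncl_apply, single_incl, single_incl, map_add]
  have h2 : incl ℂ (scoord 0 (ssingle 0 f + ssingle 1 g)) = incl ℂ f := by
    rw [← coord_incl, ← h1, testIncl_apply, map_add, coord_single_same,
      coord_single_of_ne (by decide), add_zero]
  have h3 : incl ℂ (scoord 1 (ssingle 0 f + ssingle 1 g)) = incl ℂ g := by
    rw [← coord_incl, ← h1, testIncl_apply, map_add, coord_single_same,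
      coord_single_of_ne (by decide), zero_add]
  have h4 : testIncl (⟨incl ℂ f, hu⟩, ⟨incl ℂ g, hv⟩) ∈ euler.domain := by
    rw [h1]; exact LinearMap.mem_range_self _ _
  refine ⟨h4, ?_⟩
  have h5 : (⟨_, h4⟩ : euler.domain) = ⟨incl C2 (ssingle 0 f + ssingle 1 g),
      LinearMap.mem_range_self _ _⟩ := Subtype.ext h1
  rw [h5, euler_incl, incl_injective h2, incl_injective h3, blockEuler, block_apply, testIncl_apply]
  simp [tLower_apply, tRaise_apply]

theorem actsOn_euler : ActsOn testIncl euler blockEuler where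
  apply := euler_testIncl
  adjoint v := by
    obtain ⟨h, hv⟩ := euler_testIncl v
    exact ⟨blockEuler v, fun w => by rw [← hv]; exact (euler_symmetric ⟨_, h⟩ w).symm⟩

theorem weyl_testIncl (z : ℂ) (v : testSpace × testSpace) :
    weyl z (testIncl v) = testIncl (blockWeyl z v) := by
  rw [blockWeyl, block_apply, testIncl_apply, testIncl_apply, map_add, weyl_single, weyl_single]
  simp [coe_tWeyl]

theorem metaplectic_apply (φ : ℝ) (u : L2 C2) :
    metaplectic φ u = single 0 (fracFourier φ (coord 0 u)) +
      Complex.exp (-(Complex.I * φ)) • single 1 (fracFourier φ (coord 1 u)) := rfl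

theorem metaplectic_testIncl (φ : ℝ) (v : testSpace × testSpace) :
    metaplectic φ (testIncl v) = testIncl (blockFrac φ v) := by
  rw [blockFrac, block_apply, testIncl_apply, testIncl_apply, metaplectic_apply,
    map_add (coord 0), map_add (coord 1), coord_single_same, coord_single_same,
    coord_single_of_ne (by decide), coord_single_of_ne (by decide)]
  simp [coe_tFrac]

theorem inner_metaplectic_right (φ : ℝ) (u v : L2 C2) :
    (inner ℂ u (metaplectic φ v) : ℂ) = inner ℂ (metaplectic (-φ) u) v := by
  rw [metaplectic_apply, metaplectic_apply, inner_add_left, inner_smul_left, inner_single_left,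
    inner_single_left, inner_add_right, inner_smul_right, ← inner_conj_symm u,
    ← inner_conj_symm u, inner_single_left, inner_single_left, inner_conj_symm, inner_conj_symm,
    inner_fracFourier_right, inner_fracFourier_right, ← Complex.exp_conj]
  simp

theorem actsOn_weylMetaplectic (z : ℂ) (φ : ℝ) :
    ActsOn testIncl (ofBounded (weylMetaplectic z φ : L2 C2 →L[ℂ] L2 C2))
      (blockWeyl z * blockFrac φ) := by
  refine ActsOn.ofBounded (B' := metaplectic (-φ) * weyl (-z))
    (y := blockFrac (-φ) * blockWeyl (-z)) (fun v => ?_) (fun v => ?_) fun u v => ?_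
  · change weyl z (metaplectic φ (testIncl v)) = _
    rw [metaplectic_testIncl, weyl_testIncl]
    rfl
  · change metaplectic (-φ) (weyl (-z) (testIncl v)) = _
    rw [weyl_testIncl, metaplectic_testIncl]
    rfl
  · change inner ℂ u (weyl z (metaplectic φ v)) = inner ℂ (metaplectic (-φ) (weyl (-z) u)) v
    rw [inner_weyl_right, inner_metaplectic_right]

/-! ### Relations between the operators on pairs of test vectors -/

theorem block_congr {p p' : Fin 2 → Fin 2 → TestEnd} (h : ∀ i j, p i j = p' i j) :
    block p = block p' := by
  rw [show p = p' from funext fun i => funext fun j => h i j]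

/-- The factor e^{-iφ} in the second component of 𝐑_φ exactly compensates the phases that R_φ
acquires in passing the ladder operators. -/
theorem blockEuler_mul_blockFrac (φ : ℝ) :
    blockEuler * blockFrac φ = blockFrac φ * blockEuler := by
  rw [blockEuler, blockFrac, block_mul, block_mul]
  refine block_congr fun i j => ?_
  fin_cases i <;> fin_cases j <;> simp [tFrac_mul_tLower, tFrac_mul_tRaise, smul_smul,
    ← Complex.exp_add]

theorem blockFrac_mul_blockWeyl (φ : ℝ) (z : ℂ) :
    blockFrac φ * blockWeyl z = blockWeyl (Complex.exp (Complex.I * φ) * z) * blockFrac φ := by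
  rw [blockWeyl, blockWeyl, blockFrac, block_mul, block_mul]
  refine block_congr fun i j => ?_
  fin_cases i <;> fin_cases j <;> simp [tFrac_mul_tWeyl]

theorem blockFrac_mul_blockFrac (φ ψ : ℝ) :
    blockFrac φ * blockFrac ψ = blockFrac (φ + ψ) := by
  rw [blockFrac, blockFrac, blockFrac, block_mul]
  refine block_congr fun i j => ?_
  fin_cases i <;> fin_cases j <;> simp [tFrac_mul_tFrac, smul_smul, ← Complex.exp_add]
  congr 2
  ring

theorem blockWeyl_mul_blockWeyl (z w : ℂ) :
    blockWeyl z * blockWeyl w =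
      Complex.exp (Complex.I * (w * (starRingEnd ℂ) z).im / 2) • blockWeyl (z + w) := by
  rw [blockWeyl, blockWeyl, blockWeyl, block_mul, block_smul]
  refine block_congr fun i j => ?_
  fin_cases i <;> fin_cases j <;> simp [tWeyl_mul_tWeyl]

theorem block_one : block ![![1, 0], ![0, 1]] = 1 := by
  refine LinearMap.ext fun v => ?_
  simp [block_apply]

theorem blockWeyl_mul_blockWeyl_neg (z : ℂ) : blockWeyl z * blockWeyl (-z) = 1 := by
  rw [← block_one, blockWeyl, blockWeyl, block_mul]
  refine block_congr fun i j => ?_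
  fin_cases i <;> fin_cases j <;> simp [tWeyl_mul_tWeyl_neg]

/-- The entries of D are ladder operators, so [D, T_z] is T_z times a constant matrix. -/
theorem blockEuler_mul_blockWeyl (z : ℂ) :
    blockEuler * blockWeyl z = blockWeyl z * (blockEuler + blockShift z) := by
  rw [blockWeyl, blockEuler, blockShift, block_add, block_mul, block_mul]
  refine block_congr fun i j => ?_
  fin_cases i <;> fin_cases j <;> simp [tRaise_mul_tWeyl, tLower_mul_tWeyl, mul_add]

/-! ### Words in the ladder operators -/

/-- The span of the words of length at most `d` in the ladder operators. -/
noncomputable def ladderWords (d : ℕ) : Submodule ℂ TestEnd :=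
  Submodule.span ℂ {1, tLower, tRaise} ^ d

theorem one_mem_ladderWords_one : (1 : TestEnd) ∈ ladderWords 1 := by
  rw [ladderWords, pow_one]
  exact Submodule.subset_span (by simp)

theorem tLower_mem_ladderWords : tLower ∈ ladderWords 1 := by
  rw [ladderWords, pow_one]
  exact Submodule.subset_span (by simp)

theorem tRaise_mem_ladderWords : tRaise ∈ ladderWords 1 := by
  rw [ladderWords, pow_one]
  exact Submodule.subset_span (by simp)

theorem mul_mem_ladderWords {d e : ℕ} {p p' : TestEnd} (h : p ∈ ladderWords d)
    (h' : p' ∈ ladderWords e) : p * p' ∈ ladderWords (d + e) := by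
  rw [ladderWords, pow_add]
  exact Submodule.mul_mem_mul h h'

theorem ladderWords_mono {d e : ℕ} (h : d ≤ e) : ladderWords d ≤ ladderWords e := by
  refine monotone_nat_of_le_succ (fun n p hp => ?_) h
  have := mul_mem_ladderWords hp one_mem_ladderWords_one
  rwa [mul_one] at this

theorem smul_one_mem_ladderWords (c : ℂ) (d : ℕ) : c • (1 : TestEnd) ∈ ladderWords d := by
  refine Submodule.smul_mem _ _ (ladderWords_mono (Nat.zero_le d) ?_)
  rw [ladderWords, pow_zero]
  exact Submodule.one_le.1 le_rfl

theorem exists_of_mem_ladderWords_zero {p : TestEnd} (h : p ∈ ladderWords 0) :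
    ∃ c : ℂ, p = c • 1 := by
  rw [ladderWords, pow_zero] at h
  obtain ⟨c, hc⟩ := Submodule.mem_one.1 h
  exact ⟨c, by rw [← hc, Algebra.algebraMap_eq_smul_one]⟩

/-- Induction principle for words that grow on the left; `ladderWords_succ_le_right` is the version
growing on the right, needed when the new letter is the first to act on a basis vector. -/
theorem ladderWords_succ_le {d : ℕ} {N : Submodule ℂ TestEnd}
    (h : ∀ p ∈ ladderWords d, p ∈ N ∧ tLower * p ∈ N ∧ tRaise * p ∈ N) :
    ladderWords (d + 1) ≤ N := by
  intro p hp
  rw [ladderWords, pow_succ'] at hp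
  refine Submodule.mul_induction_on hp (fun m hm n hn => ?_) fun x y hx hy => N.add_mem hx hy
  obtain ⟨a, b, c, rfl⟩ := Submodule.mem_span_triple.1 hm
  obtain ⟨h1, h2, h3⟩ := h n hn
  rw [add_mul, add_mul, smul_mul_assoc, smul_mul_assoc, smul_mul_assoc, one_mul]
  exact N.add_mem (N.add_mem (N.smul_mem _ h1) (N.smul_mem _ h2)) (N.smul_mem _ h3)

theorem ladderWords_succ_le_right {d : ℕ} {N : Submodule ℂ TestEnd}
    (h : ∀ p ∈ ladderWords d, p ∈ N ∧ p * tLower ∈ N ∧ p * tRaise ∈ N) :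
    ladderWords (d + 1) ≤ N := by
  intro p hp
  rw [ladderWords, pow_succ] at hp
  refine Submodule.mul_induction_on hp (fun n hn m hm => ?_) fun x y hx hy => N.add_mem hx hy
  obtain ⟨a, b, c, rfl⟩ := Submodule.mem_span_triple.1 hm
  obtain ⟨h1, h2, h3⟩ := h n hn
  rw [mul_add, mul_add, mul_smul_comm, mul_smul_comm, mul_smul_comm, mul_one]
  exact N.add_mem (N.add_mem (N.smul_mem _ h1) (N.smul_mem _ h2)) (N.smul_mem _ h3)

theorem commute_of_mem_ladderWords_zero {p : TestEnd} (h : p ∈ ladderWords 0) (x : TestEnd) :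
    p * x - x * p = 0 := by
  obtain ⟨c, rfl⟩ := exists_of_mem_ladderWords_zero h
  rw [smul_mul_assoc, mul_smul_comm, one_mul, mul_one, sub_self]

/-- The commutator with x is a derivation that turns each generator into a scalar, so it removes a
letter from every word. It is applied to x = a and x = a*. -/
theorem commutator_mem_ladderWords {x : TestEnd} (hl : ∃ c : ℂ, tLower * x - x * tLower = c • 1)
    (hr : ∃ c : ℂ, tRaise * x - x * tRaise = c • 1) {d : ℕ} {p : TestEnd}
    (hp : p ∈ ladderWords (d + 1)) : p * x - x * p ∈ ladderWords d := by
  obtain ⟨cl, hl⟩ := hl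
  obtain ⟨cr, hr⟩ := hr
  induction d generalizing p with
  | zero =>
    suffices h : ladderWords 1 ≤ (ladderWords 0).comap
        (LinearMap.mulRight ℂ x - LinearMap.mulLeft ℂ x) from h hp
    refine ladderWords_succ_le fun p hp => ?_
    obtain ⟨c, rfl⟩ := exists_of_mem_ladderWords_zero hp
    simp only [Submodule.mem_comap, LinearMap.sub_apply, LinearMap.mulRight_apply,
      LinearMap.mulLeft_apply, mul_smul_comm, mul_one, smul_mul_assoc, one_mul, sub_self,
      Submodule.zero_mem, true_and]
    have key (m : TestEnd) (k : ℂ) (hm : m * x - x * m = k • 1) :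
        c • (m * x) - c • (x * m) ∈ ladderWords 0 := by
      have h1 : c • (m * x) - c • (x * m) = c • k • (1 : TestEnd) := by
        rw [← hm]
        exact (smul_sub c (m * x) (x * m)).symm
      rw [h1]
      exact Submodule.smul_mem _ _ (smul_one_mem_ladderWords _ _)
    exact ⟨key _ _ hl, key _ _ hr⟩
  | succ d ih =>
    suffices h : ladderWords (d + 1 + 1) ≤ (ladderWords (d + 1)).comap
        (LinearMap.mulRight ℂ x - LinearMap.mulLeft ℂ x) from h hp
    refine ladderWords_succ_le fun p hp => ?_
    simp only [Submodule.mem_comap, LinearMap.sub_apply, LinearMap.mulRight_apply,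
      LinearMap.mulLeft_apply]
    have h1 := ih hp
    have key (m : TestEnd) (hm : m ∈ ladderWords 1) (c : ℂ) (hc : m * x - x * m = c • 1) :
        m * p * x - x * (m * p) ∈ ladderWords (d + 1) := by
      have : m * p * x - x * (m * p) = m * (p * x - x * p) + c • p := by
        rw [← smul_one_mul c p, ← hc]
        simp only [mul_sub, sub_mul, mul_assoc]
        abel
      rw [this]
      refine Submodule.add_mem _ ?_ (Submodule.smul_mem _ _ hp)
      rw [add_comm d 1]
      exact mul_mem_ladderWords hm h1
    exact ⟨ladderWords_mono (Nat.le_succ d) h1, key _ tLower_mem_ladderWords _ hl,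
      key _ tRaise_mem_ladderWords _ hr⟩

theorem commutator_tLower_mem {d : ℕ} {p : TestEnd} (hp : p ∈ ladderWords (d + 1)) :
    p * tLower - tLower * p ∈ ladderWords d :=
  commutator_mem_ladderWords ⟨0, by rw [sub_self, zero_smul]⟩
    ⟨-1, by rw [tLower_mul_tRaise]; module⟩ hp

theorem commutator_tRaise_mem {d : ℕ} {p : TestEnd} (hp : p ∈ ladderWords (d + 1)) :
    p * tRaise - tRaise * p ∈ ladderWords d :=
  commutator_mem_ladderWords ⟨1, by rw [tLower_mul_tRaise]; module⟩
    ⟨0, by rw [sub_self, zero_smul]⟩ hp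

/-- By the Leibniz rule the commutator with the quadratic element a*a removes one letter and inserts
another. This is why commutators with D² do not raise the degree. -/
theorem commutator_number_mem {d : ℕ} {p : TestEnd} (hp : p ∈ ladderWords d) :
    tRaise * tLower * p - p * (tRaise * tLower) ∈ ladderWords d := by
  cases d with
  | zero =>
    rw [← neg_sub, commute_of_mem_ladderWords_zero hp, neg_zero]
    exact Submodule.zero_mem _
  | succ d =>
    have h : tRaise * tLower * p - p * (tRaise * tLower) =
        -(tRaise * (p * tLower - tLower * p)) - (p * tRaise - tRaise * p) * tLower := by
      simp only [mul_sub, sub_mul, mul_assoc]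
      abel
    rw [h]
    refine Submodule.sub_mem _ (Submodule.neg_mem _ ?_)
      (mul_mem_ladderWords (commutator_tRaise_mem hp) tLower_mem_ladderWords)
    rw [add_comm d 1]
    exact mul_mem_ladderWords tRaise_mem_ladderWords (commutator_tLower_mem hp)

theorem tLower_conj (z : ℂ) :
    tWeyl (-z) * tLower * tWeyl z =
      tLower + ((1 / Real.sqrt 2 : ℂ) * (starRingEnd ℂ) z) • 1 := by
  rw [mul_assoc, tLower_mul_tWeyl, mul_add, ← mul_assoc, tWeyl_neg_mul_tWeyl, one_mul,
    mul_smul_comm, tWeyl_neg_mul_tWeyl]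

theorem tRaise_conj (z : ℂ) :
    tWeyl (-z) * tRaise * tWeyl z = tRaise + ((1 / Real.sqrt 2 : ℂ) * z) • 1 := by
  rw [mul_assoc, tRaise_mul_tWeyl, mul_add, ← mul_assoc, tWeyl_neg_mul_tWeyl, one_mul,
    mul_smul_comm, tWeyl_neg_mul_tWeyl]

/-- Conjugation by T_z is an automorphism that only adds scalars to the generators. -/
theorem conj_mem_ladderWords (z : ℂ) {d : ℕ} {p : TestEnd} (hp : p ∈ ladderWords d) :
    tWeyl (-z) * p * tWeyl z ∈ ladderWords d := by
  induction d generalizing p with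
  | zero =>
    obtain ⟨c, rfl⟩ := exists_of_mem_ladderWords_zero hp
    rw [mul_smul_comm, smul_mul_assoc, mul_one, tWeyl_neg_mul_tWeyl]
    exact smul_one_mem_ladderWords _ _
  | succ d ih =>
    suffices h : ladderWords (d + 1) ≤ (ladderWords (d + 1)).comap
        (LinearMap.mulRight ℂ (tWeyl z) ∘ₗ LinearMap.mulLeft ℂ (tWeyl (-z))) from h hp
    refine ladderWords_succ_le fun p hp => ?_
    simp only [Submodule.mem_comap, LinearMap.comp_apply, LinearMap.mulRight_apply,
      LinearMap.mulLeft_apply]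
    have h1 := ih hp
    have key (m : TestEnd) (hm : tWeyl (-z) * m * tWeyl z ∈ ladderWords 1) :
        tWeyl (-z) * (m * p) * tWeyl z ∈ ladderWords (d + 1) := by
      have : tWeyl (-z) * (m * p) * tWeyl z =
          (tWeyl (-z) * m * tWeyl z) * (tWeyl (-z) * p * tWeyl z) := by
        have h2 := tWeyl_mul_tWeyl_neg z
        calc _ = tWeyl (-z) * m * 1 * p * tWeyl z := by noncomm_ring
          _ = _ := by rw [← h2]; noncomm_ring
      rw [this, add_comm d 1]
      exact mul_mem_ladderWords hm h1
    refine ⟨ladderWords_mono (Nat.le_succ d) h1, key _ ?_, key _ ?_⟩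
    · rw [tLower_conj]
      exact Submodule.add_mem _ tLower_mem_ladderWords (smul_one_mem_ladderWords _ _)
    · rw [tRaise_conj]
      exact Submodule.add_mem _ tRaise_mem_ladderWords (smul_one_mem_ladderWords _ _)

/-! ### Matrices of words -/

/-- The `2 × 2` matrices of words of length at most `d` in the ladder operators. -/
def IsBlockWord (d : ℕ) (P : Module.End ℂ (testSpace × testSpace)) : Prop :=
  ∃ p : Fin 2 → Fin 2 → TestEnd, (∀ i j, p i j ∈ ladderWords d) ∧ P = block p

section

variable {d e : ℕ} {P P' : Module.End ℂ (testSpace × testSpace)}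

theorem IsBlockWord.mono (hP : IsBlockWord d P) (h : d ≤ e) : IsBlockWord e P := by
  obtain ⟨p, hp, rfl⟩ := hP
  exact ⟨p, fun i j => ladderWords_mono h (hp i j), rfl⟩

theorem IsBlockWord.mul (hP : IsBlockWord d P) (hP' : IsBlockWord e P') :
    IsBlockWord (d + e) (P * P') := by
  obtain ⟨p, hp, rfl⟩ := hP
  obtain ⟨p', hp', rfl⟩ := hP'
  exact ⟨_, fun i j => Submodule.add_mem _ (mul_mem_ladderWords (hp _ _) (hp' _ _))
    (mul_mem_ladderWords (hp _ _) (hp' _ _)), block_mul _ _⟩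

theorem IsBlockWord.add (hP : IsBlockWord d P) (hP' : IsBlockWord d P') :
    IsBlockWord d (P + P') := by
  obtain ⟨p, hp, rfl⟩ := hP
  obtain ⟨p', hp', rfl⟩ := hP'
  exact ⟨_, fun i j => Submodule.add_mem _ (hp _ _) (hp' _ _), block_add _ _⟩

theorem isBlockWord_blockEuler : IsBlockWord 1 blockEuler := by
  refine ⟨_, fun i j => ?_, rfl⟩
  fin_cases i <;> fin_cases j <;>
    simp [tLower_mem_ladderWords, tRaise_mem_ladderWords]

theorem isBlockWord_blockShift (z : ℂ) : IsBlockWord 0 (blockShift z) := by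
  refine ⟨_, fun i j => ?_, rfl⟩
  fin_cases i <;> fin_cases j <;> first | exact smul_one_mem_ladderWords _ _ | exact zero_mem _

theorem blockEuler_mul_blockEuler :
    blockEuler * blockEuler = block ![![tRaise * tLower, 0], ![0, tRaise * tLower + 1]] := by
  rw [blockEuler, block_mul]
  refine block_congr fun i j => ?_
  fin_cases i <;> fin_cases j <;> simp [tLower_mul_tRaise]

theorem IsBlockWord.commutator_sq (hP : IsBlockWord d P) :
    IsBlockWord d (ringAd (blockEuler * blockEuler) P) := by
  obtain ⟨p, hp, rfl⟩ := hP
  rw [ringAd, blockEuler_mul_blockEuler, block_mul, block_mul, block_sub]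
  refine ⟨_, fun i j => ?_, rfl⟩
  -- The lower diagonal entry of D² exceeds the upper one by 1, so the off-diagonal commutators
  -- carry an additional -p₀₁ and +p₁₀; the word length is unaffected.
  have h := commutator_number_mem (hp i j)
  fin_cases i <;> fin_cases j
  · simpa using h
  · simpa [mul_add, ← sub_sub] using Submodule.sub_mem _ h (hp 0 1)
  · simpa [add_mul, add_sub_right_comm] using Submodule.add_mem _ h (hp 1 0)
  · simpa [add_mul, mul_add] using h

theorem IsBlockWord.conj (z : ℂ) (hP : IsBlockWord d P) :
    IsBlockWord d (blockWeyl (-z) * P * blockWeyl z) := by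
  obtain ⟨p, hp, rfl⟩ := hP
  rw [blockWeyl, blockWeyl, block_mul, block_mul]
  refine ⟨_, fun i j => ?_, rfl⟩
  have h := conj_mem_ladderWords z (hp i j)
  fin_cases i <;> fin_cases j <;> simpa using h

end

/-- The operators `T_z⁻¹ [D, T_z]^{[n]}`. -/
noncomputable def shiftWord (z : ℂ) : ℕ → Module.End ℂ (testSpace × testSpace)
  | 0 => blockShift z
  | n + 1 => (blockEuler + blockShift z) * (blockEuler + blockShift z) * shiftWord z n -
      shiftWord z n * (blockEuler * blockEuler)

/-- With M the constant matrix T_z⁻¹[D, T_z], conjugating D² by T_z gives (D+M)², which differs from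
D² by DM + MD + M², of length one. The commutator with D² itself preserves length, so every bracket
adds at most one letter rather than two. -/
theorem isBlockWord_shiftWord (z : ℂ) (n : ℕ) : IsBlockWord n (shiftWord z n) := by
  induction n with
  | zero => exact isBlockWord_blockShift z
  | succ n ih =>
    have h : shiftWord z (n + 1) = (blockEuler * blockShift z + blockShift z * blockEuler +
        blockShift z * blockShift z) * shiftWord z n +
          ringAd (blockEuler * blockEuler) (shiftWord z n) := by
      rw [shiftWord, ringAd]
      noncomm_ring
    have hM := isBlockWord_blockShift z
    rw [h]
    refine IsBlockWord.add ?_ (ih.commutator_sq.mono (Nat.le_succ n))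
    rw [add_comm n 1]
    exact (((isBlockWord_blockEuler.mul hM).add ((hM.mul isBlockWord_blockEuler).mono
      (by norm_num))).add ((hM.mul hM).mono (by norm_num))).mul ih

theorem ringAd_iterate_blockWeyl (z : ℂ) (n : ℕ) :
    (ringAd (blockEuler * blockEuler))^[n] (ringAd blockEuler (blockWeyl z)) =
      blockWeyl z * shiftWord z n := by
  have h := blockEuler_mul_blockWeyl z
  induction n with
  | zero =>
    rw [Function.iterate_zero, id, ringAd, h, shiftWord]
    noncomm_ring
  | succ n ih =>
    rw [Function.iterate_succ_apply', ih, ringAd, shiftWord]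
    have h1 : blockEuler * blockEuler * (blockWeyl z * shiftWord z n) =
        blockWeyl z * ((blockEuler + blockShift z) * (blockEuler + blockShift z)) *
          shiftWord z n := by
      calc _ = blockEuler * (blockEuler * blockWeyl z) * shiftWord z n := by
            simp only [mul_assoc]
        _ = (blockEuler * blockWeyl z) * (blockEuler + blockShift z) * shiftWord z n := by
            refine (congrArg (fun y => blockEuler * y * shiftWord z n) h).trans ?_
            simp only [mul_assoc]
        _ = _ := by rw [h]; simp only [mul_assoc]
    rw [h1, mul_sub]
    simp only [mul_assoc]

/-! ### Iterated commutators and factors commuting with the fixed element. -/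

section

variable {R : Type*} [Ring R] {x r : R}

theorem ringAd_iterate_mul_right (h : x * r = r * x) (p : R) (n : ℕ) :
    (ringAd x)^[n] (p * r) = (ringAd x)^[n] p * r := by
  induction n generalizing p with
  | zero => rfl
  | succ n ih =>
    rw [Function.iterate_succ_apply, Function.iterate_succ_apply, ← ih]
    congr 1
    rw [ringAd, ringAd, sub_mul, mul_assoc p r x, ← h]
    simp only [mul_assoc]

theorem ringAd_iterate_mul_left (h : x * r = r * x) (p : R) (n : ℕ) :
    (ringAd x)^[n] (r * p) = r * (ringAd x)^[n] p := by
  induction n generalizing p with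
  | zero => rfl
  | succ n ih =>
    rw [Function.iterate_succ_apply, Function.iterate_succ_apply, ← ih]
    congr 1
    rw [ringAd, ringAd, mul_sub, ← mul_assoc x r p, h]
    simp only [mul_assoc]

end

/-- Since 𝐑 commutes with D and D², it passes through all brackets; moving it to the right only
rotates z. -/
theorem ringAd_iterate_blockFrac_conj (φ ψ : ℝ) (z : ℂ) (n : ℕ) :
    blockFrac φ * (ringAd (blockEuler * blockEuler))^[n]
      (ringAd blockEuler (blockWeyl z * blockFrac ψ)) =
    blockWeyl (Complex.exp (Complex.I * φ) * z) *
      shiftWord (Complex.exp (Complex.I * φ) * z) n * blockFrac (φ + ψ) := by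
  have h1 (θ : ℝ) := blockEuler_mul_blockFrac θ
  have h2 (θ : ℝ) : blockEuler * blockEuler * blockFrac θ =
      blockFrac θ * (blockEuler * blockEuler) := by
    rw [mul_assoc, h1, ← mul_assoc, h1, mul_assoc]
  have h3 (θ : ℝ) (p) : ringAd blockEuler (p * blockFrac θ) =
      ringAd blockEuler p * blockFrac θ := ringAd_iterate_mul_right (h1 θ) p 1
  have h4 (θ : ℝ) (p) : ringAd blockEuler (blockFrac θ * p) =
      blockFrac θ * ringAd blockEuler p := ringAd_iterate_mul_left (h1 θ) p 1
  rw [← ringAd_iterate_mul_left (h2 φ), ← h4, ← mul_assoc, blockFrac_mul_blockWeyl, mul_assoc,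
    blockFrac_mul_blockFrac, h3, ringAd_iterate_mul_right (h2 _), ringAd_iterate_blockWeyl]

/-! ### The operators in the cochains -/

/-- Normal form of the cochain operators: one Heisenberg-Weyl operator on the left, one rotation on
the right, a matrix of words in between. The w_j are the z_j turned by the rotations standing before
them, and the scalar collects the cocycle phases of the composition law. -/
theorem actsOn_cochainOp (z₀ z₁ z₂ : ℂ) (φ₀ φ₁ φ₂ : ℝ) (α : Fin (2 * 1) → ℕ) {w₁ w₂ : ℂ}
    (h₁ : w₁ = Complex.exp (Complex.I * φ₀) * z₁)
    (h₂ : w₂ = Complex.exp (Complex.I * ((φ₀ + φ₁ : ℝ) : ℂ)) * z₂) :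
    ActsOn testIncl
      (cochainOp euler (fun j => ((![weylMetaplectic z₀ φ₀, weylMetaplectic z₁ φ₁,
        weylMetaplectic z₂ φ₂] : Fin (2 * 1 + 1) → oscAlgebra) j : L2 C2 →L[ℂ] L2 C2)) α)
      (Complex.exp (Complex.I * ((w₁ * (starRingEnd ℂ) z₀).im / 2 +
          (w₂ * (starRingEnd ℂ) (z₀ + w₁)).im / 2)) •
        (blockWeyl (z₀ + w₁ + w₂) *
          (blockWeyl (-w₂) * shiftWord w₁ (α 0) * blockWeyl w₂ * shiftWord w₂ (α 1)) *
            blockFrac (φ₀ + φ₁ + φ₂))) := by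
  have hD2 := actsOn_euler.comp actsOn_euler
  have hA (z : ℂ) (φ : ℝ) (n : ℕ) :=
    hD2.iterCommutator (actsOn_euler.commutator (actsOn_weylMetaplectic z φ)) n
  have h := (actsOn_weylMetaplectic z₀ φ₀).comp
    ((hA z₁ φ₁ (α 0)).comp ((hA z₂ φ₂ (α 1)).comp ActsOn.ofBounded_id))
  have hx : blockWeyl z₀ * blockFrac φ₀ *
      ((ringAd (blockEuler * blockEuler))^[α 0]
        (ringAd blockEuler (blockWeyl z₁ * blockFrac φ₁)) *
        ((ringAd (blockEuler * blockEuler))^[α 1]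
          (ringAd blockEuler (blockWeyl z₂ * blockFrac φ₂)) * 1)) =
      Complex.exp (Complex.I * ((w₁ * (starRingEnd ℂ) z₀).im / 2 +
          (w₂ * (starRingEnd ℂ) (z₀ + w₁)).im / 2)) •
        (blockWeyl (z₀ + w₁ + w₂) *
          (blockWeyl (-w₂) * shiftWord w₁ (α 0) * blockWeyl w₂ * shiftWord w₂ (α 1)) *
            blockFrac (φ₀ + φ₁ + φ₂)) := by
    have e1 := ringAd_iterate_blockFrac_conj φ₀ φ₁ z₁ (α 0)
    have e2 := ringAd_iterate_blockFrac_conj (φ₀ + φ₁) φ₂ z₂ (α 1)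
    rw [← h₁] at e1
    rw [← h₂] at e2
    -- The identity T_{w₂} T_{-w₂} is inserted to the left of the first word: T_{w₂} joins the other
    -- translations, and the word becomes conjugated by T_{w₂}.
    have e3 : blockWeyl (z₀ + w₁) * (blockWeyl w₂ * blockWeyl (-w₂)) = blockWeyl (z₀ + w₁) := by
      rw [blockWeyl_mul_blockWeyl_neg, mul_one]
    calc _ = blockWeyl z₀ * (blockFrac φ₀ * (ringAd (blockEuler * blockEuler))^[α 0]
            (ringAd blockEuler (blockWeyl z₁ * blockFrac φ₁))) *
          (ringAd (blockEuler * blockEuler))^[α 1]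
            (ringAd blockEuler (blockWeyl z₂ * blockFrac φ₂)) := by
          simp only [mul_assoc, mul_one]
      _ = blockWeyl z₀ * blockWeyl w₁ * shiftWord w₁ (α 0) * (blockFrac (φ₀ + φ₁) *
          (ringAd (blockEuler * blockEuler))^[α 1]
            (ringAd blockEuler (blockWeyl z₂ * blockFrac φ₂))) := by
          rw [e1]
          simp only [mul_assoc]
      _ = Complex.exp (Complex.I * (w₁ * (starRingEnd ℂ) z₀).im / 2) •
          (blockWeyl (z₀ + w₁) * shiftWord w₁ (α 0) * blockWeyl w₂ * shiftWord w₂ (α 1) *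
            blockFrac (φ₀ + φ₁ + φ₂)) := by
          rw [e2, blockWeyl_mul_blockWeyl]
          simp only [mul_assoc, smul_mul_assoc]
      _ = Complex.exp (Complex.I * (w₁ * (starRingEnd ℂ) z₀).im / 2) •
          (blockWeyl (z₀ + w₁) * blockWeyl w₂ * (blockWeyl (-w₂) * shiftWord w₁ (α 0) *
            blockWeyl w₂ * shiftWord w₂ (α 1)) * blockFrac (φ₀ + φ₁ + φ₂)) := by
          conv_lhs => rw [← e3]
          simp only [mul_assoc]
      _ = _ := by
          rw [blockWeyl_mul_blockWeyl, smul_mul_assoc, smul_mul_assoc, smul_smul,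
            ← Complex.exp_add]
          congr 2
          ring
  rw [hx] at h
  exact h

/-! ### Generating functions -/

/-- The space of sequences of at most polynomial growth. -/
def polyGrowth : Submodule ℂ (ℕ → ℂ) where
  carrier := {c | ∃ (K : ℝ) (N : ℕ), 0 ≤ K ∧ ∀ n : ℕ, ‖c n‖ ≤ K * (n + 1) ^ N}
  zero_mem' := ⟨0, 0, le_rfl, fun n => by simp⟩
  add_mem' := by
    rintro c c' ⟨K, N, hK, h⟩ ⟨K', N', hK', h'⟩
    refine ⟨K + K', max N N', add_nonneg hK hK', fun n => (norm_add_le _ _).trans ?_⟩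
    rw [add_mul]
    have h1 : (1 : ℝ) ≤ n + 1 := by linarith [n.cast_nonneg (α := ℝ)]
    refine add_le_add ((h n).trans ?_) ((h' n).trans ?_)
    · exact mul_le_mul_of_nonneg_left (pow_le_pow_right₀ h1 (le_max_left _ _)) hK
    · exact mul_le_mul_of_nonneg_left (pow_le_pow_right₀ h1 (le_max_right _ _)) hK'
  smul_mem' := by
    rintro a c ⟨K, N, hK, h⟩
    refine ⟨‖a‖ * K, N, by positivity, fun n => ?_⟩
    rw [Pi.smul_apply, norm_smul, mul_assoc]
    exact mul_le_mul_of_nonneg_left (h n) (norm_nonneg _)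

/-- The sequence `c` shifted to the right. -/
def shiftSeq : (ℕ → ℂ) →ₗ[ℂ] (ℕ → ℂ) where
  toFun c n := n.casesOn 0 c
  map_add' c c' := by funext n; cases n <;> simp
  map_smul' a c := by funext n; cases n <;> simp

@[simp] theorem shiftSeq_zero (c : ℕ → ℂ) : shiftSeq c 0 = 0 := rfl

@[simp] theorem shiftSeq_succ (c : ℕ → ℂ) (n : ℕ) : shiftSeq c (n + 1) = c n := rfl

/-- The sequence `n c_n`. -/
def mulIndex : (ℕ → ℂ) →ₗ[ℂ] (ℕ → ℂ) where
  toFun c n := n * c n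
  map_add' c c' := by funext n; simp [mul_add]
  map_smul' a c := by funext n; simp [mul_left_comm]

theorem mulIndex_apply (c : ℕ → ℂ) (n : ℕ) : mulIndex c n = n * c n := rfl

theorem mulIndex_iterate_apply (c : ℕ → ℂ) (k n : ℕ) : mulIndex^[k] c n = (n : ℂ) ^ k * c n := by
  induction k with
  | zero => simp
  | succ k ih => rw [Function.iterate_succ_apply', mulIndex_apply, ih, pow_succ]; ring

theorem shiftSeq_mem_polyGrowth {c : ℕ → ℂ} (hc : c ∈ polyGrowth) : shiftSeq c ∈ polyGrowth := by
  obtain ⟨K, N, hK, h⟩ := hc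
  refine ⟨K, N, hK, fun n => ?_⟩
  cases n with
  | zero => simpa using hK
  | succ n =>
    refine (h n).trans (mul_le_mul_of_nonneg_left ?_ hK)
    push_cast
    gcongr
    linarith

theorem mulIndex_mem_polyGrowth {c : ℕ → ℂ} (hc : c ∈ polyGrowth) : mulIndex c ∈ polyGrowth := by
  obtain ⟨K, N, hK, h⟩ := hc
  refine ⟨K, N + 1, hK, fun n => ?_⟩
  rw [mulIndex_apply, norm_mul, Complex.norm_natCast, pow_succ, ← mul_assoc, mul_comm]
  exact mul_le_mul (h n) (by linarith) n.cast_nonneg (by positivity)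

theorem summable_succ_pow_mul_geometric (N : ℕ) {r : ℝ} (h0 : 0 ≤ r) (h1 : r < 1) :
    Summable fun n : ℕ => ((n : ℝ) + 1) ^ N * r ^ n := by
  have hr : ‖r‖ < 1 := by rwa [Real.norm_of_nonneg h0]
  have h := ((summable_pow_mul_geometric_of_norm_lt_one N hr).add
    (summable_geometric_of_lt_one h0 h1)).mul_left (2 ^ N)
  refine Summable.of_nonneg_of_le (fun n => by positivity) (fun n => ?_) h
  rw [← add_one_mul, ← mul_assoc]
  refine mul_le_mul_of_nonneg_right ?_ (by positivity)
  rcases Nat.eq_zero_or_pos n with rfl | hn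
  · have h2 : (1 : ℝ) ≤ 2 ^ N := one_le_pow₀ (by norm_num)
    have h3 : (0 : ℝ) ≤ ((0 : ℕ) : ℝ) ^ N := by positivity
    simp only [Nat.cast_zero, zero_add, one_pow] at h3 ⊢
    nlinarith
  · have h2 : (1 : ℝ) ≤ n := by exact_mod_cast hn
    calc ((n : ℝ) + 1) ^ N ≤ (2 * n) ^ N := by gcongr; linarith
      _ = 2 ^ N * (n : ℝ) ^ N := mul_pow _ _ _
      _ ≤ 2 ^ N * ((n : ℝ) ^ N + 1) := by gcongr; linarith

/-- The generating function `∑ c_n tⁿ`. -/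
noncomputable def genFun (c : ℕ → ℂ) (t : ℝ) : ℂ := ∑' n, c n * (t : ℂ) ^ n

theorem summable_norm_genFun {c : ℕ → ℂ} (hc : c ∈ polyGrowth) {t : ℝ} (ht : |t| < 1) :
    Summable fun n => ‖c n * (t : ℂ) ^ n‖ := by
  obtain ⟨K, N, hK, h⟩ := hc
  refine Summable.of_nonneg_of_le (fun n => norm_nonneg _) (fun n => ?_)
    ((summable_succ_pow_mul_geometric N (abs_nonneg t) ht).mul_left K)
  rw [norm_mul, norm_pow, Complex.norm_real, Real.norm_eq_abs, ← mul_assoc]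
  exact mul_le_mul_of_nonneg_right (h n) (by positivity)

theorem summable_genFun {c : ℕ → ℂ} (hc : c ∈ polyGrowth) {t : ℝ} (ht : |t| < 1) :
    Summable fun n => c n * (t : ℂ) ^ n :=
  (summable_norm_genFun hc ht).of_norm

theorem genFun_add {c c' : ℕ → ℂ} (hc : c ∈ polyGrowth) (hc' : c' ∈ polyGrowth) {t : ℝ}
    (ht : |t| < 1) : genFun (c + c') t = genFun c t + genFun c' t := by
  rw [genFun, genFun, genFun, ← (summable_genFun hc ht).tsum_add (summable_genFun hc' ht)]
  simp only [Pi.add_apply, add_mul]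

theorem genFun_smul (a : ℂ) (c : ℕ → ℂ) (t : ℝ) : genFun (a • c) t = a * genFun c t := by
  simp only [genFun, Pi.smul_apply, smul_eq_mul, mul_assoc, tsum_mul_left]

theorem genFun_sub {c c' : ℕ → ℂ} (hc : c ∈ polyGrowth) (hc' : c' ∈ polyGrowth) {t : ℝ}
    (ht : |t| < 1) : genFun (c - c') t = genFun c t - genFun c' t := by
  rw [genFun, genFun, genFun, ← (summable_genFun hc ht).tsum_sub (summable_genFun hc' ht)]
  simp only [Pi.sub_apply, sub_mul]

theorem genFun_shiftSeq {c : ℕ → ℂ} (hc : c ∈ polyGrowth) {t : ℝ} (ht : |t| < 1) :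
    genFun (shiftSeq c) t = t * genFun c t := by
  rw [genFun, (summable_genFun (shiftSeq_mem_polyGrowth hc) ht).tsum_eq_zero_add, genFun,
    shiftSeq_zero, zero_mul, zero_add, ← tsum_mul_left]
  simp only [shiftSeq_succ, pow_succ, mul_left_comm, mul_comm]

theorem genFun_zero (c : ℕ → ℂ) : genFun c 0 = c 0 := by
  rw [genFun, tsum_eq_single 0]
  · simp
  · intro n hn
    simp [hn]

/-- Multiplication of the coefficients by n corresponds to t d/dt; stated without division by t, the
formula also covers t = 0. -/
theorem hasDerivAt_genFun {c : ℕ → ℂ} (hc : c ∈ polyGrowth) {t : ℝ} (ht : |t| < 1) :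
    ∃ g : ℂ, HasDerivAt (genFun c) g t ∧ t * g = genFun (mulIndex c) t := by
  -- A radius strictly between |t| and 1 gives a summable bound for the differentiated terms near t.
  obtain ⟨r, hr1, hr2⟩ := exists_between ht
  have hr0 : 0 < r := (abs_nonneg t).trans_lt hr1
  have hr : |r| < 1 := by rwa [abs_of_pos hr0]
  have hu : Summable fun n => r⁻¹ * ‖mulIndex c n * (r : ℂ) ^ n‖ :=
    (summable_norm_genFun (mulIndex_mem_polyGrowth hc) hr).mul_left _
  have h := hasDerivAt_tsum_of_isPreconnected (g := fun n (y : ℝ) => c n * (y : ℂ) ^ n)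
    (g' := fun n y => c n * (n * (y : ℂ) ^ (n - 1))) (y₀ := 0) (y := t) hu
    (isOpen_Ioo (a := -r) (b := r)) isPreconnected_Ioo (fun n y _ => ?_) (fun n y hy => ?_)
    ⟨by linarith, hr0⟩ (summable_genFun hc (by simp)) (abs_lt.1 hr1)
  · refine ⟨_, h, ?_⟩
    rw [genFun, ← tsum_mul_left]
    refine tsum_congr fun n => ?_
    rw [mulIndex_apply]
    cases n with
    | zero => simp
    | succ n => rw [Nat.add_sub_cancel, pow_succ]; ring
  · have := ((hasDerivAt_pow n (y : ℂ)).comp_ofReal).const_mul (c n)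
    exact this
  · cases n with
    | zero => simp [mulIndex_apply]
    | succ n =>
      have hy' : |y| ≤ r := (abs_lt.2 hy).le
      rw [mulIndex_apply, Nat.add_sub_cancel, norm_mul, norm_mul, norm_mul, norm_mul, norm_pow,
        norm_pow, Complex.norm_real, Complex.norm_real, Real.norm_eq_abs, Real.norm_eq_abs,
        abs_of_pos hr0, pow_succ]
      have h1 : |y| ^ n ≤ r ^ n := pow_le_pow_left₀ (abs_nonneg y) hy' n
      calc ‖c (n + 1)‖ * (‖((n + 1 : ℕ) : ℂ)‖ * |y| ^ n)
          ≤ ‖c (n + 1)‖ * (‖((n + 1 : ℕ) : ℂ)‖ * r ^ n) := by gcongr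
        _ = _ := by field_simp

theorem one_sub_mul_ne_zero {q : ℂ} (hq : ‖q‖ = 1) {t : ℝ} (ht : |t| < 1) :
    1 - q * (t : ℂ) ≠ 0 := by
  intro h
  have h1 : ‖q * (t : ℂ)‖ = 1 := by rw [← sub_eq_zero.1 h, norm_one]
  rw [norm_mul, hq, one_mul, Complex.norm_real, Real.norm_eq_abs] at h1
  exact ht.ne h1

theorem hasDerivAt_one_sub_mul (q : ℂ) (t : ℝ) :
    HasDerivAt (fun s : ℝ => 1 - q * (s : ℂ)) (-q) t := by
  have h := ((Complex.ofRealCLM.hasDerivAt (x := t)).const_mul q).const_sub 1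
  simpa using h

/-- The generating function of a sequence satisfying the recursion of the Laguerre polynomials. -/
theorem genFun_eq_exp {q α β : ℂ} (hq : ‖q‖ = 1) {c b : ℕ → ℂ} (hc : c ∈ polyGrowth)
    (hb : b ∈ polyGrowth) (h1 : b - q • shiftSeq b = (α * q) • shiftSeq c)
    (h2 : mulIndex c - q • shiftSeq (mulIndex c) = q • shiftSeq c - β • b) {t : ℝ}
    (ht : t ∈ Set.Ioo (0 : ℝ) 1) :
    genFun c t = c 0 * (1 - q * t)⁻¹ * Complex.exp (-(α * β * (q * t / (1 - q * t)))) := by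
  have habs {t : ℝ} (ht : t ∈ Set.Ioo (0 : ℝ) 1) : |t| < 1 := by
    rw [abs_of_pos ht.1]; exact ht.2
  -- The two relations become (1-qt) B = αqt C and (1-qt) t C' = qt C - β B for the generating
  -- functions B, C of b, c. Eliminating B and cancelling t leaves a first order equation for C.
  have hode {t : ℝ} (ht : t ∈ Set.Ioo (0 : ℝ) 1) : HasDerivAt (genFun c)
      (((1 - q * t) * q - α * β * q) * genFun c t / (1 - q * t) ^ 2) t := by
    have ht' := habs ht
    have hne := one_sub_mul_ne_zero hq ht'
    have ht0 : (t : ℂ) ≠ 0 := Complex.ofReal_ne_zero.2 ht.1.ne'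
    obtain ⟨g, hg, hg'⟩ := hasDerivAt_genFun hc ht'
    have hn := mulIndex_mem_polyGrowth hc
    have e1 := congrArg (fun s => genFun s t) h1
    have e2 := congrArg (fun s => genFun s t) h2
    rw [genFun_sub hb (polyGrowth.smul_mem _ (shiftSeq_mem_polyGrowth hb)) ht', genFun_smul,
      genFun_smul, genFun_shiftSeq hb ht', genFun_shiftSeq hc ht'] at e1
    rw [genFun_sub hn (polyGrowth.smul_mem _ (shiftSeq_mem_polyGrowth hn)) ht',
      genFun_sub (polyGrowth.smul_mem _ (shiftSeq_mem_polyGrowth hc)) (polyGrowth.smul_mem _ hb)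
        ht', genFun_smul, genFun_smul, genFun_smul, genFun_shiftSeq hn ht',
      genFun_shiftSeq hc ht', ← hg'] at e2
    refine hg.congr_deriv ?_
    rw [eq_div_iff (pow_ne_zero 2 hne)]
    refine mul_left_cancel₀ ht0 ?_
    linear_combination (1 - q * t) * e2 - β * e1
  -- The generating function divided by the expected solution, up to the factor `c 0`; its
  -- derivative vanishes on (0, 1).
  let F : ℝ → ℂ := fun s =>
    genFun c s * ((1 - q * s) * Complex.exp (α * β * (q * s / (1 - q * s))))
  have hexp {s : ℝ} (hs : |s| < 1) :
      HasDerivAt (fun s : ℝ => (1 - q * (s : ℂ)) * Complex.exp (α * β * (q * s / (1 - q * s))))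
        ((-q + (1 - q * s) * (α * β * (q / (1 - q * s) ^ 2))) *
          Complex.exp (α * β * (q * s / (1 - q * s)))) s := by
    have hne := one_sub_mul_ne_zero hq hs
    have e1 := hasDerivAt_one_sub_mul q s
    have e2 : HasDerivAt (fun s : ℝ => q * (s : ℂ)) q s := by
      simpa using (Complex.ofRealCLM.hasDerivAt (x := s)).const_mul q
    have e3 := ((e2.fun_div e1 hne).const_mul (α * β)).cexp
    refine (e1.fun_mul e3).congr_deriv ?_
    field_simp
    ring
  have hF {s : ℝ} (hs : s ∈ Set.Ioo (0 : ℝ) 1) : HasDerivAt F 0 s := by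
    have hne := one_sub_mul_ne_zero hq (habs hs)
    refine ((hode hs).fun_mul (hexp (habs hs))).congr_deriv ?_
    field_simp
    ring
  have hF0 : ContinuousAt F 0 := by
    obtain ⟨g, hg, -⟩ := hasDerivAt_genFun hc (t := 0) (by simp)
    exact (hg.fun_mul (hexp (s := 0) (by simp))).continuousAt
  -- The differential equation was divided by t, so the constant is identified by a limit at 0.
  have hlim : Tendsto F (𝓝[>] 0) (𝓝 (F 0)) := hF0.tendsto.mono_left nhdsWithin_le_nhds
  have hconst : Tendsto F (𝓝[>] 0) (𝓝 (F t)) := by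
    refine tendsto_const_nhds.congr' ?_
    filter_upwards [Ioo_mem_nhdsGT (zero_lt_one' ℝ)] with s hs
    exact isOpen_Ioo.is_const_of_deriv_eq_zero isPreconnected_Ioo
      (fun s hs => (hF hs).differentiableAt.differentiableWithinAt)
      (fun s hs => (hF hs).deriv) ht hs
  have h := tendsto_nhds_unique hconst hlim
  have hne := one_sub_mul_ne_zero hq (habs ht)
  simp only [F, genFun_zero, Complex.ofReal_zero, mul_zero, zero_div, sub_zero, Complex.exp_zero,
    mul_one] at h
  rw [← h, Complex.exp_neg]
  field_simp

/-! ### Sequences with rapidly decreasing or regular generating functions -/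

/-- The sequences of polynomial growth for which `(1 - qt)⁻ʲ ∑ c_n tⁿ` is bounded on `[0, 1)` for
all `j`. -/
def tame (q : ℂ) : Submodule ℂ (ℕ → ℂ) where
  carrier := {c | c ∈ polyGrowth ∧ ∀ j : ℕ, ∃ B : ℝ, ∀ t ∈ Set.Ioo (0 : ℝ) 1,
    ‖genFun c t‖ ≤ B * ‖1 - q * t‖ ^ j}
  zero_mem' := ⟨polyGrowth.zero_mem, fun j => ⟨0, fun t _ => by simp [genFun]⟩⟩
  add_mem' := by
    rintro c c' ⟨hc, h⟩ ⟨hc', h'⟩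
    refine ⟨polyGrowth.add_mem hc hc', fun j => ?_⟩
    obtain ⟨B, hB⟩ := h j
    obtain ⟨B', hB'⟩ := h' j
    refine ⟨B + B', fun t ht => ?_⟩
    rw [genFun_add hc hc' (by rw [abs_of_pos ht.1]; exact ht.2), add_mul]
    exact (norm_add_le _ _).trans (add_le_add (hB t ht) (hB' t ht))
  smul_mem' := by
    rintro a c ⟨hc, h⟩
    refine ⟨polyGrowth.smul_mem a hc, fun j => ?_⟩
    obtain ⟨B, hB⟩ := h j
    refine ⟨‖a‖ * B, fun t ht => ?_⟩
    rw [genFun_smul, norm_mul, mul_assoc]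
    exact mul_le_mul_of_nonneg_left (hB t ht) (norm_nonneg _)

theorem shiftSeq_mem_tame {q : ℂ} {c : ℕ → ℂ} (hc : c ∈ tame q) : shiftSeq c ∈ tame q := by
  obtain ⟨hc, h⟩ := hc
  refine ⟨shiftSeq_mem_polyGrowth hc, fun j => ?_⟩
  obtain ⟨B, hB⟩ := h j
  refine ⟨B, fun t ht => ?_⟩
  rw [genFun_shiftSeq hc (by rw [abs_of_pos ht.1]; exact ht.2), norm_mul, Complex.norm_real,
    Real.norm_of_nonneg ht.1.le]
  exact (mul_le_of_le_one_left (norm_nonneg _) ht.2.le).trans (hB t ht)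

/-- On generating functions, c - q·(shift of c) is multiplication by 1-qt. Dividing by it costs one
power of 1-qt, which is harmless because tameness asks for all powers. -/
theorem mem_tame_of_sub_shiftSeq_mem {q : ℂ} (hq : ‖q‖ = 1) {c : ℕ → ℂ} (hc : c ∈ polyGrowth)
    (h : c - q • shiftSeq c ∈ tame q) : c ∈ tame q := by
  refine ⟨hc, fun j => ?_⟩
  obtain ⟨B, hB⟩ := h.2 (j + 1)
  refine ⟨B, fun t ht => ?_⟩
  have ht' : |t| < 1 := by rw [abs_of_pos ht.1]; exact ht.2
  have h1 := hB t ht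
  rw [genFun_sub hc (polyGrowth.smul_mem _ (shiftSeq_mem_polyGrowth hc)) ht', genFun_smul,
    genFun_shiftSeq hc ht', show genFun c t - q * (t * genFun c t) = genFun c t * (1 - q * t) by
      ring, norm_mul, pow_succ, ← mul_assoc] at h1
  exact le_of_mul_le_mul_right h1 (norm_pos_iff.2 (one_sub_mul_ne_zero hq ht'))

theorem exists_norm_one_sub_mul_ge {q : ℂ} (hq : ‖q‖ = 1) (h : q ≠ 1) :
    ∃ δ > 0, ∀ t ∈ Set.Ioo (0 : ℝ) 1, δ ≤ ‖1 - q * (t : ℂ)‖ := by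
  obtain ⟨t₀, ht₀, hmin⟩ := (isCompact_Icc (a := (0 : ℝ)) (b := 1)).exists_isMinOn
    ⟨0, by simp⟩ (f := fun t : ℝ => ‖1 - q * (t : ℂ)‖) (by fun_prop)
  refine ⟨‖1 - q * (t₀ : ℂ)‖, norm_pos_iff.2 ?_, fun t ht => hmin ⟨ht.1.le, ht.2.le⟩⟩
  rcases ht₀.2.lt_or_eq with h1 | h1
  · exact one_sub_mul_ne_zero hq (by rwa [abs_of_nonneg ht₀.1])
  · rw [h1, Complex.ofReal_one, mul_one]
    exact sub_ne_zero.2 h.symm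

/-- Two mechanisms: for q = 1 and x > 0 the exponential decays faster than every power of 1-t; for q
≠ 1 the number 1-qt stays away from 0 and all powers are comparable. -/
theorem mem_tame_of_genFun_eq {q : ℂ} (hq : ‖q‖ = 1) {c : ℕ → ℂ} (hc : c ∈ polyGrowth) {x : ℝ}
    (hx : 0 ≤ x) (hqx : q ≠ 1 ∨ 0 < x) {a : ℂ}
    (h : ∀ t ∈ Set.Ioo (0 : ℝ) 1,
      genFun c t = a * (1 - q * t)⁻¹ * Complex.exp (-(x * (q * t / (1 - q * t))))) :
    c ∈ tame q := by
  refine ⟨hc, fun j => ?_⟩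
  by_cases hq1 : q = 1
  · have hx0 : 0 < x := hqx.resolve_left (not_not.2 hq1)
    subst hq1
    -- Since t/(1-t) = 1/(1-t) - 1, the exponential is e^x e^{-y} with y = x/(1-t), and
    -- y^{j+1}/(j+1)! ≤ e^y. The exponent j+1 also absorbs the factor (1-t)⁻¹.
    refine ⟨‖a‖ * Real.exp x * ((j + 1).factorial / x ^ (j + 1)), fun t ht => ?_⟩
    have hpos : 0 < 1 - t := by linarith [ht.2]
    have h1 : ‖(1 : ℂ) - 1 * t‖ = 1 - t := by
      rw [one_mul, ← Complex.ofReal_one, ← Complex.ofReal_sub, Complex.norm_real,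
        Real.norm_of_nonneg hpos.le]
    have h2 : (-(x * (1 * t / (1 - 1 * t))) : ℂ) = ((x - x / (1 - t) : ℝ) : ℂ) := by
      have : (1 : ℂ) - t ≠ 0 := by exact_mod_cast hpos.ne'
      push_cast
      field_simp
      ring
    have h3 := Real.pow_div_factorial_le_exp (x / (1 - t)) (by positivity) (j + 1)
    rw [h t ht, h2, norm_mul, norm_mul, norm_inv, h1, Complex.norm_exp, Complex.ofReal_re,
      Real.exp_sub]
    rw [div_pow, div_div, div_le_iff₀ (by positivity)] at h3
    rw [mul_assoc, mul_assoc, mul_assoc]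
    refine mul_le_mul_of_nonneg_left ?_ (norm_nonneg a)
    rw [mul_div_assoc', mul_comm, div_mul_eq_mul_div, div_le_iff₀ (Real.exp_pos _)]
    have h4 : (1 - t)⁻¹ * x ^ (j + 1) ≤
        Real.exp (x / (1 - t)) * ((1 - t) ^ j * (j + 1).factorial) := by
      rw [inv_mul_le_iff₀ hpos]
      calc _ ≤ _ := h3
        _ = _ := by ring
    have h5 : (1 - t)⁻¹ ≤
        Real.exp (x / (1 - t)) * ((1 - t) ^ j * (j + 1).factorial) / x ^ (j + 1) := by
      rw [le_div_iff₀ (by positivity)]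
      exact h4
    calc Real.exp x * (1 - t)⁻¹ ≤ Real.exp x *
          (Real.exp (x / (1 - t)) * ((1 - t) ^ j * (j + 1).factorial) / x ^ (j + 1)) :=
          mul_le_mul_of_nonneg_left h5 (Real.exp_pos x).le
      _ = _ := by ring
  · obtain ⟨δ, hδ, hδ'⟩ := exists_norm_one_sub_mul_ge hq hq1
    -- The factors bound (1-qt)⁻¹ and the exponential; the last one makes up for |1-qt|^j ≥ δ^j.
    refine ⟨‖a‖ * δ⁻¹ * Real.exp (x * δ⁻¹) * (δ⁻¹) ^ j, fun t ht => ?_⟩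
    have h1 := hδ' t ht
    have h2 : ‖(1 - q * t)⁻¹‖ ≤ δ⁻¹ := by
      rw [norm_inv]
      exact inv_anti₀ hδ h1
    have h3 : ‖Complex.exp (-(x * (q * t / (1 - q * t))))‖ ≤ Real.exp (x * δ⁻¹) := by
      refine (Complex.norm_exp_le_exp_norm _).trans (Real.exp_le_exp.2 ?_)
      rw [norm_neg, norm_mul, Complex.norm_real, Real.norm_of_nonneg hx, div_eq_mul_inv, norm_mul,
        norm_mul, hq, one_mul, Complex.norm_real, Real.norm_of_nonneg ht.1.le]
      gcongr
      exact (mul_le_of_le_one_left (norm_nonneg _) ht.2.le).trans h2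
    have h4 : 1 ≤ (δ⁻¹) ^ j * ‖1 - q * (t : ℂ)‖ ^ j := by
      rw [← mul_pow]
      exact one_le_pow₀ (by rw [inv_mul_eq_div, one_le_div hδ]; exact h1)
    rw [h t ht, norm_mul, norm_mul, mul_assoc (_ * _ * _)]
    calc ‖a‖ * ‖(1 - q * t)⁻¹‖ * ‖Complex.exp (-(x * (q * t / (1 - q * t))))‖
        ≤ ‖a‖ * δ⁻¹ * Real.exp (x * δ⁻¹) := by gcongr
      _ ≤ _ := le_mul_of_one_le_right (by positivity) h4

/-! ### Diagonal matrix coefficients of words -/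

theorem inner_hermiteL2_tLower (n : ℕ) (v : testSpace) :
    (inner ℂ (hermiteL2 n) (tLower v : L2 ℂ) : ℂ) =
      (Real.sqrt (n + 1) : ℂ) * inner ℂ (hermiteL2 (n + 1)) (v : L2 ℂ) := by
  have h := inner_tRaise (tHermite n) v
  rw [tRaise_tHermite, Submodule.coe_smul, inner_smul_left, Complex.conj_ofReal] at h
  exact h.symm

theorem inner_hermiteL2_zero_tRaise (v : testSpace) :
    (inner ℂ (hermiteL2 0) (tRaise v : L2 ℂ) : ℂ) = 0 := by
  have h := inner_tLower (tHermite 0) v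
  rw [tLower_tHermite_zero, Submodule.coe_zero, inner_zero_left] at h
  exact h.symm

theorem inner_hermiteL2_succ_tRaise (n : ℕ) (v : testSpace) :
    (inner ℂ (hermiteL2 (n + 1)) (tRaise v : L2 ℂ) : ℂ) =
      (Real.sqrt (n + 1) : ℂ) * inner ℂ (hermiteL2 n) (v : L2 ℂ) := by
  have h := inner_tLower (tHermite (n + 1)) v
  rw [tLower_tHermite_succ, Submodule.coe_smul, inner_smul_left, Complex.conj_ofReal] at h
  exact h.symm

/-- The sequence `qⁿ ⟨h_n, T_w p h_n⟩`. -/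
noncomputable def wordCoeff (w q : ℂ) : TestEnd →ₗ[ℂ] (ℕ → ℂ) where
  toFun p n := q ^ n * inner ℂ (hermiteL2 n) ((tWeyl w * p) (tHermite n) : L2 ℂ)
  map_add' p p' := by
    funext n
    rw [mul_add, LinearMap.add_apply, Submodule.coe_add, inner_add_right, mul_add]
    rfl
  map_smul' c p := by
    funext n
    rw [mul_smul_comm, LinearMap.smul_apply, Submodule.coe_smul, inner_smul_right, mul_left_comm]
    rfl

theorem wordCoeff_apply (w q : ℂ) (p : TestEnd) (n : ℕ) :
    wordCoeff w q p n = q ^ n * inner ℂ (hermiteL2 n) ((tWeyl w * p) (tHermite n) : L2 ℂ) := rfl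

/-- Cyclicity of the trace, coefficient by coefficient. Past T_w, the raising operator turns h_{n+1}
on the left into √(n+1) h_n; the same root comes from applying a* to h_n on the right. Hence the
shift by one, with a factor q from qⁿ. -/
theorem wordCoeff_tRaise_mul (w q : ℂ) (p : TestEnd) :
    wordCoeff w q (tRaise * p) =
      q • shiftSeq (wordCoeff w q (p * tRaise)) - ((1 / Real.sqrt 2 : ℂ) * w) • wordCoeff w q p := by
  have h : tWeyl w * (tRaise * p) =
      tRaise * (tWeyl w * p) - ((1 / Real.sqrt 2 : ℂ) * w) • (tWeyl w * p) := by
    rw [← mul_assoc tRaise, tRaise_mul_tWeyl, add_mul, smul_mul_assoc, add_sub_cancel_right,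
      mul_assoc]
  funext n
  rw [Pi.sub_apply, Pi.smul_apply, Pi.smul_apply, wordCoeff_apply, wordCoeff_apply, h,
    LinearMap.sub_apply, LinearMap.smul_apply, Submodule.coe_sub, Submodule.coe_smul,
    inner_sub_right, inner_smul_right, Module.End.mul_apply tRaise, smul_eq_mul, smul_eq_mul]
  cases n with
  | zero =>
    rw [inner_hermiteL2_zero_tRaise, shiftSeq_zero]
    ring
  | succ n =>
    rw [inner_hermiteL2_succ_tRaise, shiftSeq_succ, wordCoeff_apply, ← mul_assoc (tWeyl w),
      Module.End.mul_apply _ tRaise, tRaise_tHermite, map_smul, Submodule.coe_smul,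
      inner_smul_right, pow_succ]
    ring

theorem wordCoeff_mul_tLower (w q : ℂ) (p : TestEnd) :
    wordCoeff w q (p * tLower) = q • shiftSeq (wordCoeff w q (tLower * p) +
      ((1 / Real.sqrt 2 : ℂ) * (starRingEnd ℂ) w) • wordCoeff w q p) := by
  have h : tLower * (tWeyl w * p) = tWeyl w * (tLower * p +
      ((1 / Real.sqrt 2 : ℂ) * (starRingEnd ℂ) w) • p) := by
    rw [← mul_assoc tLower, tLower_mul_tWeyl, add_mul, smul_mul_assoc, mul_add, mul_smul_comm,
      mul_assoc]
  rw [← map_smul (wordCoeff w q), ← map_add (wordCoeff w q)]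
  funext n
  rw [Pi.smul_apply, wordCoeff_apply, smul_eq_mul]
  cases n with
  | zero =>
    rw [← mul_assoc, Module.End.mul_apply _ tLower, tLower_tHermite_zero, map_zero, shiftSeq_zero,
      Submodule.coe_zero, inner_zero_right]
    ring
  | succ n =>
    rw [shiftSeq_succ, wordCoeff_apply, ← h, Module.End.mul_apply tLower, inner_hermiteL2_tLower,
      ← mul_assoc (tWeyl w), Module.End.mul_apply _ tLower, tLower_tHermite_succ, map_smul,
      Submodule.coe_smul, inner_smul_right, pow_succ]
    ring

theorem tRaise_tLower_tHermite (n : ℕ) :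
    (tRaise * tLower) (tHermite n) = (n : ℂ) • tHermite n := by
  rw [Module.End.mul_apply]
  cases n with
  | zero => rw [tLower_tHermite_zero, map_zero, Nat.cast_zero, zero_smul]
  | succ n =>
    rw [tLower_tHermite_succ, map_smul, tRaise_tHermite, smul_smul, sqrt_succ_mul_self]
    push_cast
    rfl

theorem wordCoeff_mul_number (w q : ℂ) (p : TestEnd) :
    wordCoeff w q (p * (tRaise * tLower)) = mulIndex (wordCoeff w q p) := by
  funext n
  rw [mulIndex_apply, wordCoeff_apply, wordCoeff_apply, ← mul_assoc, Module.End.mul_apply _ (_ * _),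
    tRaise_tLower_tHermite, map_smul, Submodule.coe_smul, inner_smul_right]
  ring

/-- Writing p a* = a* p + [p, a*] in the cyclic relation isolates 1-qS, with S the shift, applied to
the longer word. The right side involves only p and a commutator, which is shorter than p a*, so
induction on the length becomes possible. -/
theorem wordCoeff_tRaise_mul_sub (w q : ℂ) (p : TestEnd) :
    wordCoeff w q (tRaise * p) - q • shiftSeq (wordCoeff w q (tRaise * p)) =
      q • shiftSeq (wordCoeff w q (p * tRaise - tRaise * p)) -
        ((1 / Real.sqrt 2 : ℂ) * w) • wordCoeff w q p := by
  conv_lhs => enter [1]; rw [wordCoeff_tRaise_mul]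
  rw [map_sub, map_sub, smul_sub]
  abel

theorem wordCoeff_tLower_mul_sub (w q : ℂ) (p : TestEnd) :
    wordCoeff w q (tLower * p) - q • shiftSeq (wordCoeff w q (tLower * p)) =
      ((1 / Real.sqrt 2 : ℂ) * (starRingEnd ℂ) w * q) • shiftSeq (wordCoeff w q p) -
        wordCoeff w q (p * tLower - tLower * p) := by
  rw [map_sub (wordCoeff w q), wordCoeff_mul_tLower, map_add, map_smul, smul_add, smul_smul,
    mul_comm q]
  abel

/-! ### Growth -/

/-- The operators `p` for which `‖p h_n‖` is of at most polynomial growth. -/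
noncomputable def growthEnd : Submodule ℂ TestEnd where
  carrier := {p | ∃ (K : ℝ) (N : ℕ), 0 ≤ K ∧ ∀ n : ℕ, ‖(p (tHermite n) : L2 ℂ)‖ ≤ K * (n + 1) ^ N}
  zero_mem' := ⟨0, 0, le_rfl, fun n => by simp⟩
  add_mem' := by
    rintro p p' ⟨K, N, hK, h⟩ ⟨K', N', hK', h'⟩
    refine ⟨K + K', max N N', add_nonneg hK hK', fun n => ?_⟩
    rw [LinearMap.add_apply, Submodule.coe_add, add_mul]
    have h1 : (1 : ℝ) ≤ n + 1 := by linarith [n.cast_nonneg (α := ℝ)]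
    refine (norm_add_le _ _).trans (add_le_add ((h n).trans ?_) ((h' n).trans ?_))
    · exact mul_le_mul_of_nonneg_left (pow_le_pow_right₀ h1 (le_max_left _ _)) hK
    · exact mul_le_mul_of_nonneg_left (pow_le_pow_right₀ h1 (le_max_right _ _)) hK'
  smul_mem' := by
    rintro a p ⟨K, N, hK, h⟩
    refine ⟨‖a‖ * K, N, by positivity, fun n => ?_⟩
    rw [LinearMap.smul_apply, Submodule.coe_smul, norm_smul, mul_assoc]
    exact mul_le_mul_of_nonneg_left (h n) (norm_nonneg _)

theorem norm_sqrt_succ_le (n : ℕ) : ‖(Real.sqrt (n + 1) : ℂ)‖ ≤ (n : ℝ) + 1 := by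
  have h1 : (1 : ℝ) ≤ n + 1 := by linarith [n.cast_nonneg (α := ℝ)]
  rw [Complex.norm_real, Real.norm_of_nonneg (Real.sqrt_nonneg _)]
  exact Real.sqrt_le_iff.2 ⟨by linarith, by nlinarith⟩

/-- Each letter moves the index by one and multiplies by a root, estimated crudely by an additional
power of n+1. -/
theorem ladderWords_le_growthEnd (d : ℕ) : ladderWords d ≤ growthEnd := by
  induction d with
  | zero =>
    intro p hp
    obtain ⟨c, rfl⟩ := exists_of_mem_ladderWords_zero hp
    refine growthEnd.smul_mem c ⟨1, 0, zero_le_one, fun n => ?_⟩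
    rw [pow_zero, mul_one]
    exact (norm_hermiteL2 n).le
  | succ d ih =>
    refine ladderWords_succ_le_right fun p hp => ⟨ih hp, ?_, ?_⟩
    · obtain ⟨K, N, hK, h⟩ := ih hp
      refine ⟨K, N + 1, hK, fun n => ?_⟩
      rw [Module.End.mul_apply]
      cases n with
      | zero =>
        rw [tLower_tHermite_zero, map_zero, Submodule.coe_zero, norm_zero]
        positivity
      | succ n =>
        rw [tLower_tHermite_succ, map_smul, Submodule.coe_smul, norm_smul]
        calc _ ≤ ((n : ℝ) + 1) * (K * (n + 1) ^ N) :=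
              mul_le_mul (norm_sqrt_succ_le n) (h n) (norm_nonneg _) (by positivity)
          _ = K * ((n : ℝ) + 1) ^ (N + 1) := by ring
          _ ≤ _ := by push_cast; gcongr; linarith
    · obtain ⟨K, N, hK, h⟩ := ih hp
      -- The index has moved to n+1, and n+2 ≤ 2(n+1).
      refine ⟨K * 2 ^ N, N + 1, by positivity, fun n => ?_⟩
      rw [Module.End.mul_apply, tRaise_tHermite, map_smul, Submodule.coe_smul, norm_smul]
      have hn := n.cast_nonneg (α := ℝ)
      calc _ ≤ ((n : ℝ) + 1) * (K * ((n + 1 : ℕ) + 1) ^ N) :=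
            mul_le_mul (norm_sqrt_succ_le n) (h (n + 1)) (norm_nonneg _) (by positivity)
        _ ≤ ((n : ℝ) + 1) * (K * (2 * (n + 1)) ^ N) := by push_cast; gcongr; linarith
        _ = _ := by rw [mul_pow]; ring

theorem wordCoeff_mem_polyGrowth {q : ℂ} (hq : ‖q‖ = 1) (w : ℂ) {p : TestEnd}
    (hp : p ∈ growthEnd) : wordCoeff w q p ∈ polyGrowth := by
  obtain ⟨K, N, hK, h⟩ := hp
  refine ⟨K, N, hK, fun n => ?_⟩
  rw [wordCoeff_apply, norm_mul, norm_pow, hq, one_pow, one_mul]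
  refine (norm_inner_le_norm _ _).trans ?_
  rw [norm_hermiteL2, one_mul, Module.End.mul_apply, coe_tWeyl, norm_weyl]
  exact h n

/-! ### Coefficients of words, if `T_w R_φ` is not the identity -/

theorem wordCoeff_one_zero (w q : ℂ) :
    wordCoeff w q 1 0 = Complex.exp (-(Complex.normSq w) / 4) := by
  rw [wordCoeff_apply, pow_zero, one_mul, mul_one, coe_tWeyl]
  exact inner_weyl_groundState w

theorem inv_sqrt_two_mul_conj (w : ℂ) :
    (1 / Real.sqrt 2 : ℂ) * (starRingEnd ℂ) w * ((1 / Real.sqrt 2 : ℂ) * w) =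
      ((Complex.normSq w / 2 : ℝ) : ℂ) := by
  have h := inv_sqrt_two_mul_self
  push_cast
  rw [← Complex.mul_conj]
  linear_combination (w * (starRingEnd ℂ) w) * h

/-- The cyclic relations for the words 1 and a close up, since a*a multiplies by n and [a, a*] = 1.
They are the Laguerre recursion of `genFun_eq_exp`, with αβ = |w|²/2. -/
theorem genFun_wordCoeff_one {q : ℂ} (hq : ‖q‖ = 1) (w : ℂ) {t : ℝ}
    (ht : t ∈ Set.Ioo (0 : ℝ) 1) :
    genFun (wordCoeff w q 1) t = Complex.exp (-(Complex.normSq w) / 4) * (1 - q * t)⁻¹ *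
      Complex.exp (-(((Complex.normSq w / 2 : ℝ) : ℂ) * (q * t / (1 - q * t)))) := by
  have hg (d : ℕ) {p : TestEnd} (hp : p ∈ ladderWords d) : wordCoeff w q p ∈ polyGrowth :=
    wordCoeff_mem_polyGrowth hq w (ladderWords_le_growthEnd d hp)
  rw [← inv_sqrt_two_mul_conj, ← wordCoeff_one_zero w q]
  refine genFun_eq_exp hq (hg 1 one_mem_ladderWords_one) (hg 1 tLower_mem_ladderWords) ?_ ?_ ht
  · have h := wordCoeff_tLower_mul_sub w q 1
    rwa [mul_one, one_mul, sub_self, map_zero, sub_zero] at h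
  · have h := wordCoeff_tRaise_mul_sub w q tLower
    rwa [← one_mul (tRaise * tLower), wordCoeff_mul_number, one_mul, tLower_mul_tRaise,
      add_sub_cancel_left] at h

/-- Induction on the word length. The empty word has the explicit generating function, and a new
letter costs one division by 1-qt. -/
theorem wordCoeff_mem_tame {w q : ℂ} (hq : ‖q‖ = 1) (h : q ≠ 1 ∨ w ≠ 0) {d : ℕ} {p : TestEnd}
    (hp : p ∈ ladderWords d) : wordCoeff w q p ∈ tame q := by
  have hg (d : ℕ) {p : TestEnd} (hp : p ∈ ladderWords d) : wordCoeff w q p ∈ polyGrowth :=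
    wordCoeff_mem_polyGrowth hq w (ladderWords_le_growthEnd d hp)
  induction d generalizing p with
  | zero =>
    obtain ⟨c, rfl⟩ := exists_of_mem_ladderWords_zero hp
    rw [map_smul]
    refine (tame q).smul_mem c (mem_tame_of_genFun_eq hq (hg 1 one_mem_ladderWords_one)
      (x := Complex.normSq w / 2) (by have := Complex.normSq_nonneg w; positivity) ?_
      fun t ht => genFun_wordCoeff_one hq w ht)
    exact h.imp_right fun hw => by have := Complex.normSq_pos.2 hw; positivity
  | succ d ih =>
    suffices h : ladderWords (d + 1) ≤ (tame q).comap (wordCoeff w q) from h hp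
    refine ladderWords_succ_le fun p hp => ⟨ih hp, ?_, ?_⟩
    · refine mem_tame_of_sub_shiftSeq_mem hq (hg (1 + d) (mul_mem_ladderWords
        tLower_mem_ladderWords hp)) ?_
      rw [wordCoeff_tLower_mul_sub]
      exact (tame q).sub_mem ((tame q).smul_mem _ (shiftSeq_mem_tame (ih hp)))
        (ih (commutator_tLower_mem (ladderWords_mono (Nat.le_succ d) hp)))
    · refine mem_tame_of_sub_shiftSeq_mem hq (hg (1 + d) (mul_mem_ladderWords
        tRaise_mem_ladderWords hp)) ?_
      rw [wordCoeff_tRaise_mul_sub]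
      exact (tame q).sub_mem ((tame q).smul_mem _ (shiftSeq_mem_tame
        (ih (commutator_tRaise_mem (ladderWords_mono (Nat.le_succ d) hp)))))
        ((tame q).smul_mem _ (ih hp))

/-! ### Coefficients of words in the ladder operators alone -/

/-- The sequences given by a polynomial of degree at most `d / 2`. -/
def polySeq (d : ℕ) : Submodule ℂ (ℕ → ℂ) where
  carrier := {c | ∃ P : Polynomial ℂ, 2 * P.natDegree ≤ d ∧ ∀ n : ℕ, c n = P.eval (n : ℂ)}
  zero_mem' := ⟨0, by simp⟩
  add_mem' := by
    rintro c c' ⟨P, hP, h⟩ ⟨P', hP', h'⟩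
    refine ⟨P + P', ?_, fun n => by rw [Pi.add_apply, h, h', Polynomial.eval_add]⟩
    have := Polynomial.natDegree_add_le P P'
    omega
  smul_mem' := by
    rintro a c ⟨P, hP, h⟩
    refine ⟨a • P, ?_, fun n => by rw [Pi.smul_apply, h, Polynomial.eval_smul]⟩
    have := Polynomial.natDegree_smul_le a P
    omega

theorem polySeq_mono {d e : ℕ} (h : d ≤ e) : polySeq d ≤ polySeq e :=
  fun _ ⟨P, hP, hc⟩ => ⟨P, hP.trans h, hc⟩

/-- Faulhaber's formula: summation raises the degree by one. -/
theorem exists_eval_eq_sum_range (P : Polynomial ℂ) :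
    ∃ Q : Polynomial ℂ, Q.natDegree ≤ P.natDegree + 1 ∧
      ∀ n : ℕ, Q.eval (n : ℂ) = ∑ k ∈ Finset.range n, P.eval (k : ℂ) := by
  refine ⟨∑ j ∈ Finset.range (P.natDegree + 1), ∑ i ∈ Finset.range (j + 1),
    Polynomial.C (P.coeff j * ((bernoulli i * (j + 1).choose i / (j + 1) : ℚ) : ℂ)) *
      Polynomial.X ^ (j + 1 - i), ?_, fun n => ?_⟩
  · refine Polynomial.natDegree_sum_le_of_forall_le _ _ fun j hj => ?_
    refine Polynomial.natDegree_sum_le_of_forall_le _ _ fun i _ => ?_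
    refine (Polynomial.natDegree_C_mul_X_pow_le _ _).trans ?_
    have := Finset.mem_range.1 hj
    omega
  · simp only [Polynomial.eval_finsetSum, Polynomial.eval_mul, Polynomial.eval_C,
      Polynomial.eval_pow, Polynomial.eval_X]
    simp_rw [Polynomial.eval_eq_sum_range (p := P)]
    rw [Finset.sum_comm]
    refine Finset.sum_congr rfl fun j _ => ?_
    rw [← Finset.mul_sum]
    have h := congrArg (fun r : ℚ => (r : ℂ)) (sum_range_pow n j)
    simp only [Rat.cast_sum, Rat.cast_pow, Rat.cast_natCast] at h
    rw [h, Finset.mul_sum]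
    refine Finset.sum_congr rfl fun i _ => ?_
    push_cast
    ring

theorem mem_polySeq_of_sub {d : ℕ} {c b : ℕ → ℂ} (h0 : c 0 = 0)
    (hc : ∀ n, c (n + 1) = c n + b n) (hb : b ∈ polySeq d) : c ∈ polySeq (d + 2) := by
  obtain ⟨P, hP, hPb⟩ := hb
  obtain ⟨Q, hQ, hQs⟩ := exists_eval_eq_sum_range P
  refine ⟨Q, by omega, fun n => ?_⟩
  rw [hQs]
  induction n with
  | zero => rw [h0, Finset.sum_range_zero]
  | succ n ih => rw [hc, ih, Finset.sum_range_succ, hPb]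

/-- For w = 0 and q = 1 the cyclic relations compute the difference c_{n+1} - c_n of the
coefficients of a word of length d+1 by those of a commutator of length d-1. Summation raises the
degree by one for two letters lost, whence the bound d/2 that makes the higher residues vanish. As
the length drops by two, the induction is strong. -/
theorem wordCoeff_mem_polySeq {d : ℕ} {p : TestEnd} (hp : p ∈ ladderWords d) :
    wordCoeff 0 1 p ∈ polySeq d := by
  induction d using Nat.strong_induction_on generalizing p with
  | _ d ih =>
  cases d with
  | zero =>
    obtain ⟨c, rfl⟩ := exists_of_mem_ladderWords_zero hp
    rw [map_smul]
    refine (polySeq 0).smul_mem c ⟨1, by simp, fun n => ?_⟩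
    rw [wordCoeff_apply, tWeyl_zero, one_pow, one_mul, one_mul, Polynomial.eval_one]
    change inner ℂ (hermiteL2 n) (hermiteL2 n) = (1 : ℂ)
    rw [inner_self_eq_norm_sq_to_K, norm_hermiteL2]
    simp
  | succ d =>
    suffices h : ladderWords (d + 1) ≤ (polySeq (d + 1)).comap (wordCoeff 0 1) from h hp
    -- For d = 0 the word p is scalar, the differences vanish and so does the sequence; otherwise
    -- `mem_polySeq_of_sub` applies to the shorter commutator.
    have key {x : TestEnd} (hx : ∀ {d : ℕ} {p : TestEnd}, p ∈ ladderWords (d + 1) →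
        p * x - x * p ∈ ladderWords d) {p : TestEnd} (hp : p ∈ ladderWords d) {c : ℕ → ℂ} (e : ℂ)
        (hc0 : c 0 = 0) (hc : ∀ n, c (n + 1) = c n + (e • wordCoeff 0 1 (p * x - x * p)) n) :
        c ∈ polySeq (d + 1) := by
      cases d with
      | zero =>
        rw [commute_of_mem_ladderWords_zero hp, map_zero, smul_zero] at hc
        have : c = 0 := by
          funext n
          induction n with
          | zero => exact hc0
          | succ n ihn => rw [hc, ihn]; simp
        rw [this]
        exact zero_mem _
      | succ d =>
        exact mem_polySeq_of_sub hc0 hc ((polySeq d).smul_mem e (ih d (by omega) (hx hp)))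
    refine ladderWords_succ_le fun p hp => ?_
    have h1 : wordCoeff 0 1 p ∈ polySeq d := ih d (Nat.lt_succ_self d) hp
    refine ⟨polySeq_mono (Nat.le_succ d) h1, ?_, ?_⟩
    -- The word p a is treated before a p, because its coefficient at n = 0 vanishes and the
    -- summation can start there.
    · have h2 : wordCoeff 0 1 (p * tLower) ∈ polySeq (d + 1) := by
        have h := wordCoeff_mul_tLower 0 1 p
        rw [map_zero, mul_zero, zero_smul, add_zero, one_smul] at h
        refine key (fun h => commutator_tLower_mem h) hp (-1) ?_ fun n => ?_
        · rw [h, shiftSeq_zero]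
        · conv_lhs => rw [h, shiftSeq_succ]
          rw [map_sub, Pi.smul_apply, Pi.sub_apply, smul_eq_mul]
          ring
      have h3 : wordCoeff 0 1 (p * tLower - tLower * p) ∈ polySeq (d + 1) :=
        polySeq_mono (Nat.le_succ d)
          (ih d (Nat.lt_succ_self d) (commutator_tLower_mem (ladderWords_mono (Nat.le_succ d) hp)))
      have := (polySeq (d + 1)).sub_mem h2 h3
      rwa [map_sub, sub_sub_cancel] at this
    · have h := wordCoeff_tRaise_mul 0 1 p
      rw [mul_zero, zero_smul, sub_zero, one_smul] at h
      refine key (fun h => commutator_tRaise_mem h) hp 1 ?_ fun n => ?_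
      · rw [h, shiftSeq_zero]
      · conv_lhs => rw [h, shiftSeq_succ]
        rw [map_sub, one_smul, Pi.sub_apply]
        ring

/-! ### Residues -/

/-- Cauchy's integral formula on small circles. A removable factor is allowed, so g may vanish at c.
-/
theorem hasResidue_of_analyticAt {f g : ℂ → ℂ} {c : ℂ} (hg : AnalyticAt ℂ g c)
    (h : ∀ᶠ z in 𝓝[≠] c, f z = (z - c)⁻¹ * g z) : HasResidue f c (g c) := by
  obtain ⟨R, hR, hball⟩ := Metric.eventually_nhds_iff_ball.1 hg.eventually_analyticAt
  obtain ⟨R', hR', hball'⟩ := Metric.eventually_nhds_iff_ball.1 (eventually_nhdsWithin_iff.1 h)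
  filter_upwards [Ioo_mem_nhdsGT (lt_min hR hR')] with ρ hρ
  have hρR : ρ < R := hρ.2.trans_le (min_le_left _ _)
  have hρR' : ρ < R' := hρ.2.trans_le (min_le_right _ _)
  have hd : DifferentiableOn ℂ g (Metric.closedBall c ρ) := fun z hz =>
    (hball z (Metric.closedBall_subset_ball hρR hz)).differentiableAt.differentiableWithinAt
  have h1 := hd.circleIntegral_sub_inv_smul (Metric.mem_ball_self hρ.1)
  rw [smul_eq_mul] at h1
  rw [← h1]
  refine circleIntegral.integral_congr hρ.1.le fun z hz => ?_
  refine hball' z (Metric.sphere_subset_closedBall.trans (Metric.closedBall_subset_ball hρR') hz) ?_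
  rintro rfl
  have h2 := Metric.mem_sphere.1 hz
  rw [dist_self] at h2
  exact hρ.1.ne h2

theorem hasResidue_zero {f : ℂ → ℂ} {c : ℂ} (hf : AnalyticAt ℂ f c) : HasResidue f c 0 := by
  have h := hasResidue_of_analyticAt (f := f) (g := fun z => (z - c) * f z) (c := c)
    ((analyticAt_id.sub analyticAt_const).mul hf) ?_
  · rwa [sub_self, zero_mul] at h
  · filter_upwards [self_mem_nhdsWithin] with z hz
    rw [inv_mul_cancel_left₀ (sub_ne_zero.2 hz)]

/-- The entire function `(s - 1) ζ(s)`. -/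
noncomputable def regularZeta : ℂ → ℂ :=
  Function.update (fun s => (s - 1) * riemannZeta s) 1 1

theorem differentiable_regularZeta : Differentiable ℂ regularZeta := by
  have h {s : ℂ} (hs : s ≠ 1) : DifferentiableAt ℂ regularZeta s := by
    have h1 : DifferentiableAt ℂ (fun s => (s - 1) * riemannZeta s) s :=
      (differentiableAt_id.sub_const 1).mul (differentiableAt_riemannZeta hs)
    refine h1.congr_of_eventuallyEq ?_
    filter_upwards [isOpen_compl_singleton.mem_nhds hs] with z hz
    exact Function.update_of_ne hz _ _
  intro s
  by_cases hs : s = 1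
  · subst hs
    refine (Complex.analyticAt_of_differentiable_on_punctured_nhds_of_continuousAt ?_
      ?_).differentiableAt
    · filter_upwards [self_mem_nhdsWithin] with z hz
      exact h hz
    · simpa only [regularZeta, continuousAt_update_same] using riemannZeta_residue_one
  · exact h hs

theorem regularZeta_one : regularZeta 1 = 1 := Function.update_self _ _ _

theorem riemannZeta_eq {s : ℂ} (hs : s ≠ 1) : riemannZeta s = (s - 1)⁻¹ * regularZeta s := by
  rw [regularZeta, Function.update_of_ne hs, inv_mul_cancel_left₀ (sub_ne_zero.2 hs)]

theorem analyticAt_riemannZeta {s : ℂ} (hs : s ≠ 1) : AnalyticAt ℂ riemannZeta s :=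
  differentiableOn_riemannZeta.analyticAt (isOpen_compl_singleton.mem_nhds hs)

theorem meromorphic_riemannZeta (s : ℂ) : MeromorphicAt riemannZeta s := by
  by_cases hs : s = 1
  · subst hs
    have h : MeromorphicAt (fun s => (s - 1)⁻¹ * regularZeta s) (1 : ℂ) :=
      (((analyticAt_id.sub analyticAt_const).meromorphicAt).inv).mul
        (differentiable_regularZeta.analyticAt 1).meromorphicAt
    refine h.congr ?_
    filter_upwards [self_mem_nhdsWithin] with z hz
    exact (riemannZeta_eq hz).symm
  · exact (analyticAt_riemannZeta hs).meromorphicAt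

/-! ### Dirichlet series -/

/-- The function `μ ↦ μ⁻ˢ`, with value `1` at `0`. -/
noncomputable def regPow (s : ℂ) (μ : ℝ) : ℂ := if μ = 0 then 1 else (μ : ℂ) ^ (-s)

theorem regPow_zero (s : ℂ) : regPow s 0 = 1 := if_pos rfl

theorem regPow_natCast (s : ℂ) {n : ℕ} (hn : n ≠ 0) : regPow s n = (n : ℂ) ^ (-s) := by
  rw [regPow, if_neg (Nat.cast_ne_zero.2 hn), Complex.ofReal_natCast]

theorem norm_regPow_natCast (s : ℂ) {n : ℕ} (hn : n ≠ 0) :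
    ‖regPow s n‖ = ((n : ℝ) ^ s.re)⁻¹ := by
  rw [regPow_natCast s hn, Complex.norm_natCast_cpow_of_pos (Nat.pos_of_ne_zero hn),
    Complex.neg_re, Real.rpow_neg n.cast_nonneg]

theorem exists_summable_div_rpow {c : ℕ → ℂ} (hc : c ∈ polyGrowth) :
    ∃ σ : ℝ, 0 ≤ σ ∧ ∀ r > σ, Summable fun n : ℕ => ‖c n‖ / (n : ℝ) ^ r := by
  obtain ⟨K, N, hK, h⟩ := hc
  refine ⟨N + 1, by positivity, fun r hr => ?_⟩
  -- For n ≥ 1 one has (n+1)^N ≤ 2^N n^N. The term n = 0 is zero, as it has denominator 0^r = 0.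
  have hs := (Real.summable_one_div_nat_rpow.2 (show 1 < r - N by linarith)).mul_left (K * 2 ^ N)
  refine Summable.of_nonneg_of_le (fun n => by positivity) (fun n => ?_) hs
  rcases Nat.eq_zero_or_pos n with rfl | hn
  · have hr0 : r ≠ 0 := by have := N.cast_nonneg (α := ℝ); linarith
    rw [Nat.cast_zero, Real.zero_rpow hr0, div_zero]
    positivity
  · have hn1 : (1 : ℝ) ≤ n := by exact_mod_cast hn
    have hn0 : (0 : ℝ) < n := by linarith
    rw [Real.rpow_sub hn0, Real.rpow_natCast, one_div_div, mul_div_assoc']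
    refine div_le_div_of_nonneg_right ((h n).trans ?_) (by positivity)
    rw [mul_assoc, ← mul_pow]
    gcongr
    linarith

theorem exists_summable_regPow_mul {c : ℕ → ℂ} (hc : c ∈ polyGrowth) :
    ∃ σ : ℝ, ∀ s : ℂ, σ < s.re → Summable fun n : ℕ => ‖regPow s n‖ * ‖c n‖ := by
  obtain ⟨σ, -, hσ⟩ := exists_summable_div_rpow hc
  refine ⟨σ, fun s hs => ?_⟩
  rw [← summable_nat_add_iff 1]
  refine ((summable_nat_add_iff 1).2 (hσ s.re hs)).congr fun n => ?_
  rw [norm_regPow_natCast s n.succ_ne_zero, div_eq_inv_mul]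

/-- The function `ζ` is the meromorphic continuation of `s ↦ d_0 + ∑ d_n n⁻ˢ`. -/
def IsContinuation (d : ℕ → ℂ) (ζ : ℂ → ℂ) : Prop :=
  MeromorphicOn ζ Set.univ ∧ ∃ σ : ℝ, ∀ s : ℂ, σ < s.re →
    AnalyticAt ℂ ζ s ∧ HasSum (fun n : ℕ => regPow s n * d n) (ζ s)

/-- The coefficient of n^j contributes ζ(s-j), whose only pole is at s = j+1 with residue 1. The
value d_0 need not fit the polynomial; it enters as a constant without residue. -/
theorem exists_isContinuation_of_eval {d : ℕ → ℂ} (P : Polynomial ℂ)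
    (hd : ∀ n : ℕ, n ≠ 0 → d n = P.eval (n : ℂ)) :
    ∃ ζ : ℂ → ℂ, IsContinuation d ζ ∧ ∀ m : ℕ, P.natDegree ≤ m →
      HasResidue (fun z => ζ ((m + 1 : ℕ) + z)) 0 (P.coeff m) := by
  have hre (s : ℂ) (hs : (P.natDegree + 1 : ℝ) < s.re) (j : ℕ)
      (hj : j ∈ Finset.range (P.natDegree + 1)) : 1 < (s - j).re := by
    have hj' : (j : ℝ) ≤ P.natDegree := by exact_mod_cast Finset.mem_range_succ_iff.1 hj
    rw [Complex.sub_re, Complex.natCast_re]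
    linarith
  have hne (s : ℂ) (hs : (P.natDegree + 1 : ℝ) < s.re) (j : ℕ)
      (hj : j ∈ Finset.range (P.natDegree + 1)) : s - j ≠ 1 := fun h => by
    have := hre s hs j hj
    rw [h, Complex.one_re] at this
    exact lt_irrefl _ this
  refine ⟨fun s => d 0 + ∑ j ∈ Finset.range (P.natDegree + 1), P.coeff j * riemannZeta (s - j),
    ⟨?_, P.natDegree + 1, fun s hs => ⟨?_, ?_⟩⟩, fun m hm => ?_⟩
  · intro s _
    refine (MeromorphicAt.const _ _).add (MeromorphicAt.fun_sum fun j _ => ?_)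
    have hsub : AnalyticAt ℂ (fun s : ℂ => s - j) s := by fun_prop
    have hz : MeromorphicAt riemannZeta ((fun s : ℂ => s - j) s) := meromorphic_riemannZeta _
    exact (MeromorphicAt.const _ _).mul (MeromorphicAt.comp_analyticAt (g := fun s : ℂ => s - j) hz hsub)
  · refine analyticAt_const.add (Finset.analyticAt_fun_sum _ fun j hj => analyticAt_const.mul ?_)
    have hsub : AnalyticAt ℂ (fun s : ℂ => s - j) s := by fun_prop
    exact AnalyticAt.fun_comp (f := fun s : ℂ => s - j) (analyticAt_riemannZeta (hne s hs j hj)) hsub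
  · have h1 : HasSum (fun n : ℕ => if n = 0 then d 0 else 0) (d 0) := hasSum_ite_eq 0 (d 0)
    have h2 (j : ℕ) (hj : j ∈ Finset.range (P.natDegree + 1)) :
        HasSum (fun n : ℕ => P.coeff j * (1 / (n : ℂ) ^ (s - j)))
          (P.coeff j * riemannZeta (s - j)) := by
      rw [zeta_eq_tsum_one_div_nat_cpow (hre s hs j hj)]
      exact ((Complex.summable_one_div_nat_cpow.2 (hre s hs j hj)).hasSum).mul_left _
    convert h1.add (hasSum_sum h2) using 1
    funext n
    rcases eq_or_ne n 0 with rfl | hn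
    · rw [Nat.cast_zero, regPow_zero, if_pos rfl, one_mul, Finset.sum_eq_zero, add_zero]
      intro j hj
      have h0 : s - j ≠ 0 := by
        intro h
        have := hre s hs j hj
        rw [h, Complex.zero_re] at this
        linarith
      rw [Nat.cast_zero, Complex.zero_cpow h0, div_zero, mul_zero]
    · have hn0 : (n : ℂ) ≠ 0 := Nat.cast_ne_zero.2 hn
      rw [regPow_natCast s hn, if_neg hn, zero_add, hd n hn, Polynomial.eval_eq_sum_range,
        Finset.mul_sum]
      refine Finset.sum_congr rfl fun j _ => ?_
      rw [Complex.cpow_sub _ _ hn0, Complex.cpow_natCast, one_div_div, Complex.cpow_neg]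
      field_simp
  · have hg : AnalyticAt ℂ (fun z : ℂ => z * d 0 + ∑ j ∈ Finset.range (P.natDegree + 1),
        P.coeff j * if j = m then regularZeta (1 + z) else
          z * riemannZeta ((m + 1 : ℕ) + z - j)) 0 := by
      refine (analyticAt_id.mul analyticAt_const).add
        (Finset.analyticAt_fun_sum _ fun j hj => analyticAt_const.mul ?_)
      split_ifs with hjm
      · have hadd : AnalyticAt ℂ (fun z : ℂ => 1 + z) 0 := by fun_prop
        exact (differentiable_regularZeta.analyticAt _).fun_comp hadd
      · have hadd : AnalyticAt ℂ (fun z : ℂ => (m + 1 : ℕ) + z - j) 0 := by fun_prop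
        refine analyticAt_id.mul ((analyticAt_riemannZeta ?_).fun_comp hadd)
        intro h
        apply hjm
        have h' : (m : ℂ) = j := by push_cast at h; linear_combination h
        exact_mod_cast h'.symm
    have h := hasResidue_of_analyticAt hg (f := fun z => d 0 + ∑ j ∈
      Finset.range (P.natDegree + 1), P.coeff j * riemannZeta ((m + 1 : ℕ) + z - j)) ?_
    · convert h using 1
      simp only [zero_mul, zero_add, add_zero, regularZeta_one, mul_ite, mul_one, mul_zero,
        Finset.sum_ite_eq', Finset.mem_range]
      split_ifs with hlt
      · rfl
      · exact Polynomial.coeff_eq_zero_of_natDegree_lt (by omega)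
    · filter_upwards [self_mem_nhdsWithin] with z hz
      have hz0 : z ≠ 0 := hz
      rw [sub_zero, mul_add, inv_mul_cancel_left₀ hz0, Finset.mul_sum]
      congr 1
      refine Finset.sum_congr rfl fun j _ => ?_
      split_ifs with hjm
      · subst hjm
        have h1 : ((j + 1 : ℕ) : ℂ) + z - j = 1 + z := by push_cast; ring
        rw [h1, riemannZeta_eq (by simpa using hz0), add_sub_cancel_left]
        ring
      · rw [mul_left_comm, inv_mul_cancel_left₀ hz0]

/-! ### Dirichlet series with regular generating functions -/

theorem exists_eq_shiftSeq {c : ℕ → ℂ} (hc : c ∈ polyGrowth) (h0 : c 0 = 0) :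
    ∃ b ∈ polyGrowth, c = shiftSeq b := by
  refine ⟨fun n => c (n + 1), ?_, ?_⟩
  · obtain ⟨K, N, hK, h⟩ := hc
    refine ⟨K * 2 ^ N, N, by positivity, fun n => (h (n + 1)).trans ?_⟩
    have hn := n.cast_nonneg (α := ℝ)
    rw [mul_assoc, ← mul_pow]
    push_cast
    gcongr
    linarith
  · funext n
    cases n with
    | zero => exact h0
    | succ n => rfl

/-- A vanishing constant term gives a bound linear in t, that is, exponential decay in τ after the
substitution t = e^{-τ}. -/
theorem exists_norm_genFun_le {c : ℕ → ℂ} (hc : c ∈ polyGrowth) (h0 : c 0 = 0) {B : ℝ}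
    (hB : ∀ t ∈ Set.Ioo (0 : ℝ) 1, ‖genFun c t‖ ≤ B) :
    ∃ C : ℝ, ∀ t ∈ Set.Ioo (0 : ℝ) 1, ‖genFun c t‖ ≤ C * t := by
  obtain ⟨b, hb, rfl⟩ := exists_eq_shiftSeq hc h0
  have hcont : ContinuousOn (genFun b) (Set.Icc (0 : ℝ) (1 / 2)) := fun t ht => by
    obtain ⟨g, hg, -⟩ := hasDerivAt_genFun hb (t := t)
      (by rw [abs_of_nonneg ht.1]; linarith [ht.2])
    exact hg.continuousAt.continuousWithinAt
  obtain ⟨C, hC⟩ := isCompact_Icc.exists_bound_of_continuousOn hcont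
  -- C serves on (0, 1/2] by continuity of the quotient by t, and 2B on [1/2, 1), where 1 ≤ 2t.
  refine ⟨max C (2 * B), fun t ht => ?_⟩
  rcases le_total t (1 / 2) with h | h
  · rw [genFun_shiftSeq hb (by rw [abs_of_pos ht.1]; exact ht.2), norm_mul, Complex.norm_real,
      Real.norm_of_nonneg ht.1.le, mul_comm]
    exact mul_le_mul_of_nonneg_right ((hC t ⟨ht.1.le, h⟩).trans (le_max_left _ _)) ht.1.le
  · have hB0 : 0 ≤ B := (norm_nonneg _).trans (hB t ht)
    calc ‖genFun (shiftSeq b) t‖ ≤ B := hB t ht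
      _ ≤ 2 * B * t := by nlinarith
      _ ≤ _ := mul_le_mul_of_nonneg_right (le_max_right _ _) ht.1.le

theorem exp_neg_mem_Ioo {τ : ℝ} (hτ : 0 < τ) : Real.exp (-τ) ∈ Set.Ioo (0 : ℝ) 1 :=
  ⟨Real.exp_pos _, Real.exp_zero ▸ Real.exp_lt_exp.2 (neg_lt_zero.2 hτ)⟩

theorem hasDerivAt_genFun_exp {c : ℕ → ℂ} (hc : c ∈ polyGrowth) {τ : ℝ} (hτ : 0 < τ) :
    HasDerivAt (fun τ : ℝ => genFun c (Real.exp (-τ))) (-genFun (mulIndex c) (Real.exp (-τ))) τ := by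
  have ht := exp_neg_mem_Ioo hτ
  obtain ⟨g, hg, hg'⟩ := hasDerivAt_genFun hc (t := Real.exp (-τ))
    (by rw [abs_of_pos ht.1]; exact ht.2)
  have h1 : HasDerivAt (fun τ : ℝ => Real.exp (-τ)) (-Real.exp (-τ)) τ := by
    simpa using (hasDerivAt_neg τ).exp
  have h2 := hg.scomp τ h1
  rw [← hg']
  refine h2.congr_deriv ?_
  rw [Complex.real_smul, Complex.ofReal_neg, neg_mul]

/-- Sequences of polynomial growth, all of whose multiples `n^k d_n`, `k ≥ 1`, have a generating
function bounded on `(0, 1)`. -/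
def IsRegularSeq (d : ℕ → ℂ) : Prop :=
  d ∈ polyGrowth ∧ ∀ k : ℕ, 1 ≤ k → ∃ B : ℝ, ∀ t ∈ Set.Ioo (0 : ℝ) 1,
    ‖genFun (mulIndex^[k] d) t‖ ≤ B

/-! ### Continuation of Dirichlet series by Mellin transforms. -/

section

variable {d : ℕ → ℂ} {k : ℕ}

theorem mulIndex_iterate_mem_polyGrowth (hd : d ∈ polyGrowth) (k : ℕ) :
    mulIndex^[k] d ∈ polyGrowth := by
  induction k with
  | zero => exact hd
  | succ k ih =>
    rw [Function.iterate_succ_apply']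
    exact mulIndex_mem_polyGrowth ih

theorem IsRegularSeq.exists_bound (hd : IsRegularSeq d) (hk : 1 ≤ k) :
    ∃ C : ℝ, ∀ τ : ℝ, 0 < τ →
      ‖genFun (mulIndex^[k] d) (Real.exp (-τ))‖ ≤ C * Real.exp (-τ) := by
  obtain ⟨B, hB⟩ := hd.2 k hk
  obtain ⟨C, hC⟩ := exists_norm_genFun_le (mulIndex_iterate_mem_polyGrowth hd.1 k)
    (by rw [mulIndex_iterate_apply, Nat.cast_zero, zero_pow (by omega), zero_mul]) hB
  exact ⟨C, fun τ hτ => hC _ (exp_neg_mem_Ioo hτ)⟩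

theorem continuousOn_genFun_exp {c : ℕ → ℂ} (hc : c ∈ polyGrowth) :
    ContinuousOn (fun τ : ℝ => genFun c (Real.exp (-τ))) (Set.Ioi 0) :=
  fun _ hτ => (hasDerivAt_genFun_exp hc hτ).continuousAt.continuousWithinAt

/-- The continuation of the Dirichlet series to `Re s > -k`. -/
noncomputable def mellinSeries (d : ℕ → ℂ) (k : ℕ) (s : ℂ) : ℂ :=
  d 0 + (Complex.Gamma (s + k))⁻¹ *
    mellin (fun τ : ℝ => genFun (mulIndex^[k] d) (Real.exp (-τ))) (s + k)

/-- The integrand is bounded at 0 and decays exponentially at infinity, so the Mellin transform is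
holomorphic for Re(s+k) > 0, and 1/Γ is entire. -/
theorem IsRegularSeq.differentiableAt_mellinSeries (hd : IsRegularSeq d) (hk : 1 ≤ k) {s : ℂ}
    (hs : -(k : ℝ) < s.re) : DifferentiableAt ℂ (mellinSeries d k) s := by
  obtain ⟨C, hC⟩ := hd.exists_bound hk
  have hm : DifferentiableAt ℂ
      (mellin (fun τ : ℝ => genFun (mulIndex^[k] d) (Real.exp (-τ)))) (s + k) := by
    refine mellin_differentiableAt_of_isBigO_rpow_exp one_pos (b := 0)
      ((continuousOn_genFun_exp (mulIndex_iterate_mem_polyGrowth hd.1 k)).locallyIntegrableOn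
        measurableSet_Ioi) ?_ ?_ (by simp; linarith)
    · refine Asymptotics.IsBigO.of_bound C ?_
      filter_upwards [eventually_gt_atTop 0] with τ hτ
      rw [neg_one_mul, Real.norm_of_nonneg (Real.exp_pos _).le]
      exact hC τ hτ
    · refine Asymptotics.IsBigO.of_bound |C| ?_
      filter_upwards [self_mem_nhdsWithin] with τ hτ
      rw [neg_zero, Real.rpow_zero, norm_one, mul_one]
      have h1 := exp_neg_mem_Ioo hτ
      refine (hC τ hτ).trans ((mul_le_mul_of_nonneg_right (le_abs_self C) h1.1.le).trans ?_)
      exact mul_le_of_le_one_right (abs_nonneg C) h1.2.le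
  have hadd : DifferentiableAt ℂ (fun s : ℂ => s + k) s := by fun_prop
  exact (differentiableAt_const _).add
    (((Complex.differentiable_one_div_Gamma (s + k)).comp s hadd).mul (DifferentiableAt.comp (f := fun s : ℂ => s + k) s hm hadd))

/-- Writing d_n n^{-s} as n^k d_n n^{-(s+k)} moves the argument by k, which gains the half-plane Re
s > -k. Since k ≥ 1 the factor n^k removes the term n = 0, restored as d_0. -/
theorem exists_hasSum_mellinSeries (hd : d ∈ polyGrowth) (hk : 1 ≤ k) :
    ∃ σ : ℝ, 0 ≤ σ ∧ ∀ s : ℂ, σ < s.re →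
      HasSum (fun n : ℕ => regPow s n * d n) (mellinSeries d k s) := by
  have hc := mulIndex_iterate_mem_polyGrowth hd k
  obtain ⟨σ, hσ0, hσ⟩ := exists_summable_div_rpow hc
  refine ⟨σ, hσ0, fun s hs => ?_⟩
  have hk0 := k.cast_nonneg (α := ℝ)
  have hre : (s + k).re = s.re + k := by simp
  have hpos : 0 < (s + k).re := by rw [hre]; linarith
  have h := hasSum_mellin (a := mulIndex^[k] d) (p := fun n : ℕ => (n : ℝ))
    (F := fun τ : ℝ => genFun (mulIndex^[k] d) (Real.exp (-τ))) (s := s + k) (fun n => ?_) hpos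
    (fun τ hτ => ?_) (hσ _ (by rw [hre]; linarith))
  · have h1 : HasSum (fun n : ℕ => if n = 0 then d 0 else 0) (d 0) := hasSum_ite_eq 0 (d 0)
    convert h1.add (h.mul_left (Complex.Gamma (s + k))⁻¹) using 1
    on_goal 2 => rfl
    funext n
    have hG := Complex.Gamma_ne_zero_of_re_pos hpos
    rw [mulIndex_iterate_apply]
    rcases eq_or_ne n 0 with rfl | hn
    · rw [Nat.cast_zero, regPow_zero, Nat.cast_zero, zero_pow (by omega), if_pos rfl]
      ring
    · have hn0 : (n : ℂ) ≠ 0 := Nat.cast_ne_zero.2 hn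
      rw [regPow_natCast s hn, if_neg hn, Complex.ofReal_natCast, Complex.cpow_add _ _ hn0,
        Complex.cpow_natCast, Complex.cpow_neg]
      have h2 : (n : ℂ) ^ s ≠ 0 := by simp [Complex.cpow_eq_zero_iff, hn0]
      field_simp
      ring
  · rcases eq_or_ne n 0 with rfl | hn
    · left
      rw [mulIndex_iterate_apply, Nat.cast_zero, zero_pow (by omega), zero_mul]
    · right
      exact_mod_cast Nat.pos_of_ne_zero hn
  · have h1 := exp_neg_mem_Ioo hτ
    convert (summable_genFun hc (t := Real.exp (-τ))
      (by rw [abs_of_pos h1.1]; exact h1.2)).hasSum using 1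
    on_goal 2 => rfl
    funext n
    rw [← Complex.ofReal_pow, ← Real.exp_nat_mul]
    congr 3
    ring

/-- Both sides sum the same series far to the right, so the identity theorem applies on their common
half-plane. -/
theorem IsRegularSeq.mellinSeries_eq (hd : IsRegularSeq d) (hk : 1 ≤ k) {s : ℂ}
    {k' : ℕ} (hk' : 1 ≤ k') (hs : -(k : ℝ) < s.re) (hs' : -(k' : ℝ) < s.re) :
    mellinSeries d k s = mellinSeries d k' s := by
  obtain ⟨σ, hσ0, hσ⟩ := exists_hasSum_mellinSeries hd.1 hk
  obtain ⟨σ', hσ0', hσ'⟩ := exists_hasSum_mellinSeries hd.1 hk'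
  have han {k : ℕ} (hk : 1 ≤ k) {r : ℝ} (hr : -(k : ℝ) ≤ r) :
      AnalyticOnNhd ℂ (mellinSeries d k) {s | r < s.re} :=
    DifferentiableOn.analyticOnNhd (fun z hz =>
      (hd.differentiableAt_mellinSeries hk (hr.trans_lt hz)).differentiableWithinAt)
      (isOpen_lt continuous_const Complex.continuous_re)
  refine (han hk (le_max_left _ _)).eqOn_of_preconnected_of_eventuallyEq
    (han hk' (le_max_right (-(k : ℝ)) _)) (convex_halfSpace_re_gt _).isPreconnected
    (z₀ := ((max σ σ' + 1 : ℝ) : ℂ)) ?_ ?_ (max_lt hs hs')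
  · have h1 := le_max_left σ σ'
    have hk0 := k.cast_nonneg (α := ℝ)
    have hk0' := k'.cast_nonneg (α := ℝ)
    simp only [Set.mem_ofPred_eq, Complex.ofReal_re]
    exact max_lt (by linarith) (by linarith)
  · filter_upwards [(isOpen_lt continuous_const Complex.continuous_re).mem_nhds
      (show max σ σ' < (((max σ σ' + 1 : ℝ) : ℂ)).re by simp)] with z hz
    exact (hσ z ((le_max_left _ _).trans_lt hz)).unique (hσ' z ((le_max_right _ _).trans_lt hz))

/-- At s = 0 and k = 1 the Mellin integral is the integral of minus the derivative of ∑ d_n e^{-nτ}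
over (0, ∞), which is L - d_0. The value of the continuation at 0 is thus the Abel sum. -/
theorem IsRegularSeq.mellinSeries_one_zero (hd : IsRegularSeq d) {L : ℂ}
    (hL : Tendsto (genFun d) (𝓝[<] 1) (𝓝 L)) : mellinSeries d 1 0 = L := by
  obtain ⟨C, hC⟩ := hd.exists_bound le_rfl
  have hexp : Tendsto (fun τ : ℝ => Real.exp (-τ)) (𝓝[>] 0) (𝓝[<] 1) := by
    refine tendsto_nhdsWithin_iff.2 ⟨?_, ?_⟩
    · have : ContinuousAt (fun τ : ℝ => Real.exp (-τ)) 0 := by fun_prop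
      have h := this.tendsto.mono_left (nhdsWithin_le_nhds (s := Set.Ioi 0))
      simpa using h
    · filter_upwards [self_mem_nhdsWithin] with τ hτ
      exact (exp_neg_mem_Ioo hτ).2
  -- The value L at τ = 0 makes F continuous from the right, as the fundamental theorem of calculus
  -- requires.
  let F : ℝ → ℂ := Function.update (fun τ : ℝ => genFun d (Real.exp (-τ))) 0 L
  have hFeq {τ : ℝ} (hτ : 0 < τ) : F τ = genFun d (Real.exp (-τ)) :=
    Function.update_of_ne hτ.ne' _ _
  have hcont : ContinuousWithinAt F (Set.Ici 0) 0 := by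
    rw [continuousWithinAt_update_same, Set.Ici_sdiff_left]
    exact hL.comp hexp
  have hderiv (τ : ℝ) (hτ : τ ∈ Set.Ioi (0 : ℝ)) :
      HasDerivAt F (-genFun (mulIndex d) (Real.exp (-τ))) τ := by
    refine (hasDerivAt_genFun_exp hd.1 hτ).congr_of_eventuallyEq ?_
    filter_upwards [isOpen_Ioi.mem_nhds hτ] with x hx
    exact hFeq hx
  have hint : IntegrableOn (fun τ : ℝ => genFun (mulIndex d) (Real.exp (-τ))) (Set.Ioi 0) := by
    refine Integrable.mono' ((integrableOn_exp_neg_Ioi 0).const_mul C)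
      ((continuousOn_genFun_exp (mulIndex_mem_polyGrowth hd.1)).aestronglyMeasurable
        measurableSet_Ioi) ?_
    filter_upwards [self_mem_ae_restrict measurableSet_Ioi] with τ hτ
    exact hC τ hτ
  have htop : Tendsto F atTop (𝓝 (d 0)) := by
    obtain ⟨g, hg, -⟩ := hasDerivAt_genFun hd.1 (t := 0) (by simp)
    have h1 := hg.continuousAt.tendsto.comp Real.tendsto_exp_neg_atTop_nhds_zero
    rw [genFun_zero] at h1
    refine h1.congr' ?_
    filter_upwards [eventually_gt_atTop 0] with τ hτ
    exact (hFeq hτ).symm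
  have h := integral_Ioi_of_hasDerivAt_of_tendsto hcont hderiv hint.neg htop
  rw [integral_neg, show F 0 = L from Function.update_self _ _ _] at h
  rw [mellinSeries, zero_add, Nat.cast_one, Complex.Gamma_one, mellin]
  simp only [sub_self, Complex.cpow_zero, one_smul, Function.iterate_one, inv_one, one_mul]
  linear_combination -h

theorem IsRegularSeq.exists_isContinuation (hd : IsRegularSeq d) :
    ∃ ζ : ℂ → ℂ, Differentiable ℂ ζ ∧ IsContinuation d ζ ∧
      ∀ L : ℂ, Tendsto (genFun d) (𝓝[<] 1) (𝓝 L) → ζ 0 = L := by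
  -- The index ⌈|Re s|⌉ + 1 guarantees -k < Re s; locally it may be replaced by a fixed k.
  let ζ : ℂ → ℂ := fun s => mellinSeries d (⌈|s.re|⌉₊ + 1) s
  have hζ {k : ℕ} (hk : 1 ≤ k) {s : ℂ} (hs : -(k : ℝ) < s.re) : ζ s = mellinSeries d k s := by
    refine hd.mellinSeries_eq (Nat.le_add_left 1 _) hk ?_ hs
    have h1 := Nat.le_ceil |s.re|
    have h2 := neg_abs_le s.re
    push_cast
    linarith
  have hdiff : Differentiable ℂ ζ := fun s => by
    have hs : -((⌈|s.re|⌉₊ + 1 : ℕ) : ℝ) < s.re := by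
      have h1 := Nat.le_ceil |s.re|
      have h2 := neg_abs_le s.re
      push_cast
      linarith
    refine (hd.differentiableAt_mellinSeries (Nat.le_add_left 1 _) hs).congr_of_eventuallyEq ?_
    filter_upwards [(isOpen_lt continuous_const Complex.continuous_re).mem_nhds hs] with z hz
    exact hζ (Nat.le_add_left 1 _) hz
  refine ⟨ζ, hdiff, ⟨fun s _ => (hdiff.analyticAt s).meromorphicAt, ?_⟩, fun L hL => ?_⟩
  · obtain ⟨σ, hσ0, hσ⟩ := exists_hasSum_mellinSeries hd.1 le_rfl
    refine ⟨σ, fun s hs => ⟨hdiff.analyticAt s, ?_⟩⟩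
    rw [hζ le_rfl (by push_cast; linarith)]
    exact hσ s hs
  · rw [hζ le_rfl (by simp), hd.mellinSeries_one_zero hL]

end

/-! ### A basis of eigenvectors of `D²` -/

theorem norm_single (i : Fin 2) (u : L2 ℂ) : ‖single i u‖ = ‖u‖ := by
  rw [← pow_left_inj₀ (norm_nonneg _) (norm_nonneg _) two_ne_zero,
    ← inner_self_eq_norm_sq (𝕜 := ℂ), ← inner_self_eq_norm_sq (𝕜 := ℂ), inner_single_left,
    coord_single_same]

theorem norm_testIncl_le (v : testSpace × testSpace) :
    ‖testIncl v‖ ≤ ‖(v.1 : L2 ℂ)‖ + ‖(v.2 : L2 ℂ)‖ := by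
  rw [testIncl_apply]
  refine (norm_add_le _ _).trans (le_of_eq ?_)
  rw [norm_single, norm_single]

theorem inner_single_grading_testIncl (i : Fin 2) (u : L2 ℂ) (v : testSpace × testSpace) :
    (inner ℂ (single i u) (grading (testIncl v)) : ℂ) =
      ![inner ℂ u (v.1 : L2 ℂ), -inner ℂ u (v.2 : L2 ℂ)] i := by
  have h0 : coord 0 (testIncl v) = v.1 := by
    rw [testIncl_apply, map_add, coord_single_same, coord_single_of_ne (by decide), add_zero]
  have h1 : coord 1 (testIncl v) = v.2 := by
    rw [testIncl_apply, map_add, coord_single_same, coord_single_of_ne (by decide), zero_add]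
  have h : grading (testIncl v) = single 0 (v.1 : L2 ℂ) - single 1 (v.2 : L2 ℂ) := by
    rw [← h0, ← h1]
    rfl
  rw [h, inner_single_left, map_sub]
  fin_cases i <;>
    simp [coord_single_same, coord_single_of_ne]

/-- The Hermite functions in the two components. -/
noncomputable def spinor : ℕ ⊕ ℕ → testSpace × testSpace
  | .inl n => (tHermite n, 0)
  | .inr n => (0, tHermite n)

/-- The eigenvalues of `D²` on the vectors `spinor`. -/
def level : ℕ ⊕ ℕ → ℕ
  | .inl n => n
  | .inr n => n + 1

theorem testIncl_spinor_inl (n : ℕ) : testIncl (spinor (.inl n)) = single 0 (hermiteL2 n) := by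
  rw [testIncl_apply]
  simp [spinor, tHermite]

theorem testIncl_spinor_inr (n : ℕ) : testIncl (spinor (.inr n)) = single 1 (hermiteL2 n) := by
  rw [testIncl_apply]
  simp [spinor, tHermite]

theorem orthonormal_spinor : Orthonormal ℂ fun i => testIncl (spinor i) := by
  refine ⟨fun i => ?_, fun i j hij => ?_⟩
  · rcases i with n | n
    · exact (congrArg norm (testIncl_spinor_inl n)).trans
        ((norm_single _ _).trans (norm_hermiteL2 n))
    · exact (congrArg norm (testIncl_spinor_inr n)).trans
        ((norm_single _ _).trans (norm_hermiteL2 n))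
  · rcases i with m | m <;> rcases j with n | n <;>
      simp only [testIncl_spinor_inl, testIncl_spinor_inr, inner_single_left, coord_single_same]
    · exact inner_hermiteL2_of_ne fun h => hij (congrArg _ h)
    · rw [coord_single_of_ne (by decide), inner_zero_right]
    · rw [coord_single_of_ne (by decide), inner_zero_right]
    · exact inner_hermiteL2_of_ne fun h => hij (congrArg _ h)

/-- The Hilbert basis of `L²(ℝ, ℂ²)` of Hermite functions. -/
noncomputable def spinorBasis : HilbertBasis (ℕ ⊕ ℕ) ℂ (L2 C2) :=
  HilbertBasis.mkOfOrthogonalEqBot orthonormal_spinor <| by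
    rw [Submodule.eq_bot_iff]
    intro u hu
    have h (i : ℕ ⊕ ℕ) : (inner ℂ (testIncl (spinor i)) u : ℂ) = 0 :=
      Submodule.mem_orthogonal _ _ |>.1 hu _ (Submodule.subset_span ⟨i, rfl⟩)
    rw [← single_coord_add u, eq_zero_of_inner_hermiteL2 (u := coord 0 u) fun n => ?_,
      eq_zero_of_inner_hermiteL2 (u := coord 1 u) fun n => ?_, map_zero, map_zero, add_zero]
    · rw [← inner_single_left, ← testIncl_spinor_inr]
      exact h _
    · rw [← inner_single_left, ← testIncl_spinor_inl]
      exact h _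

theorem spinorBasis_apply (i : ℕ ⊕ ℕ) : spinorBasis i = testIncl (spinor i) := by
  rw [spinorBasis, HilbertBasis.coe_mkOfOrthogonalEqBot]

theorem blockEuler_sq_spinor (i : ℕ ⊕ ℕ) :
    (blockEuler * blockEuler) (spinor i) = (level i : ℂ) • spinor i := by
  rw [blockEuler_mul_blockEuler, block_apply]
  rcases i with n | n
  · simp only [spinor, level, Prod.smul_mk, smul_zero]
    simpa using tRaise_tLower_tHermite n
  · have h := tRaise_tLower_tHermite n
    simp only [spinor, level, Prod.smul_mk, smul_zero]
    simp [h, add_smul]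

theorem spinorBasis_mem_eigenspace (i : ℕ ⊕ ℕ) :
    spinorBasis i ∈ eigenspace (comp euler euler) (level i) := by
  rw [spinorBasis_apply]
  obtain ⟨h, h'⟩ := (actsOn_euler.comp actsOn_euler).apply (spinor i)
  refine ⟨h, ?_⟩
  rw [h', blockEuler_sq_spinor, map_smul, Complex.ofReal_natCast]

/-! ### Supertraces -/

/-- The supertraces on the eigenspaces of `D²` of the operator `T_w P 𝐑_φ`, where `q = e^{-iφ}` and
the matrix `P` of words has diagonal entries `p` and `p'`. -/
noncomputable def superCoeff (w q : ℂ) (p p' : TestEnd) : ℕ → ℂ :=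
  wordCoeff w q p - q • shiftSeq (wordCoeff w q p')

theorem norm_exp_neg_I_mul (φ : ℝ) : ‖Complex.exp (-(Complex.I * φ))‖ = 1 := by
  rw [show -(Complex.I * (φ : ℂ)) = ((-φ : ℝ) : ℂ) * Complex.I by push_cast; ring,
    Complex.norm_exp_ofReal_mul_I]

section

variable {X : L2 C2 →ₗ.[ℂ] L2 C2} {c w : ℂ} {φ : ℝ} {p : Fin 2 → Fin 2 → TestEnd} {d : ℕ}

theorem blockWord_spinor_inl (c w : ℂ) (φ : ℝ) (p : Fin 2 → Fin 2 → TestEnd) (n : ℕ) :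
    (c • (blockWeyl w * block p * blockFrac φ)) (spinor (.inl n)) =
      (c * Complex.exp (-(Complex.I * φ)) ^ n) • (tWeyl w (p 0 0 (tHermite n)),
        tWeyl w (p 1 0 (tHermite n))) := by
  rw [LinearMap.smul_apply, Module.End.mul_apply, Module.End.mul_apply, blockFrac, blockWeyl,
    block_apply, block_apply, block_apply]
  simp [spinor, tFrac_tHermite, smul_smul]

theorem blockWord_spinor_inr (c w : ℂ) (φ : ℝ) (p : Fin 2 → Fin 2 → TestEnd) (n : ℕ) :
    (c • (blockWeyl w * block p * blockFrac φ)) (spinor (.inr n)) =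
      (c * Complex.exp (-(Complex.I * φ)) ^ (n + 1)) • (tWeyl w (p 0 1 (tHermite n)),
        tWeyl w (p 1 1 (tHermite n))) := by
  rw [LinearMap.smul_apply, Module.End.mul_apply, Module.End.mul_apply, blockFrac, blockWeyl,
    block_apply, block_apply, block_apply]
  simp [spinor, tFrac_tHermite, smul_smul, pow_succ, mul_comm]

theorem norm_mem_polyGrowth {p : TestEnd} (hp : p ∈ growthEnd) :
    (fun n => (‖(p (tHermite n) : L2 ℂ)‖ : ℂ)) ∈ polyGrowth := by
  obtain ⟨K, N, hK, h⟩ := hp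
  refine ⟨K, N, hK, fun n => ?_⟩
  rw [Complex.norm_real, norm_norm]
  exact h n

/-- The trace is taken in the Hermite basis. The vector (0, h_n) lies on level n+1 and 𝐑_φ
multiplies it by q^{n+1}, so the second component enters with the opposite sign, one additional
factor q and the index shifted by one. -/
theorem isSuperZeta_of_actsOn
    (hX : ActsOn testIncl X (c • (blockWeyl w * block p * blockFrac φ)))
    (hp : ∀ i j, p i j ∈ ladderWords d) {ζ : ℂ → ℂ}
    (hζ : IsContinuation
      (c • superCoeff w (Complex.exp (-(Complex.I * φ))) (p 0 0) (p 1 1)) ζ) :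
    IsSuperZeta grading euler X ζ := by
  set q := Complex.exp (-(Complex.I * φ)) with hq_def
  have hq : ‖q‖ = 1 := norm_exp_neg_I_mul φ
  obtain ⟨hmero, σ, hσ⟩ := hζ
  have hgrow (i j) : p i j ∈ growthEnd := ladderWords_le_growthEnd d (hp i j)
  have hnorm (i j) := norm_mem_polyGrowth (hgrow i j)
  have hword (i) := wordCoeff_mem_polyGrowth hq w (hgrow i i)
  -- The bounds σ₁, σ₂ secure nuclear convergence on the two components; σ₃, σ₄ secure the two
  -- diagonal sums separately, so that the sum over levels can be split.
  obtain ⟨σ₁, hσ₁⟩ := exists_summable_regPow_mul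
    (polyGrowth.add_mem (hnorm 0 0) (hnorm 1 0))
  obtain ⟨σ₂, hσ₂⟩ := exists_summable_regPow_mul
    (shiftSeq_mem_polyGrowth (polyGrowth.add_mem (hnorm 0 1) (hnorm 1 1)))
  obtain ⟨σ₃, hσ₃⟩ := exists_summable_regPow_mul (polyGrowth.smul_mem c (hword 0))
  obtain ⟨σ₄, hσ₄⟩ := exists_summable_regPow_mul
    (polyGrowth.smul_mem (c * q) (shiftSeq_mem_polyGrowth (hword 1)))
  refine ⟨hmero, max σ (max (max σ₁ σ₂) (max σ₃ σ₄)), fun s hs => ?_⟩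
  simp only [max_lt_iff] at hs
  obtain ⟨hs0, ⟨hs1, hs2⟩, hs3, hs4⟩ := hs
  refine ⟨(hσ s hs0).1, ?_⟩
  have hnormsum (u v : L2 ℂ) : ‖((‖u‖ : ℂ) + (‖v‖ : ℂ))‖ = ‖u‖ + ‖v‖ := by
    rw [← Complex.ofReal_add, Complex.norm_real, Real.norm_of_nonneg (by positivity)]
  refine hasTrace_comp_functionOf Equiv.natSumNatEquivNat spinorBasis euler_sq_symmetric
    spinorBasis_mem_eigenspace (regPow s) grading X
    (fun i => testIncl ((c • (blockWeyl w * block p * blockFrac φ)) (spinor i)))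
    (fun i => ?_) (fun i => ?_) ?_ ?_
  · rw [spinorBasis_apply]
    exact hX.apply _
  · obtain ⟨g, hg⟩ := hX.adjoint (spinor i)
    exact ⟨testIncl g, fun x => by rw [spinorBasis_apply]; exact hg x⟩
  · refine Summable.sum _ ?_ ?_
    · refine Summable.of_nonneg_of_le (fun n => by simp only [Function.comp_apply]; positivity)
        (fun n => ?_) ((hσ₁ s hs1).mul_left ‖c‖)
      simp only [Function.comp_apply, blockWord_spinor_inl, level]
      rw [map_smul, norm_smul, norm_mul, norm_pow, ← hq_def, hq, one_pow, mul_one,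
        mul_left_comm]
      refine mul_le_mul_of_nonneg_left (mul_le_mul_of_nonneg_left ?_ (norm_nonneg _))
        (norm_nonneg _)
      refine (norm_testIncl_le _).trans (le_of_eq ?_)
      rw [Pi.add_apply, hnormsum, coe_tWeyl, coe_tWeyl, norm_weyl, norm_weyl]
    · refine Summable.of_nonneg_of_le (fun n => by simp only [Function.comp_apply]; positivity)
        (fun n => ?_) (((summable_nat_add_iff 1).2 (hσ₂ s hs2)).mul_left ‖c‖)
      simp only [Function.comp_apply, blockWord_spinor_inr, level]
      rw [map_smul, norm_smul, norm_mul, norm_pow, ← hq_def, hq, one_pow, mul_one,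
        mul_left_comm]
      refine mul_le_mul_of_nonneg_left (mul_le_mul_of_nonneg_left ?_ (norm_nonneg _))
        (norm_nonneg _)
      refine (norm_testIncl_le _).trans (le_of_eq ?_)
      rw [shiftSeq_succ, Pi.add_apply, hnormsum, coe_tWeyl, coe_tWeyl, norm_weyl, norm_weyl]
  · have h3 : Summable fun n : ℕ => regPow s n * (c • wordCoeff w q (p 0 0)) n :=
      Summable.of_norm (by simpa only [norm_mul] using hσ₃ s hs3)
    have h4 : Summable fun n : ℕ => regPow s n * ((c * q) • shiftSeq (wordCoeff w q (p 1 1))) n :=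
      Summable.of_norm (by simpa only [norm_mul] using hσ₄ s hs4)
    -- Removing the vanishing term at level 0 of the shifted sequence reindexes it by the Hermite
    -- functions of the second component.
    have h5 := (hasSum_nat_add_iff' 1).2 h4.hasSum
    rw [Finset.sum_range_one, Pi.smul_apply, shiftSeq_zero, smul_zero, mul_zero, sub_zero] at h5
    have h6 : HasSum (fun n : ℕ => regPow s n * (c • superCoeff w q (p 0 0) (p 1 1)) n)
        (∑' n : ℕ, regPow s n * (c • wordCoeff w q (p 0 0)) n +
          -∑' n : ℕ, regPow s n * ((c * q) • shiftSeq (wordCoeff w q (p 1 1))) n) := by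
      convert h3.hasSum.add h4.hasSum.neg using 1
      funext n
      rw [superCoeff, smul_sub, smul_smul, Pi.sub_apply]
      ring
    rw [(hσ s hs0).2.unique h6]
    refine HasSum.sum ?_ ?_
    · refine h3.hasSum.congr_fun fun n => ?_
      simp only [Function.comp_apply, blockWord_spinor_inl, level]
      rw [spinorBasis_apply, testIncl_spinor_inl, map_smul, map_smul, inner_smul_right,
        inner_single_grading_testIncl, Pi.smul_apply, wordCoeff_apply, smul_eq_mul, mul_assoc c]
      rfl
    · refine h5.neg.congr_fun fun n => ?_
      simp only [Function.comp_apply, blockWord_spinor_inr, level]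
      rw [spinorBasis_apply, testIncl_spinor_inr, map_smul, map_smul, inner_smul_right,
        inner_single_grading_testIncl, Pi.smul_apply, shiftSeq_succ, wordCoeff_apply, smul_eq_mul,
        pow_succ]
      change _ * (_ * -inner ℂ (hermiteL2 n) ((tWeyl w * p 1 1) (tHermite n) : L2 ℂ)) = _
      ring

end

/-! ### Regularity of the sequence of supertraces -/

/-- The sequences all of whose multiples by powers of the index are tame. -/
def deepTame (q : ℂ) : Submodule ℂ (ℕ → ℂ) :=
  ⨅ k : ℕ, (tame q).comap (mulIndex ^ k : Module.End ℂ (ℕ → ℂ))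

theorem mem_deepTame {q : ℂ} {c : ℕ → ℂ} : c ∈ deepTame q ↔ ∀ k, mulIndex^[k] c ∈ tame q := by
  simp only [deepTame, Submodule.mem_iInf, Submodule.mem_comap, Module.End.pow_apply]

theorem mulIndex_mem_deepTame {q : ℂ} {c : ℕ → ℂ} (hc : c ∈ deepTame q) :
    mulIndex c ∈ deepTame q :=
  mem_deepTame.2 fun k => by
    rw [← Function.iterate_succ_apply]
    exact mem_deepTame.1 hc (k + 1)

theorem mulIndex_shiftSeq (c : ℕ → ℂ) : mulIndex (shiftSeq c) = shiftSeq (c + mulIndex c) := by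
  funext n
  cases n with
  | zero => simp [mulIndex_apply]
  | succ n =>
    rw [mulIndex_apply, shiftSeq_succ, shiftSeq_succ, Pi.add_apply, mulIndex_apply]
    push_cast
    ring

theorem shiftSeq_mem_deepTame {q : ℂ} {c : ℕ → ℂ} (hc : c ∈ deepTame q) :
    shiftSeq c ∈ deepTame q := by
  refine mem_deepTame.2 fun k => ?_
  induction k generalizing c with
  | zero => exact shiftSeq_mem_tame (mem_deepTame.1 hc 0)
  | succ k ih =>
    rw [Function.iterate_succ_apply, mulIndex_shiftSeq]
    exact ih ((deepTame q).add_mem hc (mulIndex_mem_deepTame hc))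

/-- Multiplication of the coefficients by n amounts to multiplying the word by a*a on the right, so
tameness for all words already includes all powers of n. -/
theorem wordCoeff_mem_deepTame {w q : ℂ} (hq : ‖q‖ = 1) (h : q ≠ 1 ∨ w ≠ 0) {d : ℕ}
    {p : TestEnd} (hp : p ∈ ladderWords d) : wordCoeff w q p ∈ deepTame q := by
  refine mem_deepTame.2 fun k => ?_
  induction k generalizing d p with
  | zero => exact wordCoeff_mem_tame hq h hp
  | succ k ih =>
    rw [Function.iterate_succ_apply, ← wordCoeff_mul_number]
    exact ih (mul_mem_ladderWords hp
      (mul_mem_ladderWords tRaise_mem_ladderWords tLower_mem_ladderWords))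

theorem superCoeff_mem_deepTame {w q : ℂ} (hq : ‖q‖ = 1) (h : q ≠ 1 ∨ w ≠ 0) {d : ℕ}
    {p p' : TestEnd} (hp : p ∈ ladderWords d) (hp' : p' ∈ ladderWords d) :
    superCoeff w q p p' ∈ deepTame q :=
  (deepTame q).sub_mem (wordCoeff_mem_deepTame hq h hp)
    ((deepTame q).smul_mem q (shiftSeq_mem_deepTame (wordCoeff_mem_deepTame hq h hp')))

theorem isRegularSeq_of_mem_deepTame {q : ℂ} {c : ℕ → ℂ} (hc : c ∈ deepTame q) :
    IsRegularSeq c := by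
  refine ⟨(mem_deepTame.1 hc 0).1, fun k _ => ?_⟩
  obtain ⟨B, hB⟩ := (mem_deepTame.1 hc k).2 0
  exact ⟨B, fun t ht => by simpa using hB t ht⟩

/-! ### The component `Ψ₀` -/

theorem exp_neg_I_mul_eq_one_iff {φ : ℂ} :
    Complex.exp (-(Complex.I * φ)) = 1 ↔ Complex.exp (Complex.I * φ) = 1 := by
  rw [Complex.exp_neg, inv_eq_one]

theorem isPsiZero_of_isSuperZeta {γ : L2 C2 →L[ℂ] L2 C2} {D : L2 C2 →ₗ.[ℂ] L2 C2}
    {a : oscAlgebra} {ζ : ℂ → ℂ} (h : IsSuperZeta γ D (ofBounded (a : L2 C2 →L[ℂ] L2 C2)) ζ)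
    (hζ : AnalyticAt ℂ ζ 0) : IsPsiZero γ D a (ζ 0) :=
  ⟨ζ, h, hasResidue_of_analyticAt hζ (Eventually.of_forall fun z => by rw [sub_zero])⟩

theorem actsOn_weylMetaplectic_smul (z : ℂ) (φ : ℝ) :
    ActsOn testIncl (ofBounded (weylMetaplectic z φ : L2 C2 →L[ℂ] L2 C2))
      ((1 : ℂ) • (blockWeyl z * block ![![1, 0], ![0, 1]] * blockFrac φ)) := by
  rw [one_smul, block_one, mul_one]
  exact actsOn_weylMetaplectic z φ

theorem identity_mem_ladderWords (i j : Fin 2) :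
    (![![1, 0], ![0, 1]] : Fin 2 → Fin 2 → TestEnd) i j ∈ ladderWords 1 := by
  fin_cases i <;> fin_cases j <;> simp [one_mem_ladderWords_one]

theorem isPsiZero_of_tendsto {z : ℂ} {φ : ℝ}
    (h : Complex.exp (-(Complex.I * φ)) ≠ 1 ∨ z ≠ 0) {L : ℂ}
    (hL : Tendsto (genFun (superCoeff z (Complex.exp (-(Complex.I * φ))) 1 1)) (𝓝[<] 1) (𝓝 L)) :
    IsPsiZero grading euler (weylMetaplectic z φ) L := by
  have hreg := isRegularSeq_of_mem_deepTame (superCoeff_mem_deepTame (norm_exp_neg_I_mul φ) h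
    one_mem_ladderWords_one one_mem_ladderWords_one)
  obtain ⟨ζ, hζ, hcont, hval⟩ := hreg.exists_isContinuation
  rw [← hval L hL]
  refine isPsiZero_of_isSuperZeta (isSuperZeta_of_actsOn (actsOn_weylMetaplectic_smul z φ)
    identity_mem_ladderWords ?_) (hζ.analyticAt 0)
  rw [one_smul]
  exact hcont

/-- Tameness with exponent 1 bounds the generating function by a multiple of 1-t, so the Abel limit
is 0. -/
theorem isPsiZero_translation {z : ℂ} {φ : ℝ} (hφ : Complex.exp (Complex.I * φ) = 1)
    (hz : z ≠ 0) : IsPsiZero grading euler (weylMetaplectic z φ) 0 := by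
  have hq := exp_neg_I_mul_eq_one_iff.2 hφ
  refine isPsiZero_of_tendsto (Or.inr hz) ?_
  have h1 : superCoeff z 1 1 1 ∈ tame 1 :=
    mem_deepTame.1 (superCoeff_mem_deepTame norm_one (Or.inr hz) one_mem_ladderWords_one
      one_mem_ladderWords_one) 0
  obtain ⟨B, hB⟩ := h1.2 1
  rw [hq]
  refine squeeze_zero_norm' (a := fun t : ℝ => B * ‖1 - 1 * (t : ℂ)‖ ^ 1) ?_ ?_
  · filter_upwards [Ioo_mem_nhdsLT (zero_lt_one' ℝ)] with t ht
    exact hB t ht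
  · have : ContinuousAt (fun t : ℝ => B * ‖1 - 1 * (t : ℂ)‖ ^ 1) 1 := by fun_prop
    have h := this.tendsto.mono_left (nhdsWithin_le_nhds (s := Set.Iio 1))
    simpa using h

theorem wordCoeff_zero_one_one (n : ℕ) : wordCoeff 0 1 1 n = 1 := by
  rw [wordCoeff_apply, tWeyl_zero, one_pow, one_mul, one_mul]
  change inner ℂ (hermiteL2 n) (hermiteL2 n) = (1 : ℂ)
  rw [inner_self_eq_norm_sq_to_K, norm_hermiteL2]
  simp

/-- The two components cancel on every level n ≥ 1. Only the one-dimensional kernel of D remains,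
and the zeta function is constantly 1. -/
theorem isPsiZero_one {φ : ℝ} (hφ : Complex.exp (Complex.I * φ) = 1) :
    IsPsiZero grading euler (weylMetaplectic 0 φ) 1 := by
  have hq := exp_neg_I_mul_eq_one_iff.2 hφ
  refine isPsiZero_of_isSuperZeta (ζ := fun _ => 1) (isSuperZeta_of_actsOn
    (actsOn_weylMetaplectic_smul 0 φ) identity_mem_ladderWords
      ⟨fun s _ => analyticAt_const.meromorphicAt, 0, fun s _ => ⟨analyticAt_const, ?_⟩⟩) analyticAt_const
  rw [one_smul, hq]
  have h := hasSum_ite_eq (0 : ℕ) (1 : ℂ)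
  refine h.congr_fun fun n => ?_
  change _ * superCoeff 0 1 1 1 n = _
  rw [superCoeff, Pi.sub_apply, Pi.smul_apply, wordCoeff_zero_one_one]
  cases n with
  | zero => simp [regPow]
  | succ n => simp [wordCoeff_zero_one_one]

/-- Passing to the supertrace multiplies by 1-qt, which cancels the pole factor of the Laguerre
generating function. -/
theorem genFun_superCoeff_one {q : ℂ} (hq : ‖q‖ = 1) (w : ℂ) {t : ℝ}
    (ht : t ∈ Set.Ioo (0 : ℝ) 1) :
    genFun (superCoeff w q 1 1) t = Complex.exp (-(Complex.normSq w) / 4) *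
      Complex.exp (-(((Complex.normSq w / 2 : ℝ) : ℂ) * (q * t / (1 - q * t)))) := by
  have ht' : |t| < 1 := by rw [abs_of_pos ht.1]; exact ht.2
  have hg : wordCoeff w q 1 ∈ polyGrowth :=
    wordCoeff_mem_polyGrowth hq w (ladderWords_le_growthEnd 1 one_mem_ladderWords_one)
  have hne := one_sub_mul_ne_zero hq ht'
  rw [superCoeff, genFun_sub hg (polyGrowth.smul_mem _ (shiftSeq_mem_polyGrowth hg)) ht',
    genFun_smul, genFun_shiftSeq hg ht', genFun_wordCoeff_one hq w ht]
  field_simp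

theorem isPsiZero_rotation {z : ℂ} {φ : ℝ} (hφ : Complex.exp (Complex.I * φ) ≠ 1) :
    IsPsiZero grading euler (weylMetaplectic z φ)
      (Complex.exp (Complex.I / 4 * Complex.normSq z * Complex.cot (φ / 2))) := by
  have hq : Complex.exp (-(Complex.I * φ)) ≠ 1 := mt exp_neg_I_mul_eq_one_iff.1 hφ
  refine isPsiZero_of_tendsto (Or.inl hq) ?_
  set q := Complex.exp (-(Complex.I * φ)) with hq_def
  have hq1 : 1 - q * ((1 : ℝ) : ℂ) ≠ 0 := by
    rw [Complex.ofReal_one, mul_one]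
    exact sub_ne_zero.2 hq.symm
  have hcont : ContinuousAt (fun t : ℝ => Complex.exp (-(Complex.normSq z) / 4) *
      Complex.exp (-(((Complex.normSq z / 2 : ℝ) : ℂ) * (q * t / (1 - q * t))))) 1 := by
    fun_prop (disch := exact hq1)
  have h := hcont.tendsto.mono_left (nhdsWithin_le_nhds (s := Set.Iio 1))
  -- The exponent is -(|z|²/4)(1+q)/(1-q), and cot(φ/2) = i(1+q)/(1-q) for q = e^{-iφ}.
  have hval : Complex.exp (-(Complex.normSq z) / 4) *
      Complex.exp (-(((Complex.normSq z / 2 : ℝ) : ℂ) * (q * (1 : ℝ) / (1 - q * (1 : ℝ))))) =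
      Complex.exp (Complex.I / 4 * Complex.normSq z * Complex.cot (φ / 2)) := by
    rw [← Complex.exp_add, Complex.cot_eq_exp_ratio,
      show 2 * Complex.I * ((φ : ℂ) / 2) = Complex.I * φ by ring]
    have hinv : Complex.exp (Complex.I * φ) = q⁻¹ := by rw [hq_def, Complex.exp_neg, inv_inv]
    have hq0 : q ≠ 0 := Complex.exp_ne_zero _
    have h1 : 1 - q ≠ 0 := sub_ne_zero.2 hq.symm
    have h2 : q - 1 ≠ 0 := sub_ne_zero.2 hq
    have h3 : 1 - q⁻¹ = (q - 1) / q := by field_simp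
    rw [hinv, h3]
    congr 1
    push_cast
    rw [mul_one, ← neg_sub q 1]
    field_simp
    ring
  rw [hval] at h
  refine h.congr' ?_
  filter_upwards [Ioo_mem_nhdsLT (zero_lt_one' ℝ)] with t ht
  exact (genFun_superCoeff_one (norm_exp_neg_I_mul φ) z ht).symm

/-! ### The component `Ψ₂` -/

section

variable {X : L2 C2 →ₗ.[ℂ] L2 C2} {c w : ℂ} {φ : ℝ} {p : Fin 2 → Fin 2 → TestEnd} {d : ℕ}

/-- The continuation is entire, so it has no residue at any point. -/
theorem exists_isSuperZeta_of_ne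
    (hX : ActsOn testIncl X (c • (blockWeyl w * block p * blockFrac φ)))
    (hp : ∀ i j, p i j ∈ ladderWords d) (h : Complex.exp (Complex.I * φ) ≠ 1 ∨ w ≠ 0) :
    ∃ ζ : ℂ → ℂ, IsSuperZeta grading euler X ζ ∧
      ∀ m : ℂ, HasResidue (fun z => ζ (m + z)) 0 0 := by
  have hreg := isRegularSeq_of_mem_deepTame ((deepTame _).smul_mem c (superCoeff_mem_deepTame
    (norm_exp_neg_I_mul φ) (h.imp_left (mt exp_neg_I_mul_eq_one_iff.1)) (hp 0 0) (hp 1 1)))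
  obtain ⟨ζ, hζ, hcont, -⟩ := hreg.exists_isContinuation
  refine ⟨ζ, isSuperZeta_of_actsOn hX hp hcont, fun m => hasResidue_zero ?_⟩
  exact (hζ.comp (differentiable_id.const_add m)).analyticAt 0

/-- On level n ≥ 1 the second component contributes h_{n-1}, hence the polynomial P'(X-1). Level 0
may deviate from this formula and adds only a constant. -/
theorem exists_isSuperZeta_of_eq
    (hX : ActsOn testIncl X (c • (blockWeyl 0 * block p * blockFrac φ)))
    (hp : ∀ i j, p i j ∈ ladderWords d) (hφ : Complex.exp (Complex.I * φ) = 1)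
    {P P' : Polynomial ℂ} (hP : ∀ n : ℕ, wordCoeff 0 1 (p 0 0) n = P.eval (n : ℂ))
    (hP' : ∀ n : ℕ, wordCoeff 0 1 (p 1 1) n = P'.eval (n : ℂ)) {m : ℕ} (hm : P.natDegree ≤ m)
    (hm' : P'.natDegree ≤ m) :
    ∃ ζ : ℂ → ℂ, IsSuperZeta grading euler X ζ ∧
      HasResidue (fun z => ζ ((m + 1 : ℕ) + z)) 0
        (c * (P.coeff m - (P'.comp (Polynomial.X - 1)).coeff m)) := by
  have hX1 : (Polynomial.X - 1 : Polynomial ℂ).natDegree = 1 := by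
    simpa using Polynomial.natDegree_X_sub_C (1 : ℂ)
  obtain ⟨ζ, hζ, hres⟩ := exists_isContinuation_of_eval
    (d := c • superCoeff 0 (Complex.exp (-(Complex.I * φ))) (p 0 0) (p 1 1))
    (c • (P - P'.comp (Polynomial.X - 1))) fun n hn => by
      obtain ⟨n, rfl⟩ := Nat.exists_eq_succ_of_ne_zero hn
      rw [exp_neg_I_mul_eq_one_iff.2 hφ, superCoeff, one_smul, Pi.smul_apply, Pi.sub_apply, hP,
        shiftSeq_succ, hP', Polynomial.eval_smul, Polynomial.eval_sub, Polynomial.eval_comp]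
      simp
  refine ⟨ζ, isSuperZeta_of_actsOn hX hp hζ, ?_⟩
  have hdeg : (c • (P - P'.comp (Polynomial.X - 1))).natDegree ≤ m := by
    refine (Polynomial.natDegree_smul_le _ _).trans ((Polynomial.natDegree_sub_le _ _).trans ?_)
    refine max_le hm ?_
    rw [Polynomial.natDegree_comp, hX1, mul_one]
    exact hm'
  have h := hres m hdeg
  rwa [Polynomial.coeff_smul, Polynomial.coeff_sub, smul_eq_mul] at h

/-- A pole at d+1 would come from the coefficient of n^d, but the degrees are at most d/2 < d. -/
theorem exists_isSuperZeta_of_lt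
    (hX : ActsOn testIncl X (c • (blockWeyl 0 * block p * blockFrac φ)))
    (hp : ∀ i j, p i j ∈ ladderWords d) (hφ : Complex.exp (Complex.I * φ) = 1) (hd : 0 < d) :
    ∃ ζ : ℂ → ℂ, IsSuperZeta grading euler X ζ ∧
      HasResidue (fun z => ζ ((d + 1 : ℕ) + z)) 0 0 := by
  obtain ⟨P, hPd, hP⟩ := wordCoeff_mem_polySeq (hp 0 0)
  obtain ⟨P', hPd', hP'⟩ := wordCoeff_mem_polySeq (hp 1 1)
  obtain ⟨ζ, hζ, hres⟩ := exists_isSuperZeta_of_eq hX hp hφ hP hP' (m := d) (by omega) (by omega)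
  refine ⟨ζ, hζ, ?_⟩
  have hX1 : (Polynomial.X - 1 : Polynomial ℂ).natDegree = 1 := by
    simpa using Polynomial.natDegree_X_sub_C (1 : ℂ)
  rwa [Polynomial.coeff_eq_zero_of_natDegree_lt (show P.natDegree < d by omega),
    Polynomial.coeff_eq_zero_of_natDegree_lt, sub_self, mul_zero] at hres
  rw [Polynomial.natDegree_comp, hX1, mul_one]
  omega

/-- Every level n ≥ 1 has supertrace c(a-b), so the pole at 1 is that of c(a-b)ζ(s). -/
theorem exists_isSuperZeta_of_scalar {a b : ℂ} {p' p'' : TestEnd}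
    (hX : ActsOn testIncl X (c • (blockWeyl 0 * block ![![a • 1, p'], ![p'', b • 1]] *
      blockFrac φ))) (hp' : p' ∈ ladderWords 0) (hp'' : p'' ∈ ladderWords 0)
    (hφ : Complex.exp (Complex.I * φ) = 1) :
    ∃ ζ : ℂ → ℂ, IsSuperZeta grading euler X ζ ∧
      HasResidue (fun z => ζ ((0 + 1 : ℕ) + z)) 0 (c * (a - b)) := by
  have h (a : ℂ) (n : ℕ) : wordCoeff 0 1 (a • 1) n = (Polynomial.C a).eval (n : ℂ) := by
    rw [map_smul, Pi.smul_apply, wordCoeff_zero_one_one, smul_eq_mul, mul_one, Polynomial.eval_C]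
  have hp (i j : Fin 2) :
      (![![a • 1, p'], ![p'', b • 1]] : Fin 2 → Fin 2 → TestEnd) i j ∈ ladderWords 0 := by
    fin_cases i <;> fin_cases j
    · exact smul_one_mem_ladderWords _ _
    · exact hp'
    · exact hp''
    · exact smul_one_mem_ladderWords _ _
  obtain ⟨ζ, hζ, hres⟩ := exists_isSuperZeta_of_eq hX hp hφ (h a) (h b) (m := 0) (by simp)
    (by simp)
  exact ⟨ζ, hζ, by simpa using hres⟩

end

theorem isBlockWord_cochain (w₁ w₂ : ℂ) (m n : ℕ) : IsBlockWord (m + n)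
    (blockWeyl (-w₂) * shiftWord w₁ m * blockWeyl w₂ * shiftWord w₂ n) :=
  ((isBlockWord_shiftWord w₁ m).conj w₂).mul (isBlockWord_shiftWord w₂ n)

/-- For α = 0 both words are constant off-diagonal matrices: conjugation by T_{w₂} does nothing, and
their product is diagonal. -/
theorem cochain_zero_eq (w₁ w₂ : ℂ) :
    blockWeyl (-w₂) * shiftWord w₁ 0 * blockWeyl w₂ * shiftWord w₂ 0 =
      block ![![(w₁ * (starRingEnd ℂ) w₂ / 2) • 1, 0], ![0, ((starRingEnd ℂ) w₁ * w₂ / 2) • 1]] := by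
  have h2 : (1 / Real.sqrt 2 : ℂ) * (1 / Real.sqrt 2) = 1 / 2 := inv_sqrt_two_mul_self
  rw [shiftWord, shiftWord, blockWeyl, blockWeyl, blockShift, blockShift, block_mul, block_mul,
    block_mul]
  refine block_congr fun i j => ?_
  have e (x y : ℂ) : (1 / Real.sqrt 2 : ℂ) * x * ((1 / Real.sqrt 2 : ℂ) * y) = x * y / 2 := by
    linear_combination (x * y) * h2
  fin_cases i <;> fin_cases j
  · simp [tWeyl_neg_mul_tWeyl, smul_smul]
    rw [← e]
    simp only [one_div]
    congr 1
    ring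
  · simp
  · simp
  · simp [tWeyl_neg_mul_tWeyl, smul_smul]
    rw [← e]
    simp only [one_div]
    congr 1
    ring

theorem isPsi_zero_of_ne (z₀ z₁ z₂ : ℂ) (φ₀ φ₁ φ₂ : ℝ)
    (h : Complex.exp (Complex.I * (φ₀ + φ₁ + φ₂)) ≠ 1 ∨
      z₀ + Complex.exp (Complex.I * φ₀) * z₁ + Complex.exp (Complex.I * (φ₀ + φ₁)) * z₂ ≠ 0) :
    IsPsi grading euler 1
      ![weylMetaplectic z₀ φ₀, weylMetaplectic z₁ φ₁, weylMetaplectic z₂ φ₂] 0 := by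
  refine ⟨fun _ => 0, fun α => ?_, by simp⟩
  have hX := actsOn_cochainOp z₀ z₁ z₂ φ₀ φ₁ φ₂ α rfl rfl
  obtain ⟨p, hp, hpe⟩ := isBlockWord_cochain (Complex.exp (Complex.I * φ₀) * z₁)
    (Complex.exp (Complex.I * ((φ₀ + φ₁ : ℝ) : ℂ)) * z₂) (α 0) (α 1)
  rw [hpe] at hX
  obtain ⟨ζ, hζ, hres⟩ := exists_isSuperZeta_of_ne hX hp (by push_cast; exact h)
  exact ⟨ζ, hζ, hres _⟩

theorem cocycleCoeff_one_zero : cocycleCoeff 1 0 = 1 / 2 := by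
  simp [cocycleCoeff, Fin.prod_univ_two]
  norm_num

theorem isPsi_of_eq (z₀ z₁ z₂ : ℂ) (φ₀ φ₁ φ₂ : ℝ)
    (hφ : Complex.exp (Complex.I * (φ₀ + φ₁ + φ₂)) = 1)
    (hz : z₀ + Complex.exp (Complex.I * φ₀) * z₁ + Complex.exp (Complex.I * (φ₀ + φ₁)) * z₂ = 0)
    (ε : ℝ) (hε : ε = (Complex.exp (Complex.I * φ₀) * z₁ * (starRingEnd ℂ) z₀ +
      Complex.exp (Complex.I * φ₁) * z₂ * (starRingEnd ℂ) z₁ +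
        Complex.exp (Complex.I * (φ₀ + φ₁)) * z₂ * (starRingEnd ℂ) z₀).im / 2) :
    IsPsi grading euler 1
      ![weylMetaplectic z₀ φ₀, weylMetaplectic z₁ φ₁, weylMetaplectic z₂ φ₂]
      (Complex.exp (Complex.I * ε) / 4 *
        (z₁ * (starRingEnd ℂ) z₂ * Complex.exp (-(Complex.I * φ₁)) -
          (starRingEnd ℂ) z₁ * z₂ * Complex.exp (Complex.I * φ₁))) := by
  obtain ⟨w₁, hw₁⟩ : ∃ w₁, w₁ = Complex.exp (Complex.I * φ₀) * z₁ := ⟨_, rfl⟩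
  obtain ⟨w₂, hw₂⟩ : ∃ w₂, w₂ = Complex.exp (Complex.I * ((φ₀ + φ₁ : ℝ) : ℂ)) * z₂ := ⟨_, rfl⟩
  have hw : z₀ + w₁ + w₂ = 0 := by rw [hw₁, hw₂]; push_cast; exact hz
  have hX (α : Fin (2 * 1) → ℕ) := actsOn_cochainOp z₀ z₁ z₂ φ₀ φ₁ φ₂ α hw₁ hw₂
  rw [hw] at hX
  have hφ' : Complex.exp (Complex.I * ((φ₀ + φ₁ + φ₂ : ℝ) : ℂ)) = 1 := by push_cast; exact hφ
  have hconj (φ : ℝ) : (starRingEnd ℂ) (Complex.exp (Complex.I * φ)) =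
      Complex.exp (-(Complex.I * φ)) := conj_exp_I_mul φ
  -- The rotation by φ₀ is common to w₁ and w₂ and cancels from w₂ w̄₁; only φ₁ remains.
  have h12 : w₂ * (starRingEnd ℂ) w₁ =
      Complex.exp (Complex.I * φ₁) * z₂ * (starRingEnd ℂ) z₁ := by
    rw [hw₁, hw₂, map_mul, hconj]
    have : Complex.exp (Complex.I * ((φ₀ + φ₁ : ℝ) : ℂ)) * Complex.exp (-(Complex.I * φ₀)) =
        Complex.exp (Complex.I * φ₁) := by
      rw [← Complex.exp_add]
      congr 1
      push_cast
      ring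
    linear_combination (z₂ * (starRingEnd ℂ) z₁) * this
  have h21 : w₁ * (starRingEnd ℂ) w₂ =
      z₁ * (starRingEnd ℂ) z₂ * Complex.exp (-(Complex.I * φ₁)) := by
    have := congrArg (starRingEnd ℂ) h12
    simp only [map_mul, Complex.conj_conj, hconj] at this
    linear_combination this
  have hphase : Complex.exp (Complex.I * ((w₁ * (starRingEnd ℂ) z₀).im / 2 +
      (w₂ * (starRingEnd ℂ) (z₀ + w₁)).im / 2)) = Complex.exp (Complex.I * ε) := by
    have h1 : w₂ * (starRingEnd ℂ) z₀ =
        Complex.exp (Complex.I * (φ₀ + φ₁)) * z₂ * (starRingEnd ℂ) z₀ := by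
      rw [hw₂]
      push_cast
      rfl
    rw [hε, ← hw₁, ← h12, ← h1, map_add, mul_add w₂, Complex.add_im, Complex.add_im, Complex.add_im]
    congr 2
    push_cast
    ring
  rw [hphase] at hX
  obtain ⟨v, hv⟩ : ∃ v, v = Complex.exp (Complex.I * ε) *
      (w₁ * (starRingEnd ℂ) w₂ / 2 - (starRingEnd ℂ) w₁ * w₂ / 2) := ⟨_, rfl⟩
  -- Only α = 0 has a nonzero residue. The cocycle coefficient 1/2 there and the 1/2 from the two
  -- factors 1/√2 in v produce the 1/4.
  refine ⟨fun α => if α = 0 then v else 0, fun α => ?_, ?_⟩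
  · have hsum : (∑ j, α j) = α 0 + α 1 := Fin.sum_univ_two α
    beta_reduce
    split_ifs with hα
    · subst hα
      have h := hX 0
      rw [Pi.zero_apply, Pi.zero_apply, cochain_zero_eq] at h
      obtain ⟨ζ, hζ, hres⟩ := exists_isSuperZeta_of_scalar h (zero_mem _) (zero_mem _) hφ'
      refine ⟨ζ, hζ, ?_⟩
      rw [hsum, hv]
      exact hres
    · obtain ⟨p, hp, hpe⟩ := isBlockWord_cochain w₁ w₂ (α 0) (α 1)
      have h := hX α
      rw [hpe] at h
      have hpos : 0 < α 0 + α 1 := by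
        by_contra hcon
        apply hα
        funext j
        fin_cases j
        · change α 0 = 0
          omega
        · change α 1 = 0
          omega
      rw [hsum]
      exact exists_isSuperZeta_of_lt h hp hφ' hpos
  · convert hasSum_single (0 : Fin (2 * 1) → ℕ) (f := fun α => cocycleCoeff 1 α *
      if α = 0 then v else 0) (fun α hα => ?_) using 1
    · rw [if_pos rfl, cocycleCoeff_one_zero, hv, ← h21, mul_comm ((starRingEnd ℂ) w₁), h12]
      ring
    · rw [if_neg hα, mul_zero]

end Oscillator

/-! ### The two components of the cocycle. -/

theorem theorem4p2 :
    (∀ a k φ : ℝ,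
      (Complex.exp (Complex.I * φ) = 1 → ((a : ℂ) - Complex.I * k ≠ 0) →
        UnbOp.IsPsiZero Oscillator.grading Oscillator.euler
          (Oscillator.weylMetaplectic (a - Complex.I * k) φ) 0) ∧
      (Complex.exp (Complex.I * φ) = 1 → ((a : ℂ) - Complex.I * k = 0) →
        UnbOp.IsPsiZero Oscillator.grading Oscillator.euler
          (Oscillator.weylMetaplectic (a - Complex.I * k) φ) 1) ∧
      (Complex.exp (Complex.I * φ) ≠ 1 →
        UnbOp.IsPsiZero Oscillator.grading Oscillator.euler
          (Oscillator.weylMetaplectic (a - Complex.I * k) φ)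
          (Complex.exp (Complex.I / 4 * (a ^ 2 + k ^ 2) * Complex.cot (φ / 2))))) ∧
    (∀ (z₀ z₁ z₂ : ℂ) (φ₀ φ₁ φ₂ : ℝ),
      ((Complex.exp (Complex.I * (φ₀ + φ₁ + φ₂)) ≠ 1 ∨
          z₀ + Complex.exp (Complex.I * φ₀) * z₁ +
            Complex.exp (Complex.I * (φ₀ + φ₁)) * z₂ ≠ 0) →
        UnbOp.IsPsi Oscillator.grading Oscillator.euler 1
          ![Oscillator.weylMetaplectic z₀ φ₀, Oscillator.weylMetaplectic z₁ φ₁,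
            Oscillator.weylMetaplectic z₂ φ₂] 0) ∧
      (Complex.exp (Complex.I * (φ₀ + φ₁ + φ₂)) = 1 →
        z₀ + Complex.exp (Complex.I * φ₀) * z₁ +
            Complex.exp (Complex.I * (φ₀ + φ₁)) * z₂ = 0 →
        ∀ ε : ℝ,
          ε = (Complex.exp (Complex.I * φ₀) * z₁ * (starRingEnd ℂ) z₀ +
            Complex.exp (Complex.I * φ₁) * z₂ * (starRingEnd ℂ) z₁ +
            Complex.exp (Complex.I * (φ₀ + φ₁)) * z₂ * (starRingEnd ℂ) z₀).im / 2 →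
        UnbOp.IsPsi Oscillator.grading Oscillator.euler 1
          ![Oscillator.weylMetaplectic z₀ φ₀, Oscillator.weylMetaplectic z₁ φ₁,
            Oscillator.weylMetaplectic z₂ φ₂]
          (Complex.exp (Complex.I * ε) / 4 *
            (z₁ * (starRingEnd ℂ) z₂ * Complex.exp (-(Complex.I * φ₁)) -
              (starRingEnd ℂ) z₁ * z₂ * Complex.exp (Complex.I * φ₁))))) := by
  have hnorm (a k : ℝ) :
      (Complex.normSq ((a : ℂ) - Complex.I * k) : ℂ) = (a : ℂ) ^ 2 + (k : ℂ) ^ 2 := by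
    rw [← Complex.mul_conj, map_sub, map_mul, Complex.conj_I, Complex.conj_ofReal,
      Complex.conj_ofReal]
    linear_combination (-(k : ℂ) ^ 2) * Complex.I_mul_I
  refine ⟨fun a k φ => ⟨fun hφ hz => Oscillator.isPsiZero_translation hφ hz, fun hφ hz => ?_,
    fun hφ => ?_⟩, fun z₀ z₁ z₂ φ₀ φ₁ φ₂ => ⟨Oscillator.isPsi_zero_of_ne z₀ z₁ z₂ φ₀ φ₁ φ₂,
      Oscillator.isPsi_of_eq z₀ z₁ z₂ φ₀ φ₁ φ₂⟩⟩
  · rw [hz]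
    exact Oscillator.isPsiZero_one hφ
  · have h := Oscillator.isPsiZero_rotation (z := (a : ℂ) - Complex.I * k) hφ
    rwa [hnorm] at h
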